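/- **Theorem 2.1.** Work on $\mathbb T^3=\mathbb R^3/(2\pi\mathbb Z)^3$. For $x\in\mathbb C^3$ put $|x|=\sum_i|x_i|$, $|x|_e=(\sum_i|x_i|^2)^{1/2}$, $|x|_m=\max_i|x_i|$, and let $\alpha>0$ be any constant with $\alpha|x|_m\le|x|_e$ for all $x\in\mathbb C^3$. Write $(k,x)=\sum_i k_ix_i$ and $f_k=(2\pi)^{-3}\int_{\mathbb T^3}f(x)e^{-i(k,x)}\,dx$. Let $H^1(\mathbb T^3)$ be the space of (scalar or $\mathbb C^3$-valued) functions $f\in L^2(\mathbb T^3)$ of zero mean with $$\|f\|^2=\sum_{k\in\mathbb Z^3\setminus\{0\}}|k|_e^2|f_k|_e^2<\infty ,$$ where $|f_k|_e$ is the modulus of $f_k$ if $f$ is scalar. For $0<T\le\infty$ let $I_T=[0,T]$ if $T<\infty$, $I_\infty=[0,\infty)$, let $C(I_T,H^1(\mathbb T^3))$ be the space of continuous functions $V:I_T\to H^1(\mathbb T^3)$ with $\sup_{t\in I_T}\|V(t,\cdot)\|<\infty$, and let $$Q(T)=\Big\{(t,x)\ :\ t\in\mathbb C,\ x\in\mathbb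 C^3/(2\pi\mathbb Z)^3,\ |\Im t|<\Re t<T,\ \tfrac{4}{\nu\alpha}|\Im x|_m<\Re t\Big\}.$$ For every $\nu>0$ there are constants $c>0$ and $\mu>0$, depending only on $\nu$, such that the following holds for every $\hat{\mathbf v}\in H^1(\mathbb T^3)$ with values in $\mathbb C^3$ and $\operatorname{div}\hat{\mathbf v}=0$ in the sense of generalized functions. 1. Let $T=c/(1+\|\hat{\mathbf v}\|)^{16}$. Then there are holomorphic functions $\mathbf v=(v^1,v^2,v^3)$ and $p$ on $Q(T)$ with $$\mathbf v_t+\sum_{l=1}^3 v^l\partial_l\mathbf v=-\nabla p+\nu\Delta\mathbf v,\qquad \operatorname{div}\mathbf v=0\qquad\text{on }Q(T).$$ With $\mathbf v_k(t)$ the Fourier coefficients of $\mathbf v(t,\cdot)$ on $\mathbb T^3$, one has $\mathbf v(t,x)=\sum_{k\in\mathbb Z^3\setminus\{0\}}\mathbf v_k(t)e^{i(k,x)}$ (an absolutely convergent series) for $(t,x)\in Q(T)$, and $$\|\hat{\mathbf v}-\mathbf v(t,\cdot)\|\to0\quad\text{as } t\to0,\ |\Im t|<\Re t<T.$$ If $\hat{\mathbf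 v}$ is real-valued, then $\mathbf v(t,x)$ is real for real $t\in(0,T)$ and real $x$. Furthermore, there is a function $V(t,x)=\sum_{k\in\mathbb Z^3\setminus\{0\}}V_k(t)e^{i(k,x)}$ in $C(I_T,H^1(\mathbb T^3))$ with real coefficients $V_k(t)$ such that $$|\mathbf v_k(t)|\le V_k(\Re t)\,\exp\!\big(-\Re t\,|k|_e\,\nu/2\big)\qquad\text{for } |\Im t|<\Re t<T,\ k\in\mathbb Z^3\setminus\{0\}.$$ 2. If $\|\hat{\mathbf v}\|\le\mu$, then all assertions of part 1 also hold with $T=\infty$. -/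

import Mathlib

open scoped ENNReal

namespace NSTorus

noncomputable section

/-- Vector values: `ℂ³` with its Euclidean norm. -/
abbrev Vec3 : Type := EuclideanSpace ℂ (Fin 3)

/-- The norm `|x| = |x₁| + |x₂| + |x₃|`. -/
def normOne (x : Fin 3 → ℂ) : ℝ := ∑ i, ‖x i‖

/-- The Euclidean norm `|x|_e`.  The norm `|x|_m = max |x_i|` is Mathlib's norm `‖x‖` on
`Fin 3 → ℂ` (and on `Fin 3 → ℝ`). -/
def normEucl (x : Fin 3 → ℂ) : ℝ := Real.sqrt (∑ i, ‖x i‖ ^ 2)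

/-- An integer wave vector, regarded as a vector of `ℂ³`. -/
def waveVec (k : Fin 3 → ℤ) : Fin 3 → ℂ := fun i => (k i : ℂ)

/-- The character `e^{i(k,x)}` at a point `x ∈ ℂ³`. -/
def character (k : Fin 3 → ℤ) (x : Fin 3 → ℂ) : ℂ :=
  Complex.exp (Complex.I * ∑ i, (k i : ℂ) * x i)

/-- A real point, regarded as a point of `ℂ³`. -/
def realPt (x : Fin 3 → ℝ) : Fin 3 → ℂ := fun i => (x i : ℂ)

/-- A function on the torus `ℝ³/(2πℤ)³` is a function on `ℝ³` of period `2π` in each variable. -/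
def TorusPeriodic {E : Type*} (f : (Fin 3 → ℝ) → E) : Prop :=
  ∀ (x : Fin 3 → ℝ) (i : Fin 3), f (x + Pi.single i (2 * Real.pi)) = f x

/-- A fundamental cell of the torus. -/
def cell : Set (Fin 3 → ℝ) := Set.univ.pi fun _ => Set.Ioc (0 : ℝ) (2 * Real.pi)

section Sobolev

variable {E : Type*} [NormedAddCommGroup E] [NormedSpace ℂ E]

/-- The Fourier coefficient `f_k = (2π)⁻³ ∫ f(x) e^{-i(k,x)} dx`. -/
def coeff (f : (Fin 3 → ℝ) → E) (k : Fin 3 → ℤ) : E :=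
  (((2 * Real.pi) ^ 3)⁻¹ : ℂ) •
    ∫ x in cell, character (-k) (realPt x) • f x

/-- The norm `(∑ |k|_e² |f_k|²)^{1/2}` of `H¹`, with values in `[0,∞]`. -/
def h1ENorm (f : (Fin 3 → ℝ) → E) : ℝ≥0∞ :=
  (∑' k : Fin 3 → ℤ, ENNReal.ofReal (normEucl (waveVec k) ^ 2) * ‖coeff f k‖ₑ ^ 2) ^ (1 / 2 : ℝ)

/-- The Sobolev space `H¹` of zero mean functions on the torus. -/
structure MemH1 (f : (Fin 3 → ℝ) → E) : Prop where
  periodic : TorusPeriodic f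
  memLp : MeasureTheory.MemLp f 2 (MeasureTheory.volume.restrict cell)
  zero_mean : ∫ x in cell, f x = 0
  finite_norm : h1ENorm f < ∞

/-- The (finite) `H¹` norm of an element of `H¹`. -/
def h1Norm (f : (Fin 3 → ℝ) → E) : ℝ := (h1ENorm f).toReal

/-- The space `C(I, H¹)`, with finite supremum norm. -/
structure MemCH1 (I : Set ℝ) (V : ℝ → (Fin 3 → ℝ) → E) : Prop where
  memH1 : ∀ t ∈ I, MemH1 (V t)
  continuous : ∀ t₀ ∈ I,
    Filter.Tendsto (fun t => h1ENorm (fun x => V t x - V t₀ x)) (nhdsWithin t₀ I) (nhds 0)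
  bounded : ∃ M : ℝ, ∀ t ∈ I, h1ENorm (V t) ≤ ENNReal.ofReal M

end Sobolev

/-- `div u = 0` on the torus in the sense of generalized functions. -/
def WeakDivFree (u : (Fin 3 → ℝ) → Vec3) : Prop :=
  ∀ φ : (Fin 3 → ℝ) → ℂ, ContDiff ℝ (⊤ : ℕ∞) φ → TorusPeriodic φ →
    ∫ x in cell, ∑ j, u x j * fderiv ℝ φ x (Pi.single j 1) = 0

/-- The interval `I_T`, which is `[0,T]` for finite `T` and `[0,∞)` for `T = ∞`. -/
def timeInterval (T : EReal) : Set ℝ := {t | 0 ≤ t ∧ (t : EReal) ≤ T}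

/-- The complex times with `|Im t| < Re t < T`. -/
def sector (T : EReal) : Set ℂ := {t | |t.im| < t.re ∧ (t.re : EReal) < T}

/-- The set `Q(T)`, lifted from the complexified torus to `ℂ × ℂ³`. -/
def domainQ (ν α : ℝ) (T : EReal) : Set (ℂ × (Fin 3 → ℂ)) :=
  {q | q.1 ∈ sector T ∧ 4 / (ν * α) * ‖fun i => (q.2 i).im‖ < q.1.re}

/-- Period `2π` in each space variable on `Q(T)`: together with the lift in `domainQ`, this
describes the functions on the complex neighbourhood of the torus. -/
def SpacePeriodicOn {E : Type*} (Q : Set (ℂ × (Fin 3 → ℂ))) (f : ℂ × (Fin 3 → ℂ) → E) : Prop :=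
  ∀ q ∈ Q, ∀ i : Fin 3, f (q.1, q.2 + Pi.single i (2 * Real.pi : ℂ)) = f q

/-- The time derivative `∂f/∂t`. -/
def dt (f : ℂ × (Fin 3 → ℂ) → ℂ) (q : ℂ × (Fin 3 → ℂ)) : ℂ := fderiv ℂ f q (1, 0)

/-- The space derivative `∂f/∂x_j`. -/
def dx (j : Fin 3) (f : ℂ × (Fin 3 → ℂ) → ℂ) (q : ℂ × (Fin 3 → ℂ)) : ℂ :=
  fderiv ℂ f q (0, Pi.single j 1)

/-- The Navier-Stokes equations without external force, with viscosity `ν`, velocity `v` and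
pressure `p`, at all points of `Q`. -/
structure SolvesNS (ν : ℝ) (Q : Set (ℂ × (Fin 3 → ℂ)))
    (v : ℂ × (Fin 3 → ℂ) → Vec3) (p : ℂ × (Fin 3 → ℂ) → ℂ) : Prop where
  momentum : ∀ q ∈ Q, ∀ j : Fin 3,
    dt (fun z => v z j) q + ∑ l, v q l * dx l (fun z => v z j) q =
      -dx j p q + (ν : ℂ) * ∑ l, dx l (dx l (fun z => v z j)) q
  divergence : ∀ q ∈ Q, ∑ l, dx l (fun z => v z l) q = 0

/-- The restriction `v(t,·)` to the real torus. -/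
def slice (v : ℂ × (Fin 3 → ℂ) → Vec3) (t : ℂ) : (Fin 3 → ℝ) → Vec3 :=
  fun x => v (t, realPt x)

/-- `v`, with some pressure, is a holomorphic solution on `Q(T)` with initial field `v₀`, together
with a majorant `V`. -/
structure IsAnalyticSolution (ν α : ℝ) (T : EReal) (v₀ : (Fin 3 → ℝ) → Vec3)
    (v : ℂ × (Fin 3 → ℂ) → Vec3) (V : ℝ → (Fin 3 → ℝ) → ℂ) : Prop where
  holomorphic : DifferentiableOn ℂ v (domainQ ν α T)
  periodic : SpacePeriodicOn (domainQ ν α T) v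
  solves : ∃ p : ℂ × (Fin 3 → ℂ) → ℂ, DifferentiableOn ℂ p (domainQ ν α T) ∧
    SpacePeriodicOn (domainQ ν α T) p ∧ SolvesNS ν (domainQ ν α T) v p
  fourier : ∀ q ∈ domainQ ν α T,
    HasSum (fun k : {k : Fin 3 → ℤ // k ≠ 0} =>
      character k q.2 • coeff (slice v q.1) k) (v q)
  initial : Filter.Tendsto (fun t : ℂ => h1ENorm (fun x => v₀ x - slice v t x))
    (nhdsWithin 0 (sector T)) (nhds 0)
  real : (∀ x i, (v₀ x i).im = 0) →
    ∀ t : ℝ, (t : ℂ) ∈ sector T → ∀ x i, (slice v t x i).im = 0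
  majorant_mem : MemCH1 (timeInterval T) V
  majorant_real : ∀ t ∈ timeInterval T, ∀ k, (coeff (V t) k).im = 0
  majorant : ∀ t ∈ sector T, ∀ k : Fin 3 → ℤ, k ≠ 0 →
    normOne (fun i => coeff (slice v t) k i) ≤
      (coeff (V t.re) k).re * Real.exp (-t.re * normEucl (waveVec k) * ν / 2)

end

end NSTorus

/-! Weight the Fourier coefficients of the velocity: `u_k(t) = |k|_e exp(|k|_e ν t / 2) v_k(t)`.
Projecting each mode orthogonally to `k` removes the pressure, and in Duhamel form the equations
become `u = h + B(u,u)`. Here `h` is the heat flow of the initial field, and `B` is a convolution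
followed by solving `y' = -cy + f`, `y(0) = 0`, with `c = ν|k|² - ν|k|/2`. The exponential weights
leave the factor `exp(-(|l| + |k-l| - |k|) ν t / 2)` in the convolution, which is bounded by 1
because of the triangle inequality. They cost little in `c`, since `|k| ≥ 1` for `k ≠ 0` gives `c ≥
ν|k|²/2`.

The unknown `u` is sought among square summable families of triples from the Banach algebra of
bounded holomorphic functions on the sector `|Im t| < Re t < T`. Holomorphy in `t` and exponential
decay in `k` are thus built into the space. The supremum over `t` is taken inside the sum over `k`,
so the majorant can be chosen independent of time.

To bound `B`: the derivative, the projection and the weight cost `|k|²`, which the time integration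
returns. By Cauchy-Schwarz with the kernel `(|l||k-l|)⁻²`, the remaining convolution is bounded in
`ℓ²` with a factor `√|k|` to spare on the squares (`convolution_estimate`). This spare power is
traded for time: the time integration has norm at most `2T` and at most `4/(ν|k|²)`, and
interpolation gives a factor of order `T^{1/8}` (`volterra_rate_bound_time`). Hence the contraction
principle (`exists_unique_quadratic`) applies for short time, or for all time if the data are small.

The rest is read off from the fixed point. The series converge on `Q(T)` and may be differentiated
termwise (`hasFDerivAt_fourierSum`); the projection keeps the divergence zero (`sum_mul_velCoeff`),
whence the momentum equation (`solvesNS`); dominated convergence gives the initial condition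
(`tendsto_initial`). For real data, complex conjugation maps `u` to another solution of the same
norm, which is `u` by uniqueness (`reflect_eq_of_solution`). -/

open scoped ENNReal

namespace NSTorus

noncomputable section

/-! ### Wave vectors and lattice sums -/

/-- The length `|k|_e` of a wave vector. -/
def waveNorm (k : Fin 3 → ℤ) : ℝ := normEucl (waveVec k)

theorem waveNorm_eq_sqrt (k : Fin 3 → ℤ) : waveNorm k = √(∑ i, (k i : ℝ) ^ 2) := by
  simp [waveNorm, normEucl, waveVec]

theorem waveNorm_eq_norm (k : Fin 3 → ℤ) :
    waveNorm k = ‖(WithLp.toLp 2 (fun i => (k i : ℝ)) : EuclideanSpace ℝ (Fin 3))‖ := by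
  rw [waveNorm_eq_sqrt, EuclideanSpace.norm_eq]
  simp

theorem waveNorm_nonneg (k : Fin 3 → ℤ) : 0 ≤ waveNorm k := Real.sqrt_nonneg _

theorem sq_waveNorm (k : Fin 3 → ℤ) : waveNorm k ^ 2 = ∑ i, (k i : ℝ) ^ 2 := by
  rw [waveNorm_eq_sqrt, Real.sq_sqrt (Finset.sum_nonneg fun i _ => sq_nonneg _)]

@[simp] theorem waveNorm_zero : waveNorm 0 = 0 := by
  simp [waveNorm_eq_sqrt]

@[simp] theorem waveNorm_neg (k : Fin 3 → ℤ) : waveNorm (-k) = waveNorm k := by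
  simp [waveNorm_eq_sqrt]

theorem waveNorm_add_le (k l : Fin 3 → ℤ) : waveNorm (k + l) ≤ waveNorm k + waveNorm l := by
  simp only [waveNorm_eq_norm]
  refine le_trans (le_of_eq ?_) (norm_add_le _ _)
  congr 1
  ext i
  simp

theorem waveNorm_le_add_sub (k l : Fin 3 → ℤ) : waveNorm k ≤ waveNorm l + waveNorm (k - l) := by
  simpa using waveNorm_add_le l (k - l)

theorem abs_coord_le_waveNorm (k : Fin 3 → ℤ) (i : Fin 3) : |(k i : ℝ)| ≤ waveNorm k := by
  rw [waveNorm_eq_sqrt]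
  apply Real.abs_le_sqrt
  exact Finset.single_le_sum (f := fun i => (k i : ℝ) ^ 2) (fun i _ => sq_nonneg _)
    (Finset.mem_univ i)

theorem one_le_waveNorm {k : Fin 3 → ℤ} (hk : k ≠ 0) : 1 ≤ waveNorm k := by
  obtain ⟨i, hi⟩ := Function.ne_iff.mp hk
  refine le_trans ?_ (abs_coord_le_waveNorm k i)
  exact_mod_cast Int.one_le_abs hi

theorem waveNorm_pos {k : Fin 3 → ℤ} (hk : k ≠ 0) : 0 < waveNorm k :=
  one_pos.trans_le (one_le_waveNorm hk)

theorem sum_abs_le_waveNorm (k : Fin 3 → ℤ) : ∑ i, |(k i : ℝ)| ≤ √3 * waveNorm k := by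
  rw [waveNorm_eq_sqrt, ← Real.sqrt_mul (by norm_num)]
  apply Real.le_sqrt_of_sq_le
  simpa using sq_sum_le_card_mul_sum_sq (s := Finset.univ) (f := fun i => |(k i : ℝ)|)

/-- The wave vectors embed injectively in the standard lattice of rank 3 in Euclidean space, where
the critical exponent of convergence is the rank. -/
theorem summable_waveNorm_rpow {r : ℝ} (hr : r < -3) :
    Summable fun k : Fin 3 → ℤ => waveNorm k ^ r := by
  let b := (EuclideanSpace.basisFun (Fin 3) ℝ).toBasis
  let L : Submodule ℤ (EuclideanSpace ℝ (Fin 3)) := Submodule.span ℤ (Set.range b)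
  have hrank : Module.finrank ℤ L = 3 := by
    rw [ZLattice.rank ℝ L]; simp
  have hmem : ∀ k : Fin 3 → ℤ,
      (WithLp.toLp 2 (fun i => (k i : ℝ)) : EuclideanSpace ℝ (Fin 3)) ∈ L := by
    intro k
    rw [Module.Basis.mem_span_iff_repr_mem]
    intro i
    exact ⟨k i, by simp [b]⟩
  have h := ZLattice.summable_norm_rpow L r (by rw [hrank]; exact_mod_cast hr)
  have hinj : Function.Injective
      (fun k : Fin 3 → ℤ => (⟨WithLp.toLp 2 (fun i => (k i : ℝ)), hmem k⟩ : L)) := by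
    intro k l hkl
    have := congrArg (fun x : L => (x : EuclideanSpace ℝ (Fin 3))) hkl
    ext i
    have := congrArg (fun x : EuclideanSpace ℝ (Fin 3) => x i) this
    simpa using this
  refine (h.comp_injective hinj).congr fun k => ?_
  simp only [waveNorm_eq_norm, Function.comp, Submodule.coe_norm]

/-- Exponentially weighted lattice sums converge. -/
theorem summable_waveNorm_pow_mul_exp (N : ℕ) {δ : ℝ} (hδ : 0 < δ) :
    Summable fun k : Fin 3 → ℤ => (1 + waveNorm k) ^ N * Real.exp (-δ * waveNorm k) := by
  have hs := summable_waveNorm_rpow (r := -4) (by norm_num)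
  -- With the convention `0 ^ (-4) = 0` the power says nothing at `k = 0`; the indicator covers that
  -- mode.
  have hs' : Summable fun k : Fin 3 → ℤ => waveNorm k ^ (-4 : ℝ) + if k = 0 then 1 else 0 :=
    hs.add (hasSum_ite_eq 0 1).summable
  refine Summable.of_nonneg_of_le (fun k => by have := waveNorm_nonneg k; positivity) ?_
    (hs'.mul_left (1 + 2 ^ N * ((N + 4).factorial / δ ^ (N + 4))))
  intro k
  by_cases hk : k = 0
  · subst hk
    simp only [waveNorm_zero, if_true]
    have : (0:ℝ) ^ (-4:ℝ) = 0 := Real.zero_rpow (by norm_num)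
    rw [this]
    norm_num
    positivity
  · have h1 := one_le_waveNorm hk
    have h0 : 0 < waveNorm k := waveNorm_pos hk
    simp only [hk, if_false, add_zero]
    have he := Real.pow_div_factorial_le_exp (δ * waveNorm k) (by positivity) (N + 4)
    rw [Real.rpow_neg h0.le, neg_mul, Real.exp_neg]
    have hr : waveNorm k ^ (4:ℝ) = waveNorm k ^ 4 := by exact_mod_cast Real.rpow_natCast _ 4
    rw [hr]
    have hinv : (Real.exp (δ * waveNorm k))⁻¹ ≤
        ((N + 4).factorial / δ ^ (N + 4)) * (waveNorm k ^ (N + 4))⁻¹ := by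
      rw [inv_le_iff_one_le_mul₀ (Real.exp_pos _)]
      calc (1:ℝ) = ((N + 4).factorial / δ ^ (N + 4)) * (waveNorm k ^ (N + 4))⁻¹ *
            ((δ * waveNorm k) ^ (N + 4) / (N + 4).factorial) := by
            rw [mul_pow]; field_simp
        _ ≤ _ := by gcongr
    calc (1 + waveNorm k) ^ N * (Real.exp (δ * waveNorm k))⁻¹
        ≤ (2 * waveNorm k) ^ N *
          (((N + 4).factorial / δ ^ (N + 4)) * (waveNorm k ^ (N + 4))⁻¹) := by
          gcongr; linarith
      _ = 2 ^ N * ((N + 4).factorial / δ ^ (N + 4)) * (waveNorm k ^ 4)⁻¹ := by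
          rw [mul_pow, pow_add]; field_simp; ring
      _ ≤ _ := by
          gcongr; linarith

/-! ### The convolution estimate in `ℓ²` -/

/-- The larger of `x`, `y` is at least `z/2`, so it absorbs `√z`, and its remaining negative power
is replaced by one of the smaller. What is left is the power `-7/2` of a single variable, which is
summable over a three-dimensional lattice. -/
theorem sqrt_mul_kernel_le {x y z : ℝ} (hx : 1 ≤ x) (hy : 1 ≤ y) (hxyz : z ≤ x + y) :
    √z * (x * y)⁻¹ ^ 2 ≤ 2 * (√x / x ^ 4 + √y / y ^ 4) := by
  wlog hxy : x ≤ y generalizing x y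
  · have := this hy hx (by linarith) (by linarith)
    rw [mul_comm x y]; linarith
  have hx0 : 0 < x := by linarith
  have hy0 : 0 < y := by linarith
  obtain ⟨s, hs, rfl⟩ : ∃ s, 0 < s ∧ x = s ^ 2 := ⟨√x, by positivity, (Real.sq_sqrt hx0.le).symm⟩
  obtain ⟨r, hr, rfl⟩ : ∃ s, 0 < s ∧ y = s ^ 2 := ⟨√y, by positivity, (Real.sq_sqrt hy0.le).symm⟩
  have hsr : s ≤ r := by
    by_contra hcon
    push Not at hcon
    nlinarith
  have hzz : √z ≤ 2 * r := by
    apply Real.sqrt_le_iff.mpr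
    constructor
    · positivity
    · nlinarith
  rw [Real.sqrt_sq hs.le, Real.sqrt_sq hr.le]
  calc √z * (s ^ 2 * r ^ 2)⁻¹ ^ 2 ≤ 2 * r * (s ^ 2 * r ^ 2)⁻¹ ^ 2 := by gcongr
    _ = 2 * (s ^ 4 * r ^ 3)⁻¹ := by field_simp
    _ ≤ 2 * (s ^ 4 * s ^ 3)⁻¹ := by gcongr
    _ = 2 * (s / (s ^ 2) ^ 4 + 0) := by field_simp; norm_num
    _ ≤ _ := by gcongr; positivity

/-- The lattice constant of the product estimate `convolution_estimate`. -/
def latticeConst : ℝ := 4 * ∑' k : Fin 3 → ℤ, √(waveNorm k) / waveNorm k ^ 4 + 1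

theorem summable_sqrt_waveNorm : Summable fun k : Fin 3 → ℤ => √(waveNorm k) / waveNorm k ^ 4 := by
  refine (summable_waveNorm_rpow (r := -(7 / 2)) (by norm_num)).congr fun k => ?_
  by_cases hk : k = 0
  · subst hk; simp
  · have h0 := waveNorm_pos hk
    rw [Real.sqrt_eq_rpow, ← Real.rpow_natCast, ← Real.rpow_sub h0]
    norm_num

theorem latticeConst_pos : 0 < latticeConst := by
  have : 0 ≤ ∑' k : Fin 3 → ℤ, √(waveNorm k) / waveNorm k ^ 4 :=
    tsum_nonneg fun k => by have := waveNorm_nonneg k; positivity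
  unfold latticeConst
  linarith

theorem summable_kernel_and_le (k : Fin 3 → ℤ) :
    (Summable fun l => (waveNorm l * waveNorm (k - l))⁻¹ ^ 2) ∧
      √(waveNorm k) * ∑' l, (waveNorm l * waveNorm (k - l))⁻¹ ^ 2 ≤ latticeConst := by
  set q : (Fin 3 → ℤ) → ℝ := fun k => √(waveNorm k) / waveNorm k ^ 4 with hq
  have hqs : Summable q := summable_sqrt_waveNorm
  have hqk : Summable fun l => q (k - l) := (Equiv.subLeft k).summable_iff.mpr hqs
  have hqn : ∀ l, 0 ≤ q l := fun l => by have := waveNorm_nonneg l; positivity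
  -- The choice `z = 1` gives summability of the kernel, and `z = |k|_e` the uniform bound. Terms
  -- with `l = 0` or `l = k` vanish, as the inverse of zero is zero.
  have key : ∀ z, z ≤ waveNorm k ∨ z ≤ 1 → ∀ l,
      √z * (waveNorm l * waveNorm (k - l))⁻¹ ^ 2 ≤ 2 * (q l + q (k - l)) := by
    intro z hz l
    by_cases hl : l = 0
    · subst hl; simp [hq]; positivity
    by_cases hkl : k - l = 0
    · rw [hkl]; simp [hq]; have := waveNorm_nonneg l; positivity
    have h1 := one_le_waveNorm hl
    have h2 := one_le_waveNorm hkl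
    have h3 := waveNorm_le_add_sub k l
    refine sqrt_mul_kernel_le h1 h2 ?_
    rcases hz with hz | hz <;> linarith
  have hsum : Summable fun l => (waveNorm l * waveNorm (k - l))⁻¹ ^ 2 := by
    refine Summable.of_nonneg_of_le (fun l => sq_nonneg _) (fun l => ?_) ((hqs.add hqk).mul_left 2)
    simpa using key 1 (Or.inr le_rfl) l
  refine ⟨hsum, ?_⟩
  rw [← tsum_mul_left]
  calc _ ≤ ∑' l, 2 * (q l + q (k - l)) :=
        (hsum.mul_left _).tsum_le_tsum (key _ (Or.inl le_rfl)) ((hqs.add hqk).mul_left 2)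
    _ = 4 * ∑' l, q l := by
        rw [tsum_mul_left, hqs.tsum_add hqk,
          show ∑' l, q (k - l) = ∑' l, q l from (Equiv.subLeft k).tsum_eq q]; ring
    _ ≤ _ := by unfold latticeConst; simp [hq]

/-- Cauchy-Schwarz for nonnegative real series. -/
theorem summable_mul_and_sq_tsum_le {ι : Type*} {f g : ι → ℝ} (hf : ∀ i, 0 ≤ f i)
    (hg : ∀ i, 0 ≤ g i) (hfs : Summable fun i => f i ^ 2) (hgs : Summable fun i => g i ^ 2) :
    (Summable fun i => f i * g i) ∧
      (∑' i, f i * g i) ^ 2 ≤ (∑' i, f i ^ 2) * ∑' i, g i ^ 2 := by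
  have h := Real.summable_and_inner_le_Lp_mul_Lq_tsum_of_nonneg Real.HolderConjugate.two_two hf hg
    (by simpa using hfs) (by simpa using hgs)
  refine ⟨h.1, ?_⟩
  have h2 := h.2
  simp only [Real.rpow_two, ← Real.sqrt_eq_rpow] at h2
  have h0 : 0 ≤ ∑' i, f i * g i := tsum_nonneg fun i => mul_nonneg (hf i) (hg i)
  have hf0 : 0 ≤ ∑' i, f i ^ 2 := tsum_nonneg fun i => sq_nonneg _
  have hg0 : 0 ≤ ∑' i, g i ^ 2 := tsum_nonneg fun i => sq_nonneg _
  calc _ ≤ (√(∑' i, f i ^ 2) * √(∑' i, g i ^ 2)) ^ 2 := by gcongr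
    _ = _ := by rw [mul_pow, Real.sq_sqrt hf0, Real.sq_sqrt hg0]

/-- The change of variables `(k, l) ↦ (l, k - l)` in a convolution. -/
def shearEquiv : (Fin 3 → ℤ) × (Fin 3 → ℤ) ≃ (Fin 3 → ℤ) × (Fin 3 → ℤ) where
  toFun q := (q.2, q.1 - q.2)
  invFun q := (q.1 + q.2, q.1)
  left_inv q := by simp
  right_inv q := by simp

theorem hasSum_conv {f g : (Fin 3 → ℤ) → ℝ} (hf : ∀ k, 0 ≤ f k)
    (hg : ∀ k, 0 ≤ g k) (hfs : Summable f) (hgs : Summable g) :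
    (∀ k, Summable fun l => f l * g (k - l)) ∧
      HasSum (fun k => ∑' l, f l * g (k - l)) ((∑' k, f k) * ∑' k, g k) := by
  have h1 := hfs.mul_of_nonneg hgs hf hg
  have h2 : Summable fun q : (Fin 3 → ℤ) × (Fin 3 → ℤ) => f q.2 * g (q.1 - q.2) :=
    shearEquiv.summable_iff.mpr h1
  have h3 : HasSum (fun q : (Fin 3 → ℤ) × (Fin 3 → ℤ) => f q.1 * g q.2)
      ((∑' k, f k) * ∑' k, g k) := by
    rw [hfs.tsum_mul_tsum hgs h1]; exact h1.hasSum
  have h4 : HasSum (fun q : (Fin 3 → ℤ) × (Fin 3 → ℤ) => f q.2 * g (q.1 - q.2))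
      ((∑' k, f k) * ∑' k, g k) := shearEquiv.hasSum_iff.mpr h3
  refine ⟨fun k => h2.prod_factor k, h4.prod_fiberwise fun k => (h2.prod_factor k).hasSum⟩

/-- Cauchy-Schwarz in `l`, with the kernel separated from `a l * b (k - l)`. The kernel sum times
`√|k|_e` is bounded uniformly in `k`, and summing the other factor over `k` gives the product of the
two squared `ℓ²` norms. The gain `√|k|_e` is what later permits a small factor for short times. -/
theorem convolution_estimate {a b : (Fin 3 → ℤ) → ℝ} (ha : ∀ k, 0 ≤ a k)
    (hb : ∀ k, 0 ≤ b k) (has : Summable fun k => a k ^ 2) (hbs : Summable fun k => b k ^ 2) :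
    (∀ k, Summable fun l => (waveNorm l * waveNorm (k - l))⁻¹ * (a l * b (k - l))) ∧
    ∀ s : Finset (Fin 3 → ℤ), ∑ k ∈ s, √(waveNorm k) *
      (∑' l, (waveNorm l * waveNorm (k - l))⁻¹ * (a l * b (k - l))) ^ 2 ≤
      latticeConst * ((∑' k, a k ^ 2) * ∑' k, b k ^ 2) := by
  obtain ⟨h1, h2⟩ := hasSum_conv (fun k => sq_nonneg (a k)) (fun k => sq_nonneg (b k)) has hbs
  have h3 := fun k => summable_mul_and_sq_tsum_le
    (f := fun l => (waveNorm l * waveNorm (k - l))⁻¹) (g := fun l => a l * b (k - l))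
    (fun l => by have := waveNorm_nonneg l; have := waveNorm_nonneg (k - l); positivity)
    (fun l => mul_nonneg (ha _) (hb _)) (summable_kernel_and_le k).1
    (by simpa only [mul_pow] using h1 k)
  refine ⟨fun k => (h3 k).1, fun s => ?_⟩
  calc _ ≤ ∑ k ∈ s, latticeConst * ∑' l, a l ^ 2 * b (k - l) ^ 2 := by
        refine Finset.sum_le_sum fun k _ => ?_
        calc _ ≤ √(waveNorm k) * ((∑' l, (waveNorm l * waveNorm (k - l))⁻¹ ^ 2) *
              ∑' l, (a l * b (k - l)) ^ 2) := by
              gcongr; exact (h3 k).2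
          _ = (√(waveNorm k) * ∑' l, (waveNorm l * waveNorm (k - l))⁻¹ ^ 2) *
              ∑' l, a l ^ 2 * b (k - l) ^ 2 := by simp only [mul_pow]; ring
          _ ≤ _ := by
              gcongr
              exact (summable_kernel_and_le k).2
    _ = latticeConst * ∑ k ∈ s, ∑' l, a l ^ 2 * b (k - l) ^ 2 := by rw [Finset.mul_sum]
    _ ≤ _ := by
        gcongr
        · exact latticeConst_pos.le
        · rw [← h2.tsum_eq]
          exact h2.summable.sum_le_tsum _ fun k _ => tsum_nonneg fun l => by positivity

/-! ### Quadratic fixed point equations -/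

section FixedPoint

variable {X : Type*} [NormedAddCommGroup X] [CompleteSpace X]

/-- A quadratic equation `u = h + B(u,u)` with small data has a unique small solution. -/
theorem exists_unique_quadratic {B : X → X → X} {η : ℝ} (hη : 0 ≤ η)
    (hB : ∀ u v, ‖B u v‖ ≤ η * ‖u‖ * ‖v‖) (hl : ∀ u u' v, B (u - u') v = B u v - B u' v)
    (hr : ∀ u v v', B u (v - v') = B u v - B u v') (h : X) (hs : 8 * η * ‖h‖ ≤ 1) :
    ∃ u : X, u = h + B u u ∧ ∀ w : X, ‖w‖ ≤ ‖u‖ → w = h + B w w → w = u := by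
  set R := 2 * ‖h‖ with hR
  let f : X → X := fun u => h + B u u
  -- Since `B(u,u) - B(v,v) = B(u-v,u) + B(v,u-v)`, the Lipschitz constant on the ball of radius
  -- `2‖h‖` is `4η‖h‖`, at most `1/2`.
  have hdiff : ∀ u v, ‖u‖ ≤ R → ‖v‖ ≤ R → ‖f u - f v‖ ≤ 1 / 2 * ‖u - v‖ := by
    intro u v hu hv
    have : f u - f v = B (u - v) u + B v (u - v) := by simp only [f, hl, hr]; abel
    rw [this]
    calc _ ≤ η * ‖u - v‖ * ‖u‖ + η * ‖v‖ * ‖u - v‖ :=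
          (norm_add_le _ _).trans (add_le_add (hB _ _) (hB _ _))
      _ ≤ η * ‖u - v‖ * R + η * R * ‖u - v‖ := by gcongr
      _ = (8 * η * ‖h‖) * (1 / 2 * ‖u - v‖) := by rw [hR]; ring
      _ ≤ 1 * (1 / 2 * ‖u - v‖) := by gcongr
      _ = _ := one_mul _
  have hmaps : Set.MapsTo f (Metric.closedBall 0 R) (Metric.closedBall 0 R) := by
    intro u hu
    rw [mem_closedBall_zero_iff] at hu ⊢
    calc ‖f u‖ ≤ ‖h‖ + η * ‖u‖ * ‖u‖ := (norm_add_le _ _).trans (by gcongr; exact hB _ _)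
      _ ≤ ‖h‖ + η * R * R := by gcongr
      _ = ‖h‖ + (8 * η * ‖h‖) * (‖h‖ / 2) := by rw [hR]; ring
      _ ≤ ‖h‖ + 1 * (‖h‖ / 2) := by gcongr
      _ ≤ R := by have := norm_nonneg h; rw [hR]; linarith
  have hc : ContractingWith (1 / 2) (hmaps.restrict f _ _) := by
    refine ⟨by rw [← NNReal.coe_lt_coe]; norm_num, LipschitzWith.of_dist_le_mul fun u v => ?_⟩
    have hu := mem_closedBall_zero_iff.mp u.2
    have hv := mem_closedBall_zero_iff.mp v.2
    simpa [Subtype.dist_eq, dist_eq_norm] using! hdiff u v hu hv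
  obtain ⟨u, hu, hfix, -⟩ := hc.exists_fixedPoint' Metric.isClosed_closedBall.isComplete hmaps
    (Metric.mem_closedBall_self (by positivity)) (edist_ne_top _ _)
  have huR := mem_closedBall_zero_iff.mp hu
  refine ⟨u, hfix.symm, fun w hw hwf => ?_⟩
  have := hdiff w u (hw.trans huR) huR
  rw [show f w = w from hwf.symm, show f u = u from hfix] at this
  have h0 : ‖w - u‖ = 0 := le_antisymm (by linarith) (norm_nonneg _)
  exact sub_eq_zero.mp (norm_eq_zero.mp h0)

end FixedPoint

/-! ### The quadratic term over a Banach algebra -/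

/-- Square summable families, indexed by wave vectors, of triples of elements of `A`. -/
abbrev CoeffSpace (A : Type*) [NormedAddCommGroup A] : Type _ :=
  lp (fun _ : Fin 3 → ℤ => Fin 3 → A) 2

theorem summable_sq_norm {A : Type*} [NormedAddCommGroup A] (u : CoeffSpace A) :
    Summable fun k => ‖u k‖ ^ 2 := by
  simpa using (lp.memℓp u).summable (by norm_num)

theorem tsum_sq_norm {A : Type*} [NormedAddCommGroup A] (u : CoeffSpace A) :
    ∑' k, ‖u k‖ ^ 2 = ‖u‖ ^ 2 := by
  simpa using (lp.norm_rpow_eq_tsum (p := 2) (by norm_num) u).symm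

theorem summable_majorant {A : Type*} [NormedAddCommGroup A] (u v : CoeffSpace A) (k : Fin 3 → ℤ) :
    Summable fun l => (waveNorm l * waveNorm (k - l))⁻¹ * (‖u l‖ * ‖v (k - l)‖) :=
  (convolution_estimate (fun k => norm_nonneg (u k)) (fun k => norm_nonneg (v k))
    (summable_sq_norm u) (summable_sq_norm v)).1 k

/-- The ingredients of the quadratic term of the Navier-Stokes equations for weighted Fourier
coefficients in a Banach algebra. -/
structure QuadraticModel (A : Type*) [NormedCommRing A] [NormedAlgebra ℂ A] where
  /-- weights of the products of modes -/
  m : (Fin 3 → ℤ) → (Fin 3 → ℤ) → A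
  /-- time integration for each mode -/
  L : (Fin 3 → ℤ) → A →L[ℂ] A
  /-- symbol of the projected transport term -/
  p : (Fin 3 → ℤ) → Fin 3 → Fin 3 → Fin 3 → ℂ
  /-- size of the quadratic term -/
  K : ℝ
  K_nonneg : 0 ≤ K
  norm_m_le : ∀ k l, ‖m k l‖ ≤ 1
  norm_p_le : ∀ k i j n, ‖p k i j n‖ ≤ 2 * waveNorm k
  norm_L_le : ∀ k, waveNorm k ^ 4 * ‖L k‖ ^ 2 ≤ K ^ 2 * √(waveNorm k)

namespace QuadraticModel

variable {A : Type*} [NormedCommRing A] [NormedAlgebra ℂ A] (D : QuadraticModel A)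

/-- A term of the weighted convolution. -/
def term (k : Fin 3 → ℤ) (a b : (Fin 3 → ℤ) → A) (l : Fin 3 → ℤ) : A :=
  (((waveNorm l * waveNorm (k - l))⁻¹ : ℝ) : ℂ) • (D.m k l * (a l * b (k - l)))

/-- The weighted convolution. -/
def conv (k : Fin 3 → ℤ) (a b : (Fin 3 → ℤ) → A) : A := ∑' l, D.term k a b l

/-- The nonlinearity before time integration. -/
def source (u v : CoeffSpace A) (k : Fin 3 → ℤ) (i : Fin 3) : A :=
  (waveNorm k : ℂ) • ∑ j, ∑ n, D.p k i j n • D.conv k (fun l => u l j) (fun l => v l n)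

theorem norm_term_le (u v : CoeffSpace A) (k l : Fin 3 → ℤ) (j n : Fin 3) :
    ‖D.term k (fun l => u l j) (fun l => v l n) l‖ ≤
      (waveNorm l * waveNorm (k - l))⁻¹ * (‖u l‖ * ‖v (k - l)‖) := by
  have h1 := waveNorm_nonneg l
  have h2 := waveNorm_nonneg (k - l)
  unfold term
  rw [norm_smul, Complex.norm_real, Real.norm_of_nonneg (by positivity)]
  gcongr
  calc _ ≤ ‖D.m k l‖ * (‖u l j‖ * ‖v (k - l) n‖) :=
        (norm_mul_le _ _).trans (by gcongr; exact norm_mul_le _ _)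
    _ ≤ 1 * (‖u l‖ * ‖v (k - l)‖) := by
        gcongr
        · exact D.norm_m_le k l
        · exact norm_le_pi_norm (u l) j
        · exact norm_le_pi_norm (v (k - l)) n
    _ = _ := one_mul _

theorem summable_norm_term (u v : CoeffSpace A) (k : Fin 3 → ℤ) (j n : Fin 3) :
    Summable fun l => ‖D.term k (fun l => u l j) (fun l => v l n) l‖ :=
  Summable.of_nonneg_of_le (fun _ => norm_nonneg _) (fun l => D.norm_term_le u v k l j n)
    (summable_majorant u v k)

theorem norm_conv_le (u v : CoeffSpace A) (k : Fin 3 → ℤ) (j n : Fin 3) :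
    ‖D.conv k (fun l => u l j) (fun l => v l n)‖ ≤
      ∑' l, (waveNorm l * waveNorm (k - l))⁻¹ * (‖u l‖ * ‖v (k - l)‖) :=
  tsum_of_norm_bounded (summable_majorant u v k).hasSum fun l => D.norm_term_le u v k l j n

theorem norm_source_le (u v : CoeffSpace A) (k : Fin 3 → ℤ) :
    ‖D.source u v k‖ ≤ 18 * waveNorm k ^ 2 *
      ∑' l, (waveNorm l * waveNorm (k - l))⁻¹ * (‖u l‖ * ‖v (k - l)‖) := by
  set c := ∑' l, (waveNorm l * waveNorm (k - l))⁻¹ * (‖u l‖ * ‖v (k - l)‖) with hc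
  have hk := waveNorm_nonneg k
  have hc0 : 0 ≤ c := (norm_nonneg _).trans (D.norm_conv_le u v k 0 0)
  refine (pi_norm_le_iff_of_nonneg (by positivity)).mpr fun i => ?_
  unfold source
  rw [norm_smul, Complex.norm_real, Real.norm_of_nonneg hk]
  -- The constant 18 comes from the nine pairs `(j, n)` and the factor 2 in the bound of the symbol.
  calc _ ≤ waveNorm k * ∑ j : Fin 3, ∑ n : Fin 3, 2 * waveNorm k * c := by
        gcongr
        refine (norm_sum_le _ _).trans (Finset.sum_le_sum fun j _ => ?_)
        refine (norm_sum_le _ _).trans (Finset.sum_le_sum fun n _ => ?_)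
        rw [norm_smul]
        gcongr
        · exact D.norm_p_le k i j n
        · exact D.norm_conv_le u v k j n
    _ = _ := by simp; ring

/-- The quadratic term, as a family of coefficients. -/
def quadFun (u v : CoeffSpace A) (k : Fin 3 → ℤ) (i : Fin 3) : A := D.L k (D.source u v k i)

theorem norm_quadFun_le (u v : CoeffSpace A) (k : Fin 3 → ℤ) :
    ‖D.quadFun u v k‖ ≤ ‖D.L k‖ * ‖D.source u v k‖ :=
  (pi_norm_le_iff_of_nonneg (by positivity)).mpr fun i =>
    ((D.L k).le_opNorm _).trans (by gcongr; exact norm_le_pi_norm _ i)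

/-- The factor `|k|_e²` of the source squares to `|k|_e⁴`, which `norm_L_le` turns into `K² √|k|_e`;
this is exactly the weight allowed by `convolution_estimate`. -/
theorem sum_sq_norm_quadFun_le (u v : CoeffSpace A) (s : Finset (Fin 3 → ℤ)) :
    ∑ k ∈ s, ‖D.quadFun u v k‖ ^ 2 ≤ 18 ^ 2 * D.K ^ 2 * latticeConst * (‖u‖ ^ 2 * ‖v‖ ^ 2) := by
  calc _ ≤ ∑ k ∈ s, 18 ^ 2 * D.K ^ 2 * (√(waveNorm k) *
        (∑' l, (waveNorm l * waveNorm (k - l))⁻¹ * (‖u l‖ * ‖v (k - l)‖)) ^ 2) := by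
        refine Finset.sum_le_sum fun k _ => ?_
        calc _ ≤ (‖D.L k‖ * (18 * waveNorm k ^ 2 *
              ∑' l, (waveNorm l * waveNorm (k - l))⁻¹ * (‖u l‖ * ‖v (k - l)‖))) ^ 2 := by
              gcongr
              exact (D.norm_quadFun_le u v k).trans (by gcongr; exact D.norm_source_le u v k)
          _ = (waveNorm k ^ 4 * ‖D.L k‖ ^ 2) * (18 ^ 2 *
              (∑' l, (waveNorm l * waveNorm (k - l))⁻¹ * (‖u l‖ * ‖v (k - l)‖)) ^ 2) := by ring
          _ ≤ (D.K ^ 2 * √(waveNorm k)) * (18 ^ 2 *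
              (∑' l, (waveNorm l * waveNorm (k - l))⁻¹ * (‖u l‖ * ‖v (k - l)‖)) ^ 2) := by
              exact mul_le_mul_of_nonneg_right (D.norm_L_le k) (by positivity)
          _ = _ := by ring
    _ = 18 ^ 2 * D.K ^ 2 * ∑ k ∈ s, √(waveNorm k) *
        (∑' l, (waveNorm l * waveNorm (k - l))⁻¹ * (‖u l‖ * ‖v (k - l)‖)) ^ 2 := by
        rw [Finset.mul_sum]
    _ ≤ 18 ^ 2 * D.K ^ 2 * (latticeConst * ((∑' k, ‖u k‖ ^ 2) * ∑' k, ‖v k‖ ^ 2)) := by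
        gcongr
        exact (convolution_estimate (fun k => norm_nonneg (u k)) (fun k => norm_nonneg (v k))
          (summable_sq_norm u) (summable_sq_norm v)).2 s
    _ = _ := by rw [tsum_sq_norm, tsum_sq_norm]; ring

/-- The quadratic term. -/
def quad (u v : CoeffSpace A) : CoeffSpace A :=
  ⟨D.quadFun u v, memℓp_gen' fun s => by
    simpa using D.sum_sq_norm_quadFun_le u v s⟩

theorem quad_apply (u v : CoeffSpace A) (k : Fin 3 → ℤ) (i : Fin 3) :
    D.quad u v k i = D.L k (D.source u v k i) := rfl

theorem norm_quad_le (u v : CoeffSpace A) :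
    ‖D.quad u v‖ ≤ 18 * √latticeConst * D.K * ‖u‖ * ‖v‖ := by
  have hK := D.K_nonneg
  refine lp.norm_le_of_forall_sum_le (by norm_num) (by positivity) fun s => ?_
  have h := D.sum_sq_norm_quadFun_le u v s
  have : (18 * √latticeConst * D.K * ‖u‖ * ‖v‖) ^ 2 =
      18 ^ 2 * D.K ^ 2 * latticeConst * (‖u‖ ^ 2 * ‖v‖ ^ 2) := by
    rw [mul_pow, mul_pow, mul_pow, mul_pow, Real.sq_sqrt latticeConst_pos.le]; ring
  simpa [quad, this] using h

section Reflect

variable (σ : A →ₛₗᵢ[starRingEnd ℂ] A)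

/-- The reflection `k ↦ -k` of the coefficients combined with a conjugation. -/
def reflect (u : CoeffSpace A) : CoeffSpace A :=
  ⟨fun k i => σ (u (-k) i), by
    refine memℓp_gen ?_
    have h : ∀ k : Fin 3 → ℤ, ‖fun i => σ (u (-k) i)‖ = ‖u (-k)‖ := fun k => by
      simp [Pi.norm_def]
    simpa only [h, ENNReal.toReal_ofNat, Real.rpow_ofNat, Function.comp_def, Equiv.neg_apply] using
      (Equiv.neg (Fin 3 → ℤ)).summable_iff.mpr (summable_sq_norm u)⟩

theorem reflect_apply (u : CoeffSpace A) (k : Fin 3 → ℤ) (i : Fin 3) :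
    reflect σ u k i = σ (u (-k) i) := rfl

theorem norm_reflect (u : CoeffSpace A) : ‖reflect σ u‖ = ‖u‖ := by
  have h : ∀ k : Fin 3 → ℤ, ‖reflect σ u k‖ = ‖u (-k)‖ := fun k => by
    simp [reflect, Pi.norm_def]
  have h2 : ‖reflect σ u‖ ^ 2 = ‖u‖ ^ 2 := by
    rw [← tsum_sq_norm, ← tsum_sq_norm]
    simp only [h]
    exact (Equiv.neg (Fin 3 → ℤ)).tsum_eq fun k => ‖u k‖ ^ 2
  exact (sq_eq_sq₀ (norm_nonneg _) (norm_nonneg _)).mp h2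

end Reflect

variable [CompleteSpace A]

theorem summable_term (u v : CoeffSpace A) (k : Fin 3 → ℤ) (j n : Fin 3) :
    Summable fun l => D.term k (fun l => u l j) (fun l => v l n) l :=
  (D.summable_norm_term u v k j n).of_norm

theorem conv_sub_left (u u' v : CoeffSpace A) (k : Fin 3 → ℤ) (j n : Fin 3) :
    D.conv k (fun l => (u - u') l j) (fun l => v l n) =
      D.conv k (fun l => u l j) (fun l => v l n) - D.conv k (fun l => u' l j) (fun l => v l n) := by
  unfold conv
  rw [← (D.summable_term u v k j n).tsum_sub (D.summable_term u' v k j n)]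
  refine tsum_congr fun l => ?_
  simp only [term, ← smul_sub, lp.coeFn_sub, Pi.sub_apply]
  congr 1
  ring

theorem conv_sub_right (u v v' : CoeffSpace A) (k : Fin 3 → ℤ) (j n : Fin 3) :
    D.conv k (fun l => u l j) (fun l => (v - v') l n) =
      D.conv k (fun l => u l j) (fun l => v l n) - D.conv k (fun l => u l j) (fun l => v' l n) := by
  unfold conv
  rw [← (D.summable_term u v k j n).tsum_sub (D.summable_term u v' k j n)]
  refine tsum_congr fun l => ?_
  simp only [term, ← smul_sub, lp.coeFn_sub, Pi.sub_apply]
  congr 1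
  ring

theorem quad_sub_left (u u' v : CoeffSpace A) : D.quad (u - u') v = D.quad u v - D.quad u' v := by
  ext k i
  simp only [quad, lp.coeFn_sub, Pi.sub_apply, quadFun, source, ← map_sub]
  congr 1
  simp only [← smul_sub, ← Finset.sum_sub_distrib]
  simp only [← D.conv_sub_left]
  rfl

theorem quad_sub_right (u v v' : CoeffSpace A) :
    D.quad u (v - v') = D.quad u v - D.quad u v' := by
  ext k i
  simp only [quad, lp.coeFn_sub, Pi.sub_apply, quadFun, source, ← map_sub]
  congr 1
  simp only [← smul_sub, ← Finset.sum_sub_distrib]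
  simp only [← D.conv_sub_right]
  rfl

/-- Existence of a unique small solution of `u = h + B(u,u)`. -/
theorem exists_solution (h : CoeffSpace A) (hs : 144 * √latticeConst * D.K * ‖h‖ ≤ 1) :
    ∃ u : CoeffSpace A, u = h + D.quad u u ∧
      ∀ w : CoeffSpace A, ‖w‖ ≤ ‖u‖ → w = h + D.quad w w → w = u := by
  have := D.K_nonneg
  exact exists_unique_quadratic (η := 18 * √latticeConst * D.K) (by positivity) D.norm_quad_le
    D.quad_sub_left D.quad_sub_right h (le_of_eq_of_le (by ring) hs)

section Symmetry

variable {D} {σ : A →ₛₗᵢ[starRingEnd ℂ] A}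

theorem conv_reflect (hmul : ∀ a b, σ (a * b) = σ a * σ b)
    (hm : ∀ k l, σ (D.m (-k) (-l)) = D.m k l)
    (u v : CoeffSpace A) (k : Fin 3 → ℤ) (j n : Fin 3) :
    D.conv k (fun l => reflect σ u l j) (fun l => reflect σ v l n) =
      σ (D.conv (-k) (fun l => u l j) (fun l => v l n)) := by
  unfold conv
  have h := (D.summable_term u v (-k) j n).map_tsum σ σ.continuous
  rw [h, ← (Equiv.neg (Fin 3 → ℤ)).tsum_eq fun l =>
    σ (D.term (-k) (fun l => u l j) (fun l => v l n) l)]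
  refine tsum_congr fun l => ?_
  have hkl : -k - -l = -(k - l) := by abel
  have hm' := hm k l
  simp only [term, Equiv.neg_apply, map_smulₛₗ, hmul, reflect_apply, Complex.conj_ofReal, hkl,
    waveNorm_neg, hm']

theorem reflect_quad (hmul : ∀ a b, σ (a * b) = σ a * σ b)
    (hm : ∀ k l, σ (D.m (-k) (-l)) = D.m k l)
    (hL : ∀ k a, σ (D.L (-k) a) = D.L k (σ a))
    (hp : ∀ k i j n, starRingEnd ℂ (D.p (-k) i j n) = D.p k i j n)
    (u v : CoeffSpace A) :
    reflect σ (D.quad u v) = D.quad (reflect σ u) (reflect σ v) := by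
  ext k i
  have hs : D.source (reflect σ u) (reflect σ v) k i = σ (D.source u v (-k) i) := by
    unfold source
    simp only [conv_reflect hmul hm, map_smulₛₗ, map_sum, hp, Complex.conj_ofReal, waveNorm_neg]
  rw [reflect_apply, quad_apply, quad_apply, hL, hs]

/-- Reflection commutes with the quadratic term and fixes `h`, so it maps the solution to a
solution. It is an isometry, so the uniqueness clause for `‖w‖ ≤ ‖u‖` applies. -/
theorem reflect_eq_of_solution (hmul : ∀ a b, σ (a * b) = σ a * σ b)
    (hm : ∀ k l, σ (D.m (-k) (-l)) = D.m k l)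
    (hL : ∀ k a, σ (D.L (-k) a) = D.L k (σ a))
    (hp : ∀ k i j n, starRingEnd ℂ (D.p (-k) i j n) = D.p k i j n)
    {h u : CoeffSpace A} (hh : reflect σ h = h)
    (hu : u = h + D.quad u u)
    (huniq : ∀ w : CoeffSpace A, ‖w‖ ≤ ‖u‖ → w = h + D.quad w w → w = u) : reflect σ u = u := by
  refine huniq _ (norm_reflect σ u).le ?_
  rw [← reflect_quad hmul hm hL hp]
  conv_lhs => rw [hu]
  conv_rhs => rw [← hh]
  ext k i
  exact map_add σ _ _

end Symmetry

end QuadraticModel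

/-! ### Bounded holomorphic functions on the sector -/

section SectorHol

open scoped BoundedContinuousFunction ComplexConjugate

variable {T : EReal}

theorem isOpen_sector (T : EReal) : IsOpen (sector T) := by
  refine IsOpen.inter (isOpen_lt (Complex.continuous_im.abs) Complex.continuous_re) ?_
  exact isOpen_lt (continuous_coe_real_ereal.comp Complex.continuous_re) continuous_const

theorem re_pos_of_mem_sector {t : ℂ} (ht : t ∈ sector T) : 0 < t.re :=
  (abs_nonneg _).trans_lt ht.1

/-- This is where the opening of the sector enters: integrals along complex rays lose only a factor
2 against real time. -/
theorem norm_le_of_mem_sector {t : ℂ} (ht : t ∈ sector T) : ‖t‖ ≤ 2 * t.re := by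
  have h := Complex.norm_le_abs_re_add_abs_im t
  rw [abs_of_pos (re_pos_of_mem_sector ht)] at h
  linarith [ht.1]

theorem smul_mem_sector {t : ℂ} (ht : t ∈ sector T) {τ : ℝ} (h0 : 0 < τ) (h1 : τ ≤ 1) :
    (τ : ℂ) * t ∈ sector T := by
  refine ⟨?_, lt_of_le_of_lt ?_ ht.2⟩
  · simpa [abs_mul, abs_of_pos h0] using mul_lt_mul_of_pos_left ht.1 h0
  · have := re_pos_of_mem_sector ht
    rw [Complex.re_ofReal_mul]
    exact_mod_cast mul_le_of_le_one_left this.le h1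

theorem conj_mem_sector {t : ℂ} (ht : t ∈ sector T) : conj t ∈ sector T :=
  ⟨by simpa using ht.1, by simpa using ht.2⟩

open Classical in
/-- Extension by zero of a function on the sector. -/
def zeroExt (f : sector T → ℂ) (z : ℂ) : ℂ := if h : z ∈ sector T then f ⟨z, h⟩ else 0

theorem zeroExt_of_mem (f : sector T → ℂ) {z : ℂ} (h : z ∈ sector T) : zeroExt f z = f ⟨z, h⟩ :=
  dif_pos h

/-- The algebra of bounded holomorphic functions on the sector. -/
def holSubalgebra (T : EReal) : Subalgebra ℂ (sector T →ᵇ ℂ) where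
  carrier := {f | DifferentiableOn ℂ (zeroExt f) (sector T)}
  mul_mem' {f g} hf hg := (hf.mul hg).congr fun z hz => by simp [zeroExt_of_mem _ hz]
  add_mem' {f g} hf hg := (hf.add hg).congr fun z hz => by simp [zeroExt_of_mem _ hz]
  algebraMap_mem' c := (differentiableOn_const c).congr fun z hz => by
    simp [zeroExt_of_mem _ hz]

/-- The Banach algebra of bounded holomorphic functions on the sector. -/
abbrev SectorHol (T : EReal) : Type := holSubalgebra T

/-- Weierstrass: uniform limits of holomorphic functions are holomorphic. Completeness of the
algebra, needed for the contraction principle, follows. -/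
theorem isClosed_holSubalgebra (T : EReal) : IsClosed (holSubalgebra T : Set (sector T →ᵇ ℂ)) := by
  refine isClosed_of_closure_subset fun f hf => ?_
  obtain ⟨u, hu, hlim⟩ := mem_closure_iff_seq_limit.mp hf
  have huni := BoundedContinuousFunction.tendsto_iff_tendstoUniformly.mp hlim
  have : TendstoUniformlyOn (fun n => zeroExt (u n)) (zeroExt f) Filter.atTop (sector T) := by
    rw [Metric.tendstoUniformlyOn_iff]
    intro ε hε
    filter_upwards [Metric.tendstoUniformly_iff.mp huni ε hε] with n hn z hz
    rw [zeroExt_of_mem _ hz, zeroExt_of_mem _ hz]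
    exact hn _
  exact this.tendstoLocallyUniformlyOn.differentiableOn (Filter.Eventually.of_forall hu)
    (isOpen_sector T)

instance : CompleteSpace (SectorHol T) := (isClosed_holSubalgebra T).completeSpace_coe

/-- Evaluation at a point of the sector (zero at all other points). -/
def evalAt (z : ℂ) : SectorHol T →L[ℂ] ℂ :=
  LinearMap.mkContinuous
    { toFun := fun f => zeroExt f.1 z
      map_add' := fun f g => by
        by_cases h : z ∈ sector T
        · simp only [zeroExt, dif_pos h]; rfl
        · simp only [zeroExt, dif_neg h, add_zero]
      map_smul' := fun c f => by
        by_cases h : z ∈ sector T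
        · simp only [zeroExt, dif_pos h]; rfl
        · simp only [zeroExt, dif_neg h, smul_zero] } 1 fun f => by
    change ‖zeroExt f.1 z‖ ≤ 1 * ‖f.1‖
    rw [one_mul]
    by_cases h : z ∈ sector T
    · rw [zeroExt_of_mem _ h]; exact f.1.norm_coe_le_norm ⟨z, h⟩
    · rw [zeroExt, dif_neg h, norm_zero]; exact norm_nonneg _

theorem evalAt_of_mem (f : SectorHol T) {z : ℂ} (hz : z ∈ sector T) : evalAt z f = f.1 ⟨z, hz⟩ :=
  zeroExt_of_mem f.1 hz

theorem evalAt_of_notMem (f : SectorHol T) {z : ℂ} (hz : z ∉ sector T) : evalAt z f = 0 :=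
  dif_neg hz

theorem norm_evalAt_le (z : ℂ) (f : SectorHol T) : ‖evalAt z f‖ ≤ ‖f‖ := by
  refine ((evalAt z).le_of_opNorm_le ?_ f).trans_eq (one_mul _)
  exact LinearMap.mkContinuous_norm_le _ zero_le_one _

theorem differentiableOn_evalAt (f : SectorHol T) :
    DifferentiableOn ℂ (fun z => evalAt z f) (sector T) := f.2

theorem evalAt_mul (z : ℂ) (f g : SectorHol T) : evalAt z (f * g) = evalAt z f * evalAt z g := by
  by_cases h : z ∈ sector T
  · simp only [evalAt_of_mem _ h]; rfl
  · simp only [evalAt_of_notMem _ h, mul_zero]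

theorem SectorHol.ext {f g : SectorHol T} (h : ∀ z ∈ sector T, evalAt z f = evalAt z g) :
    f = g := by
  refine Subtype.ext (BoundedContinuousFunction.ext fun z => ?_)
  simpa only [evalAt_of_mem _ z.2] using h z z.2

/-- A bounded holomorphic function on the sector, as an element of the algebra. -/
def SectorHol.mk (g : ℂ → ℂ) (hg : DifferentiableOn ℂ g (sector T)) (C : ℝ)
    (hC : ∀ z ∈ sector T, ‖g z‖ ≤ C) : SectorHol T :=
  ⟨BoundedContinuousFunction.ofNormedAddCommGroup (fun z : sector T => g z)
    (continuousOn_iff_continuous_domRestrict.mp hg.continuousOn) C fun z => hC z z.2,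
    hg.congr fun _ hz => zeroExt_of_mem _ hz⟩

theorem SectorHol.evalAt_mk {g : ℂ → ℂ} {hg : DifferentiableOn ℂ g (sector T)} {C : ℝ}
    {hC : ∀ z ∈ sector T, ‖g z‖ ≤ C} {z : ℂ} (hz : z ∈ sector T) :
    evalAt z (SectorHol.mk g hg C hC) = g z :=
  evalAt_of_mem _ hz

theorem SectorHol.norm_le {f : SectorHol T} {C : ℝ} (hC0 : 0 ≤ C)
    (hC : ∀ z ∈ sector T, ‖evalAt z f‖ ≤ C) : ‖f‖ ≤ C :=
  (BoundedContinuousFunction.norm_le hC0).mpr fun z => by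
    have h := hC z z.2
    rw [evalAt_of_mem _ z.2] at h
    exact h

theorem SectorHol.norm_mk_le {g : ℂ → ℂ} {hg : DifferentiableOn ℂ g (sector T)} {C : ℝ}
    {hC : ∀ z ∈ sector T, ‖g z‖ ≤ C} (hC0 : 0 ≤ C) : ‖SectorHol.mk g hg C hC‖ ≤ C :=
  SectorHol.norm_le hC0 fun z hz => by rw [SectorHol.evalAt_mk hz]; exact hC z hz

/-- The function `e^{-ct}`, for `c ≥ 0`. -/
def decay (T : EReal) {c : ℝ} (hc : 0 ≤ c) : SectorHol T :=
  SectorHol.mk (fun t => Complex.exp (-(c : ℂ) * t)) (by fun_prop) 1 fun t ht => by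
    rw [Complex.norm_exp]
    have := re_pos_of_mem_sector ht
    simpa using mul_nonneg hc this.le

theorem evalAt_decay {c : ℝ} (hc : 0 ≤ c) {t : ℂ} (ht : t ∈ sector T) :
    evalAt t (decay T hc) = Complex.exp (-(c : ℂ) * t) := SectorHol.evalAt_mk ht

theorem norm_decay_le {c : ℝ} (hc : 0 ≤ c) : ‖decay T hc‖ ≤ 1 := SectorHol.norm_mk_le zero_le_one

theorem differentiableOn_conj_evalAt (f : SectorHol T) :
    DifferentiableOn ℂ (conj ∘ (fun z => evalAt z f) ∘ conj) (sector T) := fun z hz => by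
  have h := ((differentiableOn_evalAt f).differentiableAt
    ((isOpen_sector T).mem_nhds (conj_mem_sector hz))).conj_conj
  rw [Complex.conj_conj] at h
  exact h.differentiableWithinAt

/-- The conjugate function `conj (f (conj t))`. -/
def conjFun (f : SectorHol T) : SectorHol T :=
  SectorHol.mk _ (differentiableOn_conj_evalAt f) ‖f‖ fun _ _ =>
    (RCLike.norm_conj _).trans_le (norm_evalAt_le _ f)

theorem evalAt_conjFun (f : SectorHol T) {z : ℂ} (hz : z ∈ sector T) :
    evalAt z (conjFun f) = conj (evalAt (conj z) f) := SectorHol.evalAt_mk hz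

/-- The conjugation `f ↦ conj (f (conj t))`. -/
def conjHol (T : EReal) : SectorHol T →ₛₗᵢ[starRingEnd ℂ] SectorHol T where
  toFun := conjFun
  map_add' f g := SectorHol.ext fun z hz => by
    simp only [evalAt_conjFun _ hz, map_add]
  map_smul' c f := SectorHol.ext fun z hz => by
    simp only [evalAt_conjFun _ hz, map_smul, smul_eq_mul, map_mul]
  norm_map' f := by
    change ‖conjFun f‖ = ‖f‖
    refine le_antisymm (SectorHol.norm_le (norm_nonneg _) fun z hz => ?_)
      (SectorHol.norm_le (norm_nonneg _) fun z hz => ?_)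
    · rw [evalAt_conjFun _ hz, RCLike.norm_conj]
      exact norm_evalAt_le _ f
    refine le_trans ?_ (norm_evalAt_le (conj z) (conjFun f))
    rw [evalAt_conjFun _ (conj_mem_sector hz), Complex.conj_conj, RCLike.norm_conj]

theorem evalAt_conjHol (f : SectorHol T) {z : ℂ} (hz : z ∈ sector T) :
    evalAt z (conjHol T f) = conj (evalAt (conj z) f) := evalAt_conjFun f hz

theorem conjHol_mul (f g : SectorHol T) : conjHol T (f * g) = conjHol T f * conjHol T g :=
  SectorHol.ext fun z hz => by
    simp only [evalAt_conjHol _ hz, evalAt_mul, map_mul]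

theorem conjHol_decay {c : ℝ} (hc : 0 ≤ c) : conjHol T (decay T hc) = decay T hc :=
  SectorHol.ext fun z hz => by
    rw [evalAt_conjHol _ hz, evalAt_decay hc (conj_mem_sector hz), evalAt_decay hc hz,
      ← Complex.exp_conj]
    simp

/-! ### Primitives by integration along rays from the vertex -/

section Primitive

open MeasureTheory intervalIntegral

variable {F : ℂ → ℂ}

theorem continuousOn_ray (hF : ContinuousOn F (sector T)) {t : ℂ} (ht : t ∈ sector T) :
    ContinuousOn (fun τ : ℝ => F (τ * t)) (Set.Ioc 0 1) :=
  hF.comp (by fun_prop) fun _ hτ => smul_mem_sector ht hτ.1 hτ.2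

theorem intervalIntegrable_of_bounded_Ioc {f : ℝ → ℂ} (hf : ContinuousOn f (Set.Ioc 0 1)) {M : ℝ}
    (hM : ∀ τ ∈ Set.Ioc (0 : ℝ) 1, ‖f τ‖ ≤ M) : IntervalIntegrable f volume 0 1 := by
  rw [intervalIntegrable_iff_integrableOn_Ioc_of_le zero_le_one]
  exact IntegrableOn.of_bound (by simp) (hf.aestronglyMeasurable measurableSet_Ioc) M
    (ae_restrict_of_forall_mem measurableSet_Ioc hM)

/-- Differentiation under the integral sign. The vertex lies outside the sector, so the boundedness
hypothesis replaces continuity of `F` as `τ → 0`. -/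
theorem differentiableAt_rayIntegral (hF : DifferentiableOn ℂ F (sector T))
    (hb : ∀ R : ℝ, ∃ M, ∀ s ∈ sector T, ‖s‖ ≤ R → ‖F s‖ ≤ M) {t : ℂ} (ht : t ∈ sector T) :
    DifferentiableAt ℂ (fun t => ∫ τ in (0 : ℝ)..1, t * F (τ * t)) t := by
  obtain ⟨r, hr, hball⟩ := Metric.isOpen_iff.mp (isOpen_sector T) t ht
  obtain ⟨M, hM⟩ := hb (‖t‖ + r)
  have hnorm : ∀ x ∈ Metric.ball t r, ‖x‖ ≤ ‖t‖ + r := fun x hx => by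
    have := norm_le_norm_add_norm_sub' x t
    rw [mem_ball_iff_norm] at hx
    linarith
  have hFr : ∀ x ∈ Metric.ball t r, ∀ τ ∈ Set.Ioc (0 : ℝ) 1, ‖x * F (τ * x)‖ ≤ (‖t‖ + r) * M := by
    intro x hx τ hτ
    rw [norm_mul]
    have h1 : ‖F (τ * x)‖ ≤ M := by
      refine hM _ (smul_mem_sector (hball hx) hτ.1 hτ.2) ?_
      rw [norm_mul, Complex.norm_real, Real.norm_of_nonneg hτ.1.le]
      exact (mul_le_of_le_one_left (norm_nonneg _) hτ.2).trans (hnorm x hx)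
    have := (norm_nonneg _).trans h1
    gcongr
    exact hnorm x hx
  have hd : ∀ x ∈ sector T, ∀ τ ∈ Set.Ioc (0 : ℝ) 1,
      HasDerivAt (fun x => x * F (τ * x)) (F (τ * x) + x * (τ * deriv F (τ * x))) x := by
    intro x hx τ hτ
    have h1 := (hF.differentiableAt
      ((isOpen_sector T).mem_nhds (smul_mem_sector hx hτ.1 hτ.2))).hasDerivAt
    have h2 : HasDerivAt (fun x => F (τ * x)) (τ * deriv F (τ * x)) x := by
      have := h1.comp x ((hasDerivAt_id x).const_mul (τ : ℂ))
      simpa [mul_comm, Function.comp_def] using this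
    simpa only [id_eq, one_mul] using! (hasDerivAt_id x).mul h2
  have hcont : ∀ x ∈ sector T, ContinuousOn (fun τ : ℝ => x * F (τ * x)) (Set.Ioc 0 1) :=
    fun x hx => continuousOn_const.mul (continuousOn_ray hF.continuousOn hx)
  have hder := ((hF.deriv (isOpen_sector T)).continuousOn)
  have key := intervalIntegral.hasDerivAt_integral_of_dominated_loc_of_deriv_le
    (𝕜 := ℂ) (μ := volume) (a := 0) (b := 1) (x₀ := t) (s := Metric.ball t (r / 2))
    (F := fun x τ => x * F (τ * x))
    (F' := fun x τ => F (τ * x) + x * (τ * deriv F (τ * x)))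
    (bound := fun _ => (‖t‖ + r) * M / (r / 3))
    (Metric.ball_mem_nhds _ (by positivity)) ?_ ?_ ?_ ?_ ?_ ?_
  · exact key.2.differentiableAt
  · filter_upwards [(isOpen_sector T).mem_nhds ht] with x hx
    rw [Set.uIoc_of_le zero_le_one]
    exact (hcont x hx).aestronglyMeasurable measurableSet_Ioc
  · exact intervalIntegrable_of_bounded_Ioc (hcont t ht) (hFr t (Metric.mem_ball_self hr))
  · rw [Set.uIoc_of_le zero_le_one]
    refine ContinuousOn.aestronglyMeasurable ?_ measurableSet_Ioc
    exact (continuousOn_ray hF.continuousOn ht).add (continuousOn_const.mul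
      ((by fun_prop : Continuous fun τ : ℝ => (τ : ℂ)).continuousOn.mul (continuousOn_ray hder ht)))
  · refine Filter.Eventually.of_forall fun τ hτ x hx => ?_
    rw [Set.uIoc_of_le zero_le_one] at hτ
    have hx' : ∀ y ∈ Metric.closedBall x (r / 3), y ∈ Metric.ball t r := fun y hy => by
      have h1 := Metric.mem_closedBall.mp hy
      have h2 := Metric.mem_ball.mp hx
      have := dist_triangle y x t
      exact Metric.mem_ball.mpr (by linarith)
    -- The Cauchy estimate is applied to `x ↦ x * F (τ * x)` as a whole, on a disc whose radius does
    -- not depend on `τ`; the derivative bound is therefore uniform down to `τ = 0`. The radii fit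
    -- because `r/2 + r/3 < r`.
    rw [← (hd x (hball (hx' x (Metric.mem_closedBall_self (by positivity)))) τ hτ).deriv]
    refine Complex.norm_deriv_le_of_forall_mem_sphere_norm_le (by positivity) ?_ fun y hy =>
      hFr y (hx' y (Metric.sphere_subset_closedBall hy)) τ hτ
    refine DifferentiableOn.diffContOnCl fun y hy => ?_
    rw [closure_ball _ (by positivity)] at hy
    exact (hd y (hball (hx' y hy)) τ hτ).differentiableAt.differentiableWithinAt
  · exact intervalIntegrable_const
  · refine Filter.Eventually.of_forall fun τ hτ x hx => ?_
    rw [Set.uIoc_of_le zero_le_one] at hτ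
    exact hd x (hball (Metric.ball_subset_ball (by linarith) hx)) τ hτ

/-- The integral along rays from the origin is a primitive. -/
theorem hasDerivAt_rayIntegral (hF : DifferentiableOn ℂ F (sector T))
    (hb : ∀ R : ℝ, ∃ M, ∀ s ∈ sector T, ‖s‖ ≤ R → ‖F s‖ ≤ M) {t : ℂ} (ht : t ∈ sector T) :
    HasDerivAt (fun t => ∫ τ in (0 : ℝ)..1, t * F (τ * t)) (F t) t := by
  set G : ℂ → ℂ := fun t => ∫ τ in (0 : ℝ)..1, t * F (τ * t) with hG
  have h1 : HasDerivAt G (deriv G t) t := (differentiableAt_rayIntegral hF hb ht).hasDerivAt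
  have hcont : ContinuousOn (fun τ : ℝ => t * F (τ * t)) (Set.Ioc 0 1) :=
    continuousOn_const.mul (continuousOn_ray hF.continuousOn ht)
  -- On the ray through `t` the function `G` is an ordinary integral with variable upper limit. Its
  -- derivative at `r = 1` is both `t * F t` and `t * G'(t)`, which identifies `G'` without any
  -- appeal to path independence.
  have hray : ∀ r : ℝ, G (r * t) = ∫ σ in (0 : ℝ)..r, t * F (σ * t) := by
    intro r
    have := smul_integral_comp_mul_right (a := 0) (b := 1) (fun σ : ℝ => t * F (σ * t)) r
    rw [zero_mul, one_mul] at this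
    rw [← this, hG, ← intervalIntegral.integral_smul]
    refine intervalIntegral.integral_congr fun τ _ => ?_
    simp only [Complex.real_smul]
    push_cast
    ring_nf
  have h2 : HasDerivAt (fun r : ℝ => G (r * t)) (deriv G t * t) 1 := by
    have h1' : HasDerivAt G (deriv G t) (((1 : ℝ) : ℂ) * t) := by simpa using h1
    have h3 : HasDerivAt (fun r : ℝ => (r : ℂ) * t) t 1 := by
      simpa using (Complex.ofRealCLM.hasDerivAt (x := (1 : ℝ))).mul_const t
    exact h1'.comp (1 : ℝ) h3
  have hcat : ContinuousAt (fun τ : ℝ => t * F (τ * t)) 1 := by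
    refine continuousAt_const.mul ?_
    have h4 : ContinuousAt F (((1 : ℝ) : ℂ) * t) := by
      simpa using (hF.continuousOn.continuousAt ((isOpen_sector T).mem_nhds ht))
    exact ContinuousAt.comp (f := fun τ : ℝ => (τ : ℂ) * t) h4 (by fun_prop)
  have hmeas : StronglyMeasurableAtFilter (fun τ : ℝ => t * F (τ * t)) (nhds 1) := by
    have hopen : IsOpen ((fun τ : ℝ => (τ : ℂ) * t) ⁻¹' sector T) :=
      (isOpen_sector T).preimage (by fun_prop)
    refine ContinuousOn.stronglyMeasurableAtFilter hopen ?_ 1 (by simpa using ht)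
    exact continuousOn_const.mul (hF.continuousOn.comp (by fun_prop) fun _ h => h)
  obtain ⟨M, hM⟩ := hb ‖t‖
  have hint : IntervalIntegrable (fun τ : ℝ => t * F (τ * t)) volume 0 1 := by
    refine intervalIntegrable_of_bounded_Ioc hcont (M := ‖t‖ * M) fun τ hτ => ?_
    rw [norm_mul]
    gcongr
    refine hM _ (smul_mem_sector ht hτ.1 hτ.2) ?_
    rw [norm_mul, Complex.norm_real, Real.norm_of_nonneg hτ.1.le]
    exact mul_le_of_le_one_left (norm_nonneg _) hτ.2
  have h3 : HasDerivAt (fun r : ℝ => G (r * t)) (t * F t) 1 := by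
    have := integral_hasDerivAt_right hint hmeas hcat
    simp only [Complex.ofReal_one, one_mul] at this
    exact this.congr_of_eventuallyEq (Filter.Eventually.of_forall hray)
  have ht0 : t ≠ 0 := fun h => by simpa [h] using re_pos_of_mem_sector ht
  have h4 : deriv G t = F t := by
    have := h2.unique h3
    rw [mul_comm] at this
    exact mul_left_cancel₀ ht0 this
  rwa [h4] at h1

end Primitive

/-! ### Time integration in the sector -/

section Volterra

open MeasureTheory intervalIntegral

/-- The integral `∫_0^t e^{-c(t-s)} f(s) ds` along the ray from the origin to `t`. -/
def volterraFun (c : ℝ) (f : SectorHol T) (t : ℂ) : ℂ :=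
  ∫ τ in (0 : ℝ)..1, t * (Complex.exp (-(c : ℂ) * ((1 - τ) * t)) * evalAt (τ * t) f)

/-- Pulling `exp(-ct)` out leaves a ray integral of a fixed holomorphic function, to which
`hasDerivAt_rayIntegral` applies; the product rule then gives the differential equation. -/
theorem volterraFun_eq (c : ℝ) (f : SectorHol T) (t : ℂ) :
    volterraFun c f t = Complex.exp (-(c : ℂ) * t) *
      ∫ τ in (0 : ℝ)..1, t * (Complex.exp (c * (τ * t)) * evalAt (τ * t) f) := by
  rw [volterraFun, ← intervalIntegral.integral_const_mul]
  refine intervalIntegral.integral_congr fun τ _ => ?_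
  have : Complex.exp (-(c : ℂ) * ((1 - τ) * t)) =
      Complex.exp (-(c : ℂ) * t) * Complex.exp (c * (τ * t)) := by
    rw [← Complex.exp_add]; congr 1; ring
  simp only [this]
  ring

theorem hasDerivAt_volterraFun (c : ℝ) (f : SectorHol T) {t : ℂ} (ht : t ∈ sector T) :
    HasDerivAt (volterraFun c f) (-(c : ℂ) * volterraFun c f t + evalAt t f) t := by
  have h1 : HasDerivAt (fun t : ℂ => Complex.exp (-(c : ℂ) * t))
      (-(c : ℂ) * Complex.exp (-(c : ℂ) * t)) t := by
    have := (((hasDerivAt_id t).const_mul (-(c : ℂ)))).cexp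
    simpa [mul_comm] using this
  have h2 := hasDerivAt_rayIntegral (F := fun s => Complex.exp (c * s) * evalAt s f)
    (DifferentiableOn.mul (by fun_prop) (differentiableOn_evalAt f)) (fun R => by
      refine ⟨Real.exp (|c| * R) * ‖f‖, fun s _ hs => ?_⟩
      rw [norm_mul]
      refine mul_le_mul ?_ (norm_evalAt_le s f) (norm_nonneg _) (Real.exp_pos _).le
      refine (Complex.norm_exp_le_exp_norm _).trans (Real.exp_le_exp.mpr ?_)
      rw [norm_mul, Complex.norm_real, Real.norm_eq_abs]
      gcongr) ht
  have h3 := h1.mul h2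
  have h4 : volterraFun c f = (fun t : ℂ => Complex.exp (-(c : ℂ) * t)) *
      fun t => ∫ τ in (0 : ℝ)..1, t * (Complex.exp (c * (τ * t)) * evalAt (τ * t) f) :=
    funext fun t => volterraFun_eq c f t
  rw [volterraFun_eq, h4]
  refine h3.congr_deriv ?_
  have h5 : Complex.exp (-(c : ℂ) * t) * (Complex.exp (c * t) * evalAt t f) = evalAt t f := by
    rw [← mul_assoc, ← Complex.exp_add]
    simp
  rw [h5, mul_assoc]

theorem norm_volterra_integrand_le (c : ℝ) (f : SectorHol T) {t : ℂ} (τ : ℝ) :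
    ‖t * (Complex.exp (-(c : ℂ) * ((1 - τ) * t)) * evalAt (τ * t) f)‖ ≤
      ‖t‖ * Real.exp (-(c * t.re) * (1 - τ)) * ‖f‖ := by
  have : ‖Complex.exp (-(c : ℂ) * ((1 - τ) * t))‖ = Real.exp (-(c * t.re) * (1 - τ)) := by
    rw [Complex.norm_exp]
    congr 1
    have h : -(c : ℂ) * ((1 - τ) * t) = ((-c * (1 - τ) : ℝ) : ℂ) * t := by push_cast; ring
    rw [h, Complex.re_ofReal_mul]
    ring
  rw [norm_mul, norm_mul, this, ← mul_assoc]
  gcongr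
  exact norm_evalAt_le _ _

/-- The exponential has modulus at most 1 on the ray. This bound supplies the smallness for short
times and the vanishing as `t → 0`. -/
theorem norm_volterraFun_le_norm {c : ℝ} (hc : 0 ≤ c) (f : SectorHol T) {t : ℂ}
    (ht : t ∈ sector T) : ‖volterraFun c f t‖ ≤ ‖t‖ * ‖f‖ := by
  have h := intervalIntegral.norm_integral_le_of_norm_le_const (a := (0 : ℝ)) (b := 1)
    (C := ‖t‖ * ‖f‖)
    (f := fun τ : ℝ => t * (Complex.exp (-(c : ℂ) * ((1 - τ) * t)) * evalAt (τ * t) f))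
    fun τ hτ => ?_
  · rwa [sub_zero, abs_one, mul_one] at h
  · rw [Set.uIoc_of_le zero_le_one] at hτ
    refine (norm_volterra_integrand_le c f τ).trans ?_
    have : Real.exp (-(c * t.re) * (1 - τ)) ≤ 1 := by
      rw [Real.exp_le_one_iff]
      have := re_pos_of_mem_sector ht
      have h1 : 0 ≤ 1 - τ := by linarith [hτ.2]
      have : 0 ≤ c * t.re * (1 - τ) := by positivity
      linarith
    calc _ ≤ ‖t‖ * 1 * ‖f‖ := by gcongr
      _ = _ := by ring

/-- The exponential integrates to at most `1/(c Re t)` over the ray parameter, and `|t| ≤ 2 Re t`.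
This bound is uniform in time and carries the parabolic gain. -/
theorem norm_volterraFun_le {c : ℝ} (hc : 0 < c) (f : SectorHol T) {t : ℂ}
    (ht : t ∈ sector T) : ‖volterraFun c f t‖ ≤ 2 / c * ‖f‖ := by
  have hre := re_pos_of_mem_sector ht
  set b := c * t.re with hb
  have hb0 : 0 < b := by positivity
  have hder : ∀ τ : ℝ, HasDerivAt (fun τ => Real.exp (-b * (1 - τ)) / b)
      (Real.exp (-b * (1 - τ))) τ := fun τ => by
    have := ((((hasDerivAt_id τ).const_sub 1).const_mul (-b)).exp).div_const b
    refine this.congr_deriv ?_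
    simp only [id]
    field_simp
  have hint : ∫ τ in (0 : ℝ)..1, Real.exp (-b * (1 - τ)) ≤ 1 / b := by
    rw [intervalIntegral.integral_eq_sub_of_hasDerivAt (fun τ _ => hder τ)
      (Continuous.intervalIntegrable (by fun_prop) _ _)]
    have : 0 < Real.exp (-b * (1 - 0)) / b := by positivity
    simp only [sub_self, mul_zero, Real.exp_zero]
    linarith
  have h := intervalIntegral.norm_integral_le_of_norm_le (a := (0 : ℝ)) (b := 1) (μ := volume)
    (g := fun τ => ‖t‖ * Real.exp (-b * (1 - τ)) * ‖f‖)
    (f := fun τ : ℝ => t * (Complex.exp (-(c : ℂ) * ((1 - τ) * t)) * evalAt (τ * t) f))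
    zero_le_one (Filter.Eventually.of_forall fun τ _ => norm_volterra_integrand_le c f τ)
    (Continuous.intervalIntegrable (by fun_prop) _ _)
  have h' : ∫ τ in (0 : ℝ)..1, ‖t‖ * Real.exp (-b * (1 - τ)) * ‖f‖ =
      ‖t‖ * (∫ τ in (0 : ℝ)..1, Real.exp (-b * (1 - τ))) * ‖f‖ := by
    rw [intervalIntegral.integral_mul_const, intervalIntegral.integral_const_mul]
  refine (h.trans_eq h').trans ?_
  refine mul_le_mul_of_nonneg_right ?_ (norm_nonneg f)
  calc _ ≤ 2 * t.re * (1 / b) :=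
        mul_le_mul (norm_le_of_mem_sector ht) hint
          (intervalIntegral.integral_nonneg zero_le_one fun _ _ => (Real.exp_pos _).le)
          (by positivity)
    _ = _ := by rw [hb]; field_simp

theorem volterra_integrable (c : ℝ) (f : SectorHol T) {t : ℂ} (ht : t ∈ sector T) :
    IntervalIntegrable
      (fun τ : ℝ => t * (Complex.exp (-(c : ℂ) * ((1 - τ) * t)) * evalAt (τ * t) f))
      volume 0 1 := by
  refine intervalIntegrable_of_bounded_Ioc (continuousOn_const.mul (ContinuousOn.mul
    (by fun_prop) (continuousOn_ray (differentiableOn_evalAt f).continuousOn ht)))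
    (M := ‖t‖ * Real.exp (|c * t.re|) * ‖f‖) fun τ hτ =>
      (norm_volterra_integrand_le c f τ).trans ?_
  gcongr
  have h0 : 0 ≤ 1 - τ := by linarith [hτ.2]
  calc -(c * t.re) * (1 - τ) ≤ |c * t.re| * (1 - τ) := by gcongr; exact neg_le_abs _
    _ ≤ |c * t.re| * 1 := by gcongr; linarith [hτ.1]
    _ = _ := mul_one _

/-- The solution of `y' = -cy + f`, `y(0) = 0`. -/
def volterraHol {c : ℝ} (hc : 0 < c) (f : SectorHol T) : SectorHol T :=
  SectorHol.mk (volterraFun c f)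
    (fun _ ht => (hasDerivAt_volterraFun c f ht).differentiableAt.differentiableWithinAt)
    (2 / c * ‖f‖) fun _ ht => norm_volterraFun_le hc f ht

theorem evalAt_volterraHol {c : ℝ} (hc : 0 < c) (f : SectorHol T) {t : ℂ} (ht : t ∈ sector T) :
    evalAt t (volterraHol hc f) = volterraFun c f t := SectorHol.evalAt_mk ht

theorem volterraFun_add (c : ℝ) (f g : SectorHol T) {t : ℂ} (ht : t ∈ sector T) :
    volterraFun c (f + g) t = volterraFun c f t + volterraFun c g t := by
  unfold volterraFun
  rw [← intervalIntegral.integral_add (volterra_integrable c f ht) (volterra_integrable c g ht)]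
  refine intervalIntegral.integral_congr fun τ _ => ?_
  simp only [map_add, mul_add]

theorem volterraFun_smul (c : ℝ) (a : ℂ) (f : SectorHol T) (t : ℂ) :
    volterraFun c (a • f) t = a * volterraFun c f t := by
  unfold volterraFun
  rw [← intervalIntegral.integral_const_mul]
  refine intervalIntegral.integral_congr fun τ _ => ?_
  simp only [map_smul, smul_eq_mul]
  ring

open Classical in
/-- Solution operator of `y' = -cy + f`, `y(0) = 0`, for `c > 0` (and zero for `c ≤ 0`). -/
def volterra (T : EReal) (c : ℝ) : SectorHol T →L[ℂ] SectorHol T :=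
  if hc : 0 < c then
    LinearMap.mkContinuous
      { toFun := volterraHol hc
        map_add' := fun f g => SectorHol.ext fun t ht => by
          simp only [map_add, evalAt_volterraHol hc _ ht, volterraFun_add c f g ht]
        map_smul' := fun a f => SectorHol.ext fun t ht => by
          simp only [map_smul, evalAt_volterraHol hc _ ht, volterraFun_smul, smul_eq_mul,
            RingHom.id_apply] }
      (2 / c) fun f => SectorHol.norm_le (mul_nonneg (by positivity) (norm_nonneg f)) fun t ht => by
        change ‖evalAt t (volterraHol hc f)‖ ≤ _
        rw [evalAt_volterraHol hc f ht]
        exact norm_volterraFun_le hc f ht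
  else 0

theorem evalAt_volterra {c : ℝ} (hc : 0 < c) (f : SectorHol T) {t : ℂ} (ht : t ∈ sector T) :
    evalAt t (volterra T c f) = volterraFun c f t := by
  rw [volterra, dif_pos hc]
  exact evalAt_volterraHol hc f ht

theorem volterra_of_nonpos {c : ℝ} (hc : c ≤ 0) : volterra T c = 0 := dif_neg hc.not_gt

theorem hasDerivAt_volterra {c : ℝ} (hc : 0 < c) (f : SectorHol T) {t : ℂ} (ht : t ∈ sector T) :
    HasDerivAt (fun t => evalAt t (volterra T c f))
      (-(c : ℂ) * evalAt t (volterra T c f) + evalAt t f) t := by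
  rw [evalAt_volterra hc f ht]
  refine (hasDerivAt_volterraFun c f ht).congr_of_eventuallyEq ?_
  filter_upwards [(isOpen_sector T).mem_nhds ht] with s hs using evalAt_volterra hc f hs

theorem norm_evalAt_volterra_le (c : ℝ) (f : SectorHol T) {t : ℂ} (ht : t ∈ sector T) :
    ‖evalAt t (volterra T c f)‖ ≤ ‖t‖ * ‖f‖ := by
  rcases lt_or_ge 0 c with hc | hc
  · rw [evalAt_volterra hc f ht]; exact norm_volterraFun_le_norm hc.le f ht
  · rw [volterra_of_nonpos hc, zero_apply, map_zero, norm_zero]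
    exact mul_nonneg (norm_nonneg t) (norm_nonneg f)

theorem norm_volterra_le {c : ℝ} (hc : 0 < c) : ‖volterra T c‖ ≤ 2 / c := by
  refine ContinuousLinearMap.opNorm_le_bound _ (by positivity) fun f => ?_
  refine SectorHol.norm_le (mul_nonneg (by positivity) (norm_nonneg f)) fun t ht => ?_
  rw [evalAt_volterra hc f ht]
  exact norm_volterraFun_le hc f ht

theorem norm_volterra_le_time (c : ℝ) {S : ℝ} (hS : 0 ≤ S) :
    ‖volterra (S : EReal) c‖ ≤ 2 * S := by
  refine ContinuousLinearMap.opNorm_le_bound _ (by positivity) fun f => ?_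
  refine SectorHol.norm_le (mul_nonneg (by positivity) (norm_nonneg f)) fun t ht => ?_
  refine (norm_evalAt_volterra_le c f ht).trans ?_
  have h1 := norm_le_of_mem_sector ht
  have h2 : t.re < S := EReal.coe_lt_coe_iff.mp ht.2
  gcongr
  linarith

/-- Conjugation maps the ray to `conj t` onto the ray to `t`, and `c` is real. -/
theorem conjHol_volterra (c : ℝ) (f : SectorHol T) :
    conjHol T (volterra T c f) = volterra T c (conjHol T f) := by
  rcases lt_or_ge 0 c with hc | hc
  · refine SectorHol.ext fun t ht => ?_
    rw [evalAt_conjHol _ ht, evalAt_volterra hc _ ht, evalAt_volterra hc _ (conj_mem_sector ht),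
      volterraFun, volterraFun, ← intervalIntegral_conj]
    rw [intervalIntegral.integral_of_le zero_le_one, intervalIntegral.integral_of_le zero_le_one]
    refine setIntegral_congr_fun measurableSet_Ioc fun τ hτ => ?_
    simp only [map_mul, Complex.conj_conj, evalAt_conjHol _ (smul_mem_sector ht hτ.1 hτ.2),
      ← Complex.exp_conj, map_neg, map_sub, map_one, Complex.conj_ofReal]
  · rw [volterra_of_nonpos hc, zero_apply, map_zero,
      zero_apply]

end Volterra

end SectorHol

/-! ### Fourier coefficients on the torus and the norm of `H¹` -/

section Fourier

open MeasureTheory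
open scoped ComplexConjugate

theorem character_zero (x : Fin 3 → ℂ) : character 0 x = 1 := by simp [character]

theorem character_add (k l : Fin 3 → ℤ) (x : Fin 3 → ℂ) :
    character (k + l) x = character k x * character l x := by
  simp only [character, ← Complex.exp_add, ← mul_add, ← Finset.sum_add_distrib]
  simp [add_mul]

theorem norm_character (k : Fin 3 → ℤ) (x : Fin 3 → ℂ) :
    ‖character k x‖ = Real.exp (-∑ i, (k i : ℝ) * (x i).im) := by
  rw [character, Complex.norm_exp]
  congr 1
  simp

theorem norm_character_realPt (k : Fin 3 → ℤ) (x : Fin 3 → ℝ) : ‖character k (realPt x)‖ = 1 := by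
  simp [norm_character, realPt]

theorem conj_character_realPt (k : Fin 3 → ℤ) (x : Fin 3 → ℝ) :
    conj (character k (realPt x)) = character (-k) (realPt x) := by
  simp [character, realPt, ← Complex.exp_conj]

theorem continuous_character (k : Fin 3 → ℤ) : Continuous (character k) := by
  unfold character; fun_prop

theorem continuous_realPt : Continuous realPt := by unfold realPt; fun_prop

theorem continuous_character_realPt (k : Fin 3 → ℤ) : Continuous fun x => character k (realPt x) :=
  (continuous_character k).comp continuous_realPt

theorem character_add_single (k : Fin 3 → ℤ) (x : Fin 3 → ℂ) (i : Fin 3) :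
    character k (x + Pi.single i (2 * Real.pi : ℂ)) = character k x := by
  have h : ∑ j, (k j : ℂ) * (x + Pi.single i (2 * Real.pi : ℂ) : Fin 3 → ℂ) j =
      ∑ j, (k j : ℂ) * x j + k i * (2 * Real.pi) := by
    simp only [Pi.add_apply, mul_add, Finset.sum_add_distrib]
    congr 1
    rw [Finset.sum_eq_single i] <;> simp +contextual
  rw [character, h, mul_add, Complex.exp_add, character]
  have : Complex.I * (k i * (2 * Real.pi)) = k i * (2 * Real.pi * Complex.I) := by ring
  rw [this, Complex.exp_int_mul_two_pi_mul_I, mul_one]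

theorem realPt_add_single (x : Fin 3 → ℝ) (i : Fin 3) :
    realPt (x + Pi.single i (2 * Real.pi)) = realPt x + Pi.single i (2 * Real.pi : ℂ) := by
  ext j
  by_cases h : j = i
  · subst h; simp [realPt]
  · simp [realPt, h]

theorem measurableSet_cell : MeasurableSet cell :=
  MeasurableSet.univ_pi fun _ => measurableSet_Ioc

theorem restrict_cell : (volume : Measure (Fin 3 → ℝ)).restrict cell =
    Measure.pi fun _ => (volume : Measure ℝ).restrict (Set.Ioc 0 (2 * Real.pi)) := by
  rw [cell, volume_pi, Measure.restrict_pi_pi]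

instance : IsFiniteMeasure ((volume : Measure (Fin 3 → ℝ)).restrict cell) := by
  rw [restrict_cell]; infer_instance

theorem integral_exp_int_mul (n : ℤ) :
    ∫ x in Set.Ioc 0 (2 * Real.pi), Complex.exp (Complex.I * (n * (x : ℂ))) =
      if n = 0 then (2 * Real.pi : ℂ) else 0 := by
  rw [← intervalIntegral.integral_of_le Real.two_pi_pos.le]
  split_ifs with h
  · subst h; simp
  · have hn : Complex.I * n ≠ 0 := mul_ne_zero Complex.I_ne_zero (by exact_mod_cast h)
    simp only [← mul_assoc]
    rw [integral_exp_mul_complex hn]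
    have : Complex.I * n * ((2 * Real.pi : ℝ) : ℂ) = n * (2 * Real.pi * Complex.I) := by
      push_cast; ring
    rw [this, Complex.exp_int_mul_two_pi_mul_I]
    simp

theorem integral_character (k : Fin 3 → ℤ) :
    ∫ x in cell, character k (realPt x) = if k = 0 then ((2 * Real.pi) ^ 3 : ℂ) else 0 := by
  have h : ∀ x, character k (realPt x) =
      ∏ i, (fun i (y : ℝ) => Complex.exp (Complex.I * (k i * (y : ℂ)))) i (x i) := fun x => by
    simp only [character, realPt, Finset.mul_sum, Complex.exp_sum]
  simp only [h]
  rw [restrict_cell, integral_fintype_prod_eq_prod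
    (f := fun i (y : ℝ) => Complex.exp (Complex.I * (k i * (y : ℂ))))]
  simp only [integral_exp_int_mul]
  split_ifs with hk
  · simp [hk]
  · obtain ⟨i, hi⟩ := Function.ne_iff.mp hk
    exact Finset.prod_eq_zero (Finset.mem_univ i) (if_neg hi)

theorem integrable_of_continuous {E : Type*} [NormedAddCommGroup E]
    {f : (Fin 3 → ℝ) → E} {C : ℝ} (hf : Continuous f)
    (hC : ∀ x, ‖f x‖ ≤ C) : Integrable f (volume.restrict cell) :=
  Integrable.of_bound hf.aestronglyMeasurable C (Filter.Eventually.of_forall hC)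

variable {E : Type*} [NormedAddCommGroup E] [NormedSpace ℂ E]

theorem integrable_character_smul (k : Fin 3 → ℤ) {f : (Fin 3 → ℝ) → E}
    (hf : Integrable f (volume.restrict cell)) :
    Integrable (fun x => character k (realPt x) • f x) (volume.restrict cell) :=
  hf.mono ((continuous_character_realPt k).aestronglyMeasurable.smul hf.aestronglyMeasurable)
    (Filter.Eventually.of_forall fun x => by rw [norm_smul, norm_character_realPt, one_mul])

theorem coeff_sub {f g : (Fin 3 → ℝ) → E} (hf : Integrable f (volume.restrict cell))
    (hg : Integrable g (volume.restrict cell)) (k : Fin 3 → ℤ) :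
    coeff (fun x => f x - g x) k = coeff f k - coeff g k := by
  simp only [coeff, smul_sub]
  rw [integral_sub (integrable_character_smul _ hf) (integrable_character_smul _ hg), smul_sub]

theorem MemH1.integrable {f : (Fin 3 → ℝ) → E} (hf : MemH1 f) :
    Integrable f (volume.restrict cell) := hf.memLp.integrable one_le_two

theorem two_pi_cube_ne_zero : ((2 * Real.pi) ^ 3 : ℂ) ≠ 0 := by
  have := Real.pi_ne_zero
  exact_mod_cast pow_ne_zero 3 (mul_ne_zero two_ne_zero this)

/-- The coefficients of an absolutely convergent Fourier series. -/
theorem coeff_series [CompleteSpace E] {a : (Fin 3 → ℤ) → E} (ha : Summable fun k => ‖a k‖)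
    (k : Fin 3 → ℤ) : coeff (fun x => ∑' l, character l (realPt x) • a l) k = a k := by
  have h1 : ∀ x, character (-k) (realPt x) • ∑' l, character l (realPt x) • a l =
      ∑' l, character (l - k) (realPt x) • a l := fun x => by
    have hs : Summable fun l => character l (realPt x) • a l := by
      refine Summable.of_norm ?_
      simpa only [norm_smul, norm_character_realPt, one_mul] using ha
    rw [← hs.tsum_const_smul]
    refine tsum_congr fun l => ?_
    rw [smul_smul, ← character_add, neg_add_eq_sub]
  have hint : ∀ l, Integrable (fun x => character (l - k) (realPt x) • a l)
      (volume.restrict cell) := fun l => integrable_character_smul _ (integrable_const _)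
  have h2 : ∀ l, ∫ x in cell, character (l - k) (realPt x) • a l =
      if l = k then ((2 * Real.pi) ^ 3 : ℂ) • a k else 0 := fun l => by
    rw [integral_smul_const, integral_character]
    simp only [sub_eq_zero]
    split_ifs with h
    · rw [h]
    · rw [zero_smul]
  simp only [coeff, h1]
  rw [← integral_tsum_of_summable_integral_norm hint]
  · simp only [h2, tsum_ite_eq]
    rw [smul_smul, inv_mul_cancel₀ two_pi_cube_ne_zero, one_smul]
  · simp only [norm_smul, norm_character_realPt, one_mul, integral_const]
    exact ha.const_smul _

theorem continuous_series [CompleteSpace E] {a : (Fin 3 → ℤ) → E} (ha : Summable fun k => ‖a k‖) :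
    Continuous fun x => ∑' l, character l (realPt x) • a l :=
  continuous_tsum (fun l => (continuous_character_realPt l).smul continuous_const) ha fun l x => by
    rw [norm_smul, norm_character_realPt, one_mul]

theorem waveNorm_def (k : Fin 3 → ℤ) : normEucl (waveVec k) = waveNorm k := rfl

theorem h1_term_eq (f : (Fin 3 → ℝ) → E) (k : Fin 3 → ℤ) :
    ENNReal.ofReal (normEucl (waveVec k) ^ 2) * ‖coeff f k‖ₑ ^ 2 =
      ENNReal.ofReal (waveNorm k ^ 2 * ‖coeff f k‖ ^ 2) := by
  rw [waveNorm_def, ENNReal.ofReal_mul (sq_nonneg _), ← ofReal_norm,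
    ENNReal.ofReal_pow (norm_nonneg _)]

theorem h1ENorm_eq {f : (Fin 3 → ℝ) → E}
    (hf : Summable fun k => waveNorm k ^ 2 * ‖coeff f k‖ ^ 2) :
    h1ENorm f = ENNReal.ofReal (√(∑' k, waveNorm k ^ 2 * ‖coeff f k‖ ^ 2)) := by
  simp only [h1ENorm, h1_term_eq]
  rw [← ENNReal.ofReal_tsum_of_nonneg (fun k => by positivity) hf,
    ENNReal.ofReal_rpow_of_nonneg (tsum_nonneg fun k => by positivity) (by norm_num),
    Real.sqrt_eq_rpow]

theorem summable_of_h1ENorm_lt_top {f : (Fin 3 → ℝ) → E} (hf : h1ENorm f < ∞) :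
    Summable fun k => waveNorm k ^ 2 * ‖coeff f k‖ ^ 2 := by
  simp only [h1ENorm, h1_term_eq] at hf
  have h : ∑' k, ENNReal.ofReal (waveNorm k ^ 2 * ‖coeff f k‖ ^ 2) ≠ ∞ := fun h => by
    rw [h, ENNReal.top_rpow_of_pos (by norm_num)] at hf
    exact lt_irrefl _ hf
  refine (ENNReal.summable_toReal h).congr fun k => ENNReal.toReal_ofReal (by positivity)

theorem sq_h1Norm {f : (Fin 3 → ℝ) → E} (hf : h1ENorm f < ∞) :
    h1Norm f ^ 2 = ∑' k, waveNorm k ^ 2 * ‖coeff f k‖ ^ 2 := by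
  rw [h1Norm, h1ENorm_eq (summable_of_h1ENorm_lt_top hf),
    ENNReal.toReal_ofReal (Real.sqrt_nonneg _),
    Real.sq_sqrt (tsum_nonneg fun k => by positivity)]

/-- The character `e^{i(k,x)}` as an element of `L²`. -/
def charLp (k : Fin 3 → ℤ) : Lp ℂ 2 ((volume : Measure (Fin 3 → ℝ)).restrict cell) :=
  MemLp.toLp (fun x => character k (realPt x))
    (MemLp.of_bound (continuous_character_realPt k).aestronglyMeasurable 1
      (Filter.Eventually.of_forall fun x => (norm_character_realPt k x).le))

theorem inner_charLp (k : Fin 3 → ℤ) (f : Lp ℂ 2 ((volume : Measure (Fin 3 → ℝ)).restrict cell)) :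
    inner ℂ (charLp k) f = ∫ x in cell, character (-k) (realPt x) • f x := by
  rw [L2.inner_def]
  refine integral_congr_ae ?_
  filter_upwards [MemLp.coeFn_toLp (MemLp.of_bound (p := 2)
    (continuous_character_realPt k).aestronglyMeasurable 1
      (Filter.Eventually.of_forall fun x => (norm_character_realPt k x).le))] with x hx
  rw [charLp, hx, RCLike.inner_apply, conj_character_realPt, smul_eq_mul, mul_comm]

theorem inner_charLp_charLp (k l : Fin 3 → ℤ) :
    inner ℂ (charLp k) (charLp l) = if l = k then ((2 * Real.pi) ^ 3 : ℂ) else 0 := by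
  rw [inner_charLp]
  have : ∫ x in cell, character (-k) (realPt x) • charLp l x =
      ∫ x in cell, character (l - k) (realPt x) := by
    refine integral_congr_ae ?_
    filter_upwards [MemLp.coeFn_toLp (MemLp.of_bound (p := 2)
      (continuous_character_realPt l).aestronglyMeasurable 1
        (Filter.Eventually.of_forall fun x => (norm_character_realPt l x).le))] with x hx
    rw [charLp, hx, smul_eq_mul, ← character_add, neg_add_eq_sub]
  rw [this, integral_character]
  simp only [sub_eq_zero]

/-- Every square summable family consists of the Fourier coefficients of an `L²` function. -/
theorem exists_coeff_eq {a : (Fin 3 → ℤ) → ℂ} (ha : Summable fun k => ‖a k‖ ^ 2) :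
    ∃ f : (Fin 3 → ℝ) → ℂ, TorusPeriodic f ∧ MemLp f 2 (volume.restrict cell) ∧
      ∀ k, coeff f k = a k := by
  set c : ℝ := √((2 * Real.pi) ^ 3) with hc
  have hc0 : 0 < c := by have := Real.pi_pos; positivity
  have hc2 : (c : ℂ) * c = (2 * Real.pi) ^ 3 := by
    have := Real.pi_pos
    rw [← Complex.ofReal_mul, hc, Real.mul_self_sqrt (by positivity)]
    push_cast; rfl
  have hcC : (c : ℂ) ≠ 0 := by exact_mod_cast hc0.ne'
  -- The characters have norm `c = (2π)^{3/2}` on the cell; after normalization, orthonormality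
  -- turns square summability into convergence in `L²` (Riesz-Fischer).
  have hon : Orthonormal ℂ fun k => (c : ℂ)⁻¹ • charLp k := by
    rw [orthonormal_iff_ite]
    intro k l
    rw [inner_smul_left, inner_smul_right, inner_charLp_charLp, map_inv₀, Complex.conj_ofReal]
    by_cases h : k = l
    · subst h
      simp only [if_true, ← hc2]
      field_simp
    · simp [h, Ne.symm h]
  have hsum : Summable fun k => a k • charLp k := by
    have h1 := (hon.orthogonalFamily.summable_iff_norm_sq_summable fun k => (c : ℂ) * a k).mpr (by
      simpa [mul_pow] using ha.mul_left (c ^ 2))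
    refine h1.congr fun k => ?_
    simp only [LinearIsometry.toSpanSingleton_apply, smul_smul]
    congr 1
    field_simp
  set g := ∑' k, a k • charLp k with hg
  have hgk : ∀ k, inner ℂ (charLp k) g = (2 * Real.pi) ^ 3 * a k := fun k => by
    have h1 := hsum.hasSum.mapL (innerSL ℂ (charLp k))
    simp only [innerSL_apply_apply, inner_smul_right, inner_charLp_charLp] at h1
    rw [← hg] at h1
    refine h1.unique ?_
    have := hasSum_ite_eq k (a k * (2 * Real.pi) ^ 3)
    rw [mul_comm] at this
    refine this.congr_fun fun l => ?_
    split_ifs with h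
    · rw [h]; ring
    · simp
  have h0 := Real.two_pi_pos
  -- An `L²` class on the cell has no values outside it; reducing each coordinate modulo `2π` gives
  -- a representative periodic at every point.
  let f : (Fin 3 → ℝ) → ℂ := fun x => g fun i => toIocMod h0 0 (x i)
  have hfg : ∀ x ∈ cell, f x = g x := fun x hx => by
    have : (fun i => toIocMod h0 0 (x i)) = x := by
      ext i
      exact (toIocMod_eq_self h0).mpr (by simpa using hx i (Set.mem_univ i))
    simp only [f, this]
  have hfae : f =ᵐ[volume.restrict cell] g := by
    filter_upwards [ae_restrict_mem measurableSet_cell] with x hx using hfg x hx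
  refine ⟨f, fun x i => ?_, (memLp_congr_ae hfae).mpr (Lp.memLp g), fun k => ?_⟩
  · simp only [f]
    congr 1
    ext j
    by_cases hj : j = i
    · subst hj; simp
    · simp [hj]
  · rw [coeff, setIntegral_congr_fun measurableSet_cell fun x hx => by
      simp only [hfg x hx]; rfl, ← inner_charLp, hgk, smul_eq_mul, ← mul_assoc,
      inv_mul_cancel₀ two_pi_cube_ne_zero, one_mul]

theorem coeff_apply {f : (Fin 3 → ℝ) → Vec3} (hf : Integrable f (volume.restrict cell))
    (k : Fin 3 → ℤ) (j : Fin 3) : coeff f k j = coeff (fun x => f x j) k := by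
  have := (EuclideanSpace.proj (𝕜 := ℂ) j : Vec3 →L[ℂ] ℂ).integral_comp_comm
    (integrable_character_smul (-k) hf)
  simp only [coeff, PiLp.smul_apply]
  congr 1
  exact this.symm

theorem coeff_neg_of_real {f : (Fin 3 → ℝ) → ℂ} (hf : ∀ x, (f x).im = 0) (k : Fin 3 → ℤ) :
    coeff f (-k) = conj (coeff f k) := by
  simp only [coeff, smul_eq_mul, map_mul, ← integral_conj]
  congr 1
  · rw [map_inv₀, map_pow, map_mul, Complex.conj_ofReal, map_ofNat]
  · congr 1
    ext x
    rw [conj_character_realPt, Complex.conj_eq_iff_im.mpr (hf x)]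

/-- The weak divergence condition is tested with the character of `-k`, whose partial derivatives
are `-i k_j` times itself. -/
theorem sum_mul_coeff_eq_zero {u : (Fin 3 → ℝ) → Vec3} (hu : Integrable u (volume.restrict cell))
    (hdiv : WeakDivFree u) (k : Fin 3 → ℤ) : ∑ j, (k j : ℂ) * coeff u k j = 0 := by
  have hφ : (fun x => character (-k) (realPt x)) = fun x : Fin 3 → ℝ =>
      Complex.exp (Complex.I * ∑ i, ((-k) i : ℂ) * (x i : ℂ)) := by
    ext x; simp [character, realPt]
  have hder : ∀ (x : Fin 3 → ℝ) (j : Fin 3),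
      fderiv ℝ (fun x => character (-k) (realPt x)) x (Pi.single j 1) =
        -(Complex.I * k j) * character (-k) (realPt x) := fun x j => by
    have h1 : HasDerivAt (fun s : ℝ => character (-k) (realPt (x + s • Pi.single j 1)))
        (-(Complex.I * k j) * character (-k) (realPt x)) 0 := by
      have h2 : ∀ s : ℝ, character (-k) (realPt (x + s • Pi.single j 1)) =
          character (-k) (realPt x) * Complex.exp (-(Complex.I * k j) * s) := fun s => by
        simp only [character, ← Complex.exp_add]
        congr 1
        have : ∀ i, (((-k) i : ℤ) : ℂ) * realPt (x + s • Pi.single j 1) i =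
            (((-k) i : ℤ) : ℂ) * realPt x i + if i = j then -(k j : ℂ) * s else 0 := fun i => by
          by_cases h : i = j
          · subst h; simp [realPt]; ring
          · simp [realPt, h]
        simp only [this, Finset.sum_add_distrib, Finset.sum_ite_eq', Finset.mem_univ, if_true]
        ring
      simp only [h2]
      have h3 : HasDerivAt (fun s : ℝ => Complex.exp (-(Complex.I * k j) * s))
          (-(Complex.I * k j)) 0 := by
        simpa using ((Complex.ofRealCLM.hasDerivAt (x := (0 : ℝ))).const_mul
          (-(Complex.I * k j))).cexp
      simpa [mul_comm] using h3.const_mul (character (-k) (realPt x))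
    have hd : DifferentiableAt ℝ (fun x => character (-k) (realPt x)) x := by
      rw [hφ]; fun_prop
    have h4 := hd.hasFDerivAt.hasLineDerivAt (Pi.single j 1)
    exact h4.unique h1
  have h := hdiv (fun x => character (-k) (realPt x)) (by
    rw [hφ]
    exact (contDiff_const.mul (ContDiff.sum fun i _ => contDiff_const.mul
      (Complex.ofRealCLM.contDiff.comp (contDiff_apply ℝ ℝ i)))).cexp) fun x i => by
    simp only [realPt_add_single, character_add_single]
  simp only [hder] at h
  have hu' : ∀ j, Integrable (fun x => u x j) (volume.restrict cell) := fun j =>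
    (EuclideanSpace.proj (𝕜 := ℂ) j : Vec3 →L[ℂ] ℂ).integrable_comp hu
  have hterm : ∀ x, ∑ j, u x j * (-(Complex.I * k j) * character (-k) (realPt x)) =
      ∑ j, -(Complex.I * k j) * (character (-k) (realPt x) • u x j) := fun x =>
    Finset.sum_congr rfl fun j _ => by rw [smul_eq_mul]; ring
  simp only [hterm] at h
  rw [integral_finsetSum _ fun j _ => (integrable_character_smul _ (hu' j)).const_mul _] at h
  simp only [integral_const_mul] at h
  have hc : ∀ j, coeff u k j = ((2 * Real.pi) ^ 3 : ℂ)⁻¹ *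
      ∫ x in cell, character (-k) (realPt x) * u x j := fun j => by
    rw [coeff_apply hu, coeff, smul_eq_mul]; rfl
  simp only [hc]
  calc _ = ((2 * Real.pi) ^ 3 : ℂ)⁻¹ * Complex.I * ∑ j, -(Complex.I * k j) *
        ∫ x in cell, character (-k) (realPt x) • u x j := by
        rw [Finset.mul_sum]
        refine Finset.sum_congr rfl fun j _ => ?_
        simp only [smul_eq_mul]
        linear_combination (((2 * Real.pi) ^ 3 : ℂ)⁻¹ * k j *
          ∫ x in cell, character (-k) (realPt x) * u x j) * Complex.I_sq
    _ = 0 := by rw [h, mul_zero]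

end Fourier

/-! ### Fourier series with exponentially decaying holomorphic coefficients -/

section Series

/-- A domain in which Fourier series with coefficients decaying like `exp (-Re t |k|_e ν/2)`
converge. -/
def wideDomain (ν : ℝ) (T : EReal) : Set (ℂ × (Fin 3 → ℂ)) :=
  {q | q.1 ∈ sector T ∧ √3 * ‖fun i => (q.2 i).im‖ < q.1.re * ν / 2}

theorem isOpen_wideDomain (ν : ℝ) (T : EReal) : IsOpen (wideDomain ν T) := by
  refine ((isOpen_sector T).preimage continuous_fst).inter ?_
  refine isOpen_lt (continuous_const.mul (continuous_norm.comp (continuous_pi fun i => ?_))) ?_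
  · exact Complex.continuous_im.comp ((continuous_apply i).comp continuous_snd)
  · exact ((Complex.continuous_re.comp continuous_fst).mul continuous_const).div_const 2

theorem le_one_of_norm_comparison {α : ℝ} (h : ∀ x : Fin 3 → ℂ, α * ‖x‖ ≤ normEucl x) : α ≤ 1 := by
  have h1 := h (Pi.single 0 1)
  rw [Pi.norm_single, norm_one, mul_one] at h1
  refine h1.trans ?_
  rw [normEucl, Real.sqrt_le_one]
  simp [Fin.sum_univ_three]

/-- As `α ≤ 1`, points of `Q(T)` satisfy `2 |Im x|_m < ν Re t / 2`, and `√3 ≤ 2`. The factor `√3`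
compares `∑ |k_i|` with `|k|_e` in the growth of the characters. -/
theorem domainQ_subset_wideDomain {ν α : ℝ} (hν : 0 < ν) (hα : 0 < α) (hα1 : α ≤ 1) (T : EReal) :
    domainQ ν α T ⊆ wideDomain ν T := by
  rintro q ⟨h1, h2⟩
  refine ⟨h1, ?_⟩
  set n := ‖fun i => (q.2 i).im‖
  have hn : 0 ≤ n := norm_nonneg _
  have hre := re_pos_of_mem_sector h1
  have h3 : n < ν * q.1.re / 4 := by
    rw [div_mul_eq_mul_div, div_lt_iff₀ (by positivity)] at h2
    have : q.1.re * (ν * α) ≤ q.1.re * (ν * 1) := by gcongr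
    linarith
  have h4 : √3 ≤ 2 := Real.sqrt_le_iff.mpr ⟨by norm_num, by norm_num⟩
  calc √3 * n ≤ 2 * n := by gcongr
    _ < q.1.re * ν / 2 := by linarith

theorem realPt_mem_wideDomain {ν : ℝ} (hν : 0 < ν) {T : EReal} {t : ℂ} (ht : t ∈ sector T)
    (x : Fin 3 → ℝ) : (t, realPt x) ∈ wideDomain ν T := by
  refine ⟨ht, ?_⟩
  have := re_pos_of_mem_sector ht
  have h0 : (fun i => (realPt x i).im) = 0 := by ext i; simp [realPt]
  change √3 * ‖fun i => (realPt x i).im‖ < t.re * ν / 2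
  rw [h0, norm_zero, mul_zero]
  positivity

theorem norm_character_le (k : Fin 3 → ℤ) (x : Fin 3 → ℂ) :
    ‖character k x‖ ≤ Real.exp (√3 * waveNorm k * ‖fun i => (x i).im‖) := by
  rw [norm_character]
  refine Real.exp_le_exp.mpr ?_
  calc -∑ i, (k i : ℝ) * (x i).im ≤ ∑ i, |(k i : ℝ)| * ‖fun i => (x i).im‖ := by
        rw [← Finset.sum_neg_distrib]
        refine Finset.sum_le_sum fun i _ => (neg_le_abs _).trans ?_
        rw [abs_mul]
        gcongr
        exact norm_le_pi_norm (fun i => (x i).im) i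
    _ = (∑ i, |(k i : ℝ)|) * ‖fun i => (x i).im‖ := by rw [Finset.sum_mul]
    _ ≤ _ := by gcongr; exact sum_abs_le_waveNorm k

/-- Holomorphic Fourier coefficients with the decay needed for convergence in `wideDomain`. -/
structure ModeBound (ν : ℝ) (T : EReal) (a : (Fin 3 → ℤ) → ℂ → ℂ) (N : ℕ) (M : ℝ) : Prop where
  differentiableOn : ∀ k, DifferentiableOn ℂ (a k) (sector T)
  nonneg : 0 ≤ M
  norm_le : ∀ k, ∀ t ∈ sector T,
    ‖a k t‖ ≤ M * (1 + waveNorm k) ^ N * Real.exp (-t.re * waveNorm k * ν / 2)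

/-- The sum of a Fourier series. -/
def fourierSum (a : (Fin 3 → ℤ) → ℂ → ℂ) (q : ℂ × (Fin 3 → ℂ)) : ℂ :=
  ∑' k, a k q.1 * character k q.2

variable {ν : ℝ} {T : EReal} {a : (Fin 3 → ℤ) → ℂ → ℂ} {N : ℕ} {M : ℝ}

theorem ModeBound.mul_coord (ha : ModeBound ν T a N M) (j : Fin 3) :
    ModeBound ν T (fun k t => Complex.I * k j * a k t) (N + 1) M where
  differentiableOn k := (ha.differentiableOn k).const_mul _
  nonneg := ha.nonneg
  norm_le k t ht := by
    have h1 := ha.norm_le k t ht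
    have h2 := abs_coord_le_waveNorm k j
    have h3 := waveNorm_nonneg k
    have h4 := ha.nonneg
    rw [norm_mul, norm_mul, Complex.norm_I, one_mul, Complex.norm_intCast]
    calc _ ≤ (1 + waveNorm k) * (M * (1 + waveNorm k) ^ N *
          Real.exp (-t.re * waveNorm k * ν / 2)) := by
          gcongr
          linarith
      _ = _ := by ring

theorem ModeBound.summable (ha : ModeBound ν T a N M) {q : ℂ × (Fin 3 → ℂ)}
    (hq : q ∈ wideDomain ν T) : Summable fun k => ‖a k q.1 * character k q.2‖ := by
  set δ := q.1.re * ν / 2 - √3 * ‖fun i => (q.2 i).im‖ with hδ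
  have hδ0 : 0 < δ := sub_pos.mpr hq.2
  refine Summable.of_nonneg_of_le (fun _ => norm_nonneg _) (fun k => ?_)
    ((summable_waveNorm_pow_mul_exp N hδ0).mul_left M)
  have h3 := waveNorm_nonneg k
  have h4 := ha.nonneg
  rw [norm_mul]
  calc _ ≤ (M * (1 + waveNorm k) ^ N * Real.exp (-q.1.re * waveNorm k * ν / 2)) *
        Real.exp (√3 * waveNorm k * ‖fun i => (q.2 i).im‖) :=
        mul_le_mul (ha.norm_le k _ hq.1) (norm_character_le k _) (norm_nonneg _) (by positivity)
    _ = M * ((1 + waveNorm k) ^ N * (Real.exp (-q.1.re * waveNorm k * ν / 2) *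
        Real.exp (√3 * waveNorm k * ‖fun i => (q.2 i).im‖))) := by ring
    _ = _ := by rw [← Real.exp_add]; congr 3; rw [hδ]; ring

/-- The differential of a term of a Fourier series. -/
def termDeriv (a : (Fin 3 → ℤ) → ℂ → ℂ) (k : Fin 3 → ℤ) (q : ℂ × (Fin 3 → ℂ)) :
    ℂ × (Fin 3 → ℂ) →L[ℂ] ℂ :=
  (character k q.2 * deriv (a k) q.1) • ContinuousLinearMap.fst ℂ ℂ (Fin 3 → ℂ) +
    (a k q.1 * character k q.2 * Complex.I) • ∑ i, (k i : ℂ) •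
      (ContinuousLinearMap.proj (R := ℂ) (φ := fun _ : Fin 3 => ℂ) i).comp
        (ContinuousLinearMap.snd ℂ ℂ (Fin 3 → ℂ))

theorem hasFDerivAt_term (ha : ModeBound ν T a N M) (k : Fin 3 → ℤ) {q : ℂ × (Fin 3 → ℂ)}
    (hq : q.1 ∈ sector T) :
    HasFDerivAt (fun q : ℂ × (Fin 3 → ℂ) => a k q.1 * character k q.2) (termDeriv a k q) q := by
  have h1 : HasFDerivAt (fun q : ℂ × (Fin 3 → ℂ) => a k q.1)
      (deriv (a k) q.1 • ContinuousLinearMap.fst ℂ ℂ (Fin 3 → ℂ)) q :=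
    (((ha.differentiableOn k).differentiableAt
      ((isOpen_sector T).mem_nhds hq)).hasDerivAt).comp_hasFDerivAt q hasFDerivAt_fst
  have h2 : HasFDerivAt (fun q : ℂ × (Fin 3 → ℂ) => ∑ i, (k i : ℂ) * q.2 i)
      (∑ i, (k i : ℂ) • (ContinuousLinearMap.proj (R := ℂ) (φ := fun _ : Fin 3 => ℂ) i).comp
        (ContinuousLinearMap.snd ℂ ℂ (Fin 3 → ℂ))) q := by
    refine HasFDerivAt.fun_sum fun i _ => HasFDerivAt.const_mul ?_ _
    exact ((ContinuousLinearMap.proj (R := ℂ) (φ := fun _ : Fin 3 => ℂ) i).comp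
        (ContinuousLinearMap.snd ℂ ℂ (Fin 3 → ℂ))).hasFDerivAt
  have h3 := (h2.const_mul Complex.I).cexp
  refine (h1.mul h3).congr_fderiv ?_
  ext <;> (simp [termDeriv, character]; try ring)

theorem norm_termDeriv_le (a : (Fin 3 → ℤ) → ℂ → ℂ) (k : Fin 3 → ℤ) (q : ℂ × (Fin 3 → ℂ)) :
    ‖termDeriv a k q‖ ≤
      ‖character k q.2‖ * (‖deriv (a k) q.1‖ + ‖a k q.1‖ * (3 * waveNorm k)) := by
  have h1 : ‖∑ i, (k i : ℂ) •
      (ContinuousLinearMap.proj (R := ℂ) (φ := fun _ : Fin 3 => ℂ) i).comp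
        (ContinuousLinearMap.snd ℂ ℂ (Fin 3 → ℂ))‖ ≤ 3 * waveNorm k := by
    have h0 := waveNorm_nonneg k
    refine ContinuousLinearMap.opNorm_le_bound _ (by positivity) fun z => ?_
    simp only [sum_apply, smul_apply, ContinuousLinearMap.comp_apply,
      ContinuousLinearMap.coe_snd', ContinuousLinearMap.proj_apply, smul_eq_mul]
    calc _ ≤ ∑ i : Fin 3, waveNorm k * ‖z‖ := by
          refine (norm_sum_le _ _).trans (Finset.sum_le_sum fun i _ => ?_)
          rw [norm_mul, Complex.norm_intCast]
          gcongr
          · exact abs_coord_le_waveNorm k i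
          · exact (norm_le_pi_norm z.2 i).trans (norm_snd_le z)
      _ = _ := by simp; ring
  refine (norm_add_le _ _).trans ?_
  rw [norm_smul, norm_smul, norm_mul, norm_mul, norm_mul, Complex.norm_I, mul_one]
  calc _ ≤ ‖character k q.2‖ * ‖deriv (a k) q.1‖ * 1 +
        ‖a k q.1‖ * ‖character k q.2‖ * (3 * waveNorm k) := by
        gcongr
        exact ContinuousLinearMap.norm_fst_le _ _ _
    _ = _ := by ring

/-- The gap `g` between the decay rate of the coefficients and the growth rate of the characters is
positive at `q`. It stays at least `g/2` nearby, which gives a summable bound; the time derivatives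
are controlled by the Cauchy estimate, at the cost of a further radius `r`. -/
theorem exists_ball_termDeriv_bound (hν : 0 < ν) (ha : ModeBound ν T a N M)
    {q : ℂ × (Fin 3 → ℂ)} (hq : q ∈ wideDomain ν T) :
    ∃ r > 0, Metric.ball q r ⊆ wideDomain ν T ∧ ∃ b : (Fin 3 → ℤ) → ℝ, Summable b ∧
      ∀ k, ∀ z ∈ Metric.ball q r, ‖termDeriv a k z‖ ≤ b k := by
  set g := q.1.re * ν / 2 - √3 * ‖fun i => (q.2 i).im‖ with hg
  have hg0 : 0 < g := sub_pos.mpr hq.2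
  obtain ⟨r₀, hr₀, hball⟩ := Metric.isOpen_iff.mp (isOpen_wideDomain ν T) q hq
  have h3 : 0 ≤ √3 := Real.sqrt_nonneg 3
  -- Time arguments move by less than `2r`, which must stay below `r₀` and costs `rν` of the gap;
  -- space arguments cost a further `r√3`.
  set r := min (r₀ / 3) (g / (2 * (ν + √3))) with hr
  have hr0 : 0 < r := lt_min (by positivity) (by positivity)
  have hrg : r * (ν + √3) ≤ g / 2 := by
    have : r ≤ g / (2 * (ν + √3)) := min_le_right _ _
    rw [le_div_iff₀ (by positivity)] at this
    linarith
  have hrr : r ≤ r₀ / 3 := min_le_left _ _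
  refine ⟨r, hr0, (Metric.ball_subset_ball (by linarith)).trans hball,
    fun k => M * (1 / r + 3) * ((1 + waveNorm k) ^ (N + 1) * Real.exp (-(g / 2) * waveNorm k)),
    (summable_waveNorm_pow_mul_exp (N + 1) (by positivity)).mul_left _, fun k z hz => ?_⟩
  have hM := ha.nonneg
  have hw := waveNorm_nonneg k
  have hz1 : ‖z.1 - q.1‖ < r := lt_of_le_of_lt (norm_fst_le (z - q)) (mem_ball_iff_norm.mp hz)
  have hz2 : ‖z.2 - q.2‖ < r := lt_of_le_of_lt (norm_snd_le (z - q)) (mem_ball_iff_norm.mp hz)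
  set B := M * (1 + waveNorm k) ^ N * Real.exp (-(q.1.re - 2 * r) * waveNorm k * ν / 2) with hB
  have hB0 : 0 ≤ B := by positivity
  have hclose : ∀ s : ℂ, ‖s - z.1‖ ≤ r → s ∈ sector T ∧ ‖a k s‖ ≤ B := by
    intro s hs
    have hsq : ‖s - q.1‖ < 2 * r := by
      calc ‖s - q.1‖ = ‖(s - z.1) + (z.1 - q.1)‖ := by congr 1; ring
        _ ≤ ‖s - z.1‖ + ‖z.1 - q.1‖ := norm_add_le _ _
        _ < 2 * r := by linarith
    have hmem : (s, q.2) ∈ Metric.ball q r₀ := by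
      rw [mem_ball_iff_norm, Prod.norm_def]
      simp only [Prod.fst_sub, Prod.snd_sub, sub_self, norm_zero]
      exact max_lt (by linarith) hr₀
    have hs1 : s ∈ sector T := (hball hmem).1
    refine ⟨hs1, (ha.norm_le k s hs1).trans ?_⟩
    have hre : q.1.re - 2 * r ≤ s.re := by
      have := (Complex.abs_re_le_norm (s - q.1)).trans hsq.le
      rw [Complex.sub_re] at this
      linarith [neg_le_of_abs_le this]
    rw [hB]
    gcongr
  have hz0 := hclose z.1 (by simpa using hr0.le)
  have hder : ‖deriv (a k) z.1‖ ≤ B / r := by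
    refine Complex.norm_deriv_le_of_forall_mem_sphere_norm_le hr0 ?_ fun s hs =>
      (hclose s (mem_sphere_iff_norm.mp hs).le).2
    refine DifferentiableOn.diffContOnCl fun s hs => ?_
    rw [closure_ball _ hr0.ne'] at hs
    exact ((ha.differentiableOn k).differentiableAt ((isOpen_sector T).mem_nhds
      (hclose s (mem_closedBall_iff_norm.mp hs)).1)).differentiableWithinAt
  have hchar : ‖character k z.2‖ ≤
      Real.exp (√3 * waveNorm k * (‖fun i => (q.2 i).im‖ + r)) := by
    refine (norm_character_le k z.2).trans (Real.exp_le_exp.mpr ?_)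
    gcongr
    have h4 : (fun i => (z.2 i).im) = (fun i => (q.2 i).im) + fun i => ((z.2 - q.2) i).im := by
      ext i; simp
    rw [h4]
    refine (norm_add_le _ _).trans (add_le_add le_rfl ?_)
    refine (pi_norm_le_iff_of_nonneg hr0.le).mpr fun i => ?_
    exact ((Complex.abs_im_le_norm _).trans (norm_le_pi_norm (z.2 - q.2) i)).trans hz2.le
  calc _ ≤ Real.exp (√3 * waveNorm k * (‖fun i => (q.2 i).im‖ + r)) *
        (B / r + B * (3 * waveNorm k)) := by
        refine (norm_termDeriv_le a k z).trans ?_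
        gcongr
        exact hz0.2
    _ = M * (1 + waveNorm k) ^ N * (1 / r + 3 * waveNorm k) *
        (Real.exp (√3 * waveNorm k * (‖fun i => (q.2 i).im‖ + r)) *
          Real.exp (-(q.1.re - 2 * r) * waveNorm k * ν / 2)) := by rw [hB]; ring
    _ = M * (1 + waveNorm k) ^ N * (1 / r + 3 * waveNorm k) *
        Real.exp (-(g - r * (ν + √3)) * waveNorm k) := by
        rw [← Real.exp_add]; congr 2; rw [hg]; ring
    _ ≤ M * (1 + waveNorm k) ^ N * ((1 / r + 3) * (1 + waveNorm k)) *
        Real.exp (-(g / 2) * waveNorm k) := by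
        gcongr
        · have : 0 < 1 / r := by positivity
          nlinarith
        · linarith
    _ = _ := by ring

theorem hasFDerivAt_fourierSum (hν : 0 < ν) (ha : ModeBound ν T a N M)
    {q : ℂ × (Fin 3 → ℂ)} (hq : q ∈ wideDomain ν T) :
    (Summable fun k => termDeriv a k q) ∧
      HasFDerivAt (fourierSum a) (∑' k, termDeriv a k q) q := by
  obtain ⟨r, hr, hball, b, hb, hbound⟩ := exists_ball_termDeriv_bound hν ha hq
  have hmem := Metric.mem_ball_self (x := q) hr
  refine ⟨Summable.of_norm_bounded hb fun k => hbound k q hmem, ?_⟩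
  exact hasFDerivAt_tsum_of_isPreconnected hb Metric.isOpen_ball
    (convex_ball q r).isPreconnected (fun k z hz => hasFDerivAt_term ha k (hball hz).1)
    hbound hmem (ha.summable hq).of_norm hmem

theorem ModeBound.differentiableAt (hν : 0 < ν) (ha : ModeBound ν T a N M)
    {q : ℂ × (Fin 3 → ℂ)} (hq : q ∈ wideDomain ν T) : DifferentiableAt ℂ (fourierSum a) q :=
  (hasFDerivAt_fourierSum hν ha hq).2.differentiableAt

theorem ModeBound.hasSum_dt (hν : 0 < ν) (ha : ModeBound ν T a N M)
    {q : ℂ × (Fin 3 → ℂ)} (hq : q ∈ wideDomain ν T) :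
    HasSum (fun k => deriv (a k) q.1 * character k q.2) (dt (fourierSum a) q) := by
  obtain ⟨h1, h2⟩ := hasFDerivAt_fourierSum hν ha hq
  rw [dt, h2.fderiv]
  refine (h1.hasSum.mapL (ContinuousLinearMap.apply ℂ ℂ ((1 : ℂ), (0 : Fin 3 → ℂ)))).congr_fun
    fun k => ?_
  simp [termDeriv, mul_comm]

theorem ModeBound.hasSum_dx (hν : 0 < ν) (ha : ModeBound ν T a N M)
    {q : ℂ × (Fin 3 → ℂ)} (hq : q ∈ wideDomain ν T) (j : Fin 3) :
    HasSum (fun k => (Complex.I * k j * a k q.1) * character k q.2) (dx j (fourierSum a) q) := by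
  obtain ⟨h1, h2⟩ := hasFDerivAt_fourierSum hν ha hq
  rw [dx, h2.fderiv]
  refine (h1.hasSum.mapL (ContinuousLinearMap.apply ℂ ℂ
    ((0 : ℂ), (Pi.single j 1 : Fin 3 → ℂ)))).congr_fun fun k => ?_
  simp [termDeriv, Pi.single_apply]
  ring

theorem ModeBound.dx_eq (hν : 0 < ν) (ha : ModeBound ν T a N M)
    {q : ℂ × (Fin 3 → ℂ)} (hq : q ∈ wideDomain ν T) (j : Fin 3) :
    dx j (fourierSum a) q = fourierSum (fun k t => Complex.I * k j * a k t) q :=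
  (ha.hasSum_dx hν hq j).tsum_eq.symm

theorem ModeBound.hasSum_dx_dx (hν : 0 < ν) (ha : ModeBound ν T a N M)
    {q : ℂ × (Fin 3 → ℂ)} (hq : q ∈ wideDomain ν T) (j : Fin 3) :
    HasSum (fun k => (-(k j : ℂ) ^ 2 * a k q.1) * character k q.2)
      (dx j (dx j (fourierSum a)) q) := by
  have h : dx j (fourierSum a) =ᶠ[nhds q] fourierSum (fun k t => Complex.I * k j * a k t) := by
    filter_upwards [(isOpen_wideDomain ν T).mem_nhds hq] with z hz using ha.dx_eq hν hz j
  have h2 : dx j (dx j (fourierSum a)) q =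
      dx j (fourierSum (fun k t => Complex.I * k j * a k t)) q := by
    simp only [dx] at h ⊢
    rw [h.fderiv_eq]
  rw [h2]
  refine ((ha.mul_coord j).hasSum_dx hν hq j).congr_fun fun k => ?_
  linear_combination (-(k j : ℂ) ^ 2 * a k q.1 * character k q.2) * Complex.I_sq

/-- The Fourier coefficients of a product are convolutions. -/
theorem hasSum_mul_series {f g : (Fin 3 → ℤ) → ℂ} {x : Fin 3 → ℂ}
    (hf : Summable fun k => ‖f k * character k x‖) (hg : Summable fun k => ‖g k * character k x‖) :
    (∀ k, Summable fun l => f l * g (k - l)) ∧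
      HasSum (fun k => (∑' l, f l * g (k - l)) * character k x)
        ((∑' k, f k * character k x) * ∑' k, g k * character k x) := by
  have h1 := summable_mul_of_summable_norm hf hg
  have h3 : HasSum (fun q : (Fin 3 → ℤ) × (Fin 3 → ℤ) =>
      (f q.1 * character q.1 x) * (g q.2 * character q.2 x))
      ((∑' k, f k * character k x) * ∑' k, g k * character k x) := by
    rw [tsum_mul_tsum_of_summable_norm hf hg]; exact h1.hasSum
  have h4 : HasSum (fun q : (Fin 3 → ℤ) × (Fin 3 → ℤ) => (f q.2 * g (q.1 - q.2)) * character q.1 x)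
      ((∑' k, f k * character k x) * ∑' k, g k * character k x) := by
    refine (shearEquiv.hasSum_iff.mpr h3).congr_fun fun q => ?_
    have : character q.1 x = character q.2 x * character (q.1 - q.2) x := by
      rw [← character_add, add_sub_cancel]
    simp only [this, shearEquiv, Equiv.coe_fn_mk, Function.comp]
    ring
  have hne : ∀ k, character k x ≠ 0 := fun k => Complex.exp_ne_zero _
  -- Characters never vanish, also at complex points, so they can be divided out of each fibre.
  have h5 : ∀ k, Summable fun l => f l * g (k - l) := fun k =>
    (summable_mul_right_iff (hne k)).mp (h4.summable.prod_factor k)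
  refine ⟨h5, h4.prod_fiberwise fun k => ?_⟩
  exact (h5 k).hasSum.mul_right _

end Series

/-! ### The Navier-Stokes nonlinearity as a quadratic model -/

section Model

open scoped ComplexConjugate

/-- The decay rate of the weighted Fourier coefficients under the heat flow. -/
def rate (ν : ℝ) (k : Fin 3 → ℤ) : ℝ := ν * waveNorm k ^ 2 - waveNorm k * ν / 2

theorem rate_zero (ν : ℝ) : rate ν 0 = 0 := by simp [rate]

theorem rate_neg (ν : ℝ) (k : Fin 3 → ℤ) : rate ν (-k) = rate ν k := by simp [rate]

/-- As `|k|_e ≥ 1` for nonzero lattice vectors, the loss `ν|k|_e/2` caused by the exponential weight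
is at most half of the dissipation. -/
theorem half_le_rate {ν : ℝ} (hν : 0 < ν) {k : Fin 3 → ℤ} (hk : k ≠ 0) :
    ν * waveNorm k ^ 2 / 2 ≤ rate ν k := by
  have h := one_le_waveNorm hk
  have : ν * waveNorm k * 1 ≤ ν * waveNorm k * waveNorm k := by gcongr
  unfold rate
  nlinarith

theorem rate_pos {ν : ℝ} (hν : 0 < ν) {k : Fin 3 → ℤ} (hk : k ≠ 0) : 0 < rate ν k := by
  have := waveNorm_pos hk
  exact lt_of_lt_of_le (by positivity) (half_le_rate hν hk)

theorem rate_nonneg {ν : ℝ} (hν : 0 < ν) (k : Fin 3 → ℤ) : 0 ≤ rate ν k := by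
  by_cases hk : k = 0
  · rw [hk, rate_zero]
  · exact (rate_pos hν hk).le

theorem norm_volterra_rate_le {ν : ℝ} (hν : 0 < ν) (T : EReal) {k : Fin 3 → ℤ} (hk : k ≠ 0) :
    ‖volterra T (rate ν k)‖ ≤ 4 / (ν * waveNorm k ^ 2) := by
  have := waveNorm_pos hk
  refine (norm_volterra_le (rate_pos hν hk)).trans ?_
  calc 2 / rate ν k ≤ 2 / (ν * waveNorm k ^ 2 / 2) := by gcongr; exact half_le_rate hν hk
    _ = _ := by field_simp; norm_num

/-- The bound used for all times: the gain `|k|_e⁻²` of the time integration suffices alone, and the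
factor `√|k|_e ≥ 1` is given away. -/
theorem volterra_rate_bound {ν : ℝ} (hν : 0 < ν) (T : EReal) (k : Fin 3 → ℤ) :
    waveNorm k ^ 4 * ‖volterra T (rate ν k)‖ ^ 2 ≤ (4 / ν) ^ 2 * √(waveNorm k) := by
  by_cases hk : k = 0
  · simp [hk]
  have h0 := waveNorm_pos hk
  calc _ ≤ waveNorm k ^ 4 * (4 / (ν * waveNorm k ^ 2)) ^ 2 := by
        gcongr; exact norm_volterra_rate_le hν T hk
    _ = (4 / ν) ^ 2 * 1 := by field_simp
    _ ≤ _ := by gcongr; exact Real.one_le_sqrt.mpr (one_le_waveNorm hk)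

/-- Interpolation between the short-time bound `2S` and the parabolic bound `4/(ν|k|_e²)`, with
weights `1/8` and `7/8`. The loss is precisely the available `√|k|_e`. -/
theorem volterra_rate_bound_time {ν : ℝ} (hν : 0 < ν) {S K : ℝ} (hS : 0 ≤ S)
    (hSK : 2 ^ 15 * S ≤ ν ^ 7 * K ^ 8) (k : Fin 3 → ℤ) :
    waveNorm k ^ 4 * ‖volterra (S : EReal) (rate ν k)‖ ^ 2 ≤ K ^ 2 * √(waveNorm k) := by
  by_cases hk : k = 0
  · simp [hk]
  have h0 := waveNorm_pos hk
  set x := ‖volterra (S : EReal) (rate ν k)‖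
  have hx : 0 ≤ x := norm_nonneg (volterra (S : EReal) (rate ν k))
  have h1 : x ≤ 2 * S := norm_volterra_le_time _ hS
  have h2 : x ≤ 4 / (ν * waveNorm k ^ 2) := norm_volterra_rate_le hν _ hk
  -- Fourth powers produce `x ^ 8 = x * x ^ 7`, in which one factor is estimated by `2S` and seven
  -- by the parabolic bound; `2 * 4 ^ 7 = 2 ^ 15`.
  rw [← pow_le_pow_iff_left₀ (by positivity) (by positivity) (four_ne_zero)]
  have h3 : √(waveNorm k) ^ 4 = waveNorm k ^ 2 := by
    rw [show 4 = 2 * 2 from rfl, pow_mul, Real.sq_sqrt h0.le]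
  calc (waveNorm k ^ 4 * x ^ 2) ^ 4 = waveNorm k ^ 16 * (x * x ^ 7) := by ring
    _ ≤ waveNorm k ^ 16 * (2 * S * (4 / (ν * waveNorm k ^ 2)) ^ 7) := by gcongr
    _ = (2 ^ 15 * S) / ν ^ 7 * waveNorm k ^ 2 := by field_simp; norm_num; ring
    _ ≤ (ν ^ 7 * K ^ 8) / ν ^ 7 * waveNorm k ^ 2 := by gcongr
    _ = K ^ 8 * waveNorm k ^ 2 := by field_simp
    _ = _ := by rw [mul_pow, h3]; ring

/-- The symbol of the Leray projection of the transport term. -/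
def transportSymbol (k : Fin 3 → ℤ) (i j n : Fin 3) : ℂ :=
  -Complex.I * ((if i = n then 1 else 0) - (k i * k n : ℂ) / (waveNorm k : ℂ) ^ 2) * k j

theorem norm_coord_mul_div_le (k : Fin 3 → ℤ) (i n : Fin 3) :
    ‖(k i * k n : ℂ) / (waveNorm k : ℂ) ^ 2‖ ≤ 1 := by
  have h0 := waveNorm_nonneg k
  rw [norm_div, norm_mul, norm_pow, Complex.norm_intCast, Complex.norm_intCast, Complex.norm_real,
    Real.norm_of_nonneg h0]
  refine div_le_one_of_le₀ ?_ (by positivity)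
  rw [sq]
  gcongr <;> exact abs_coord_le_waveNorm k _

theorem norm_transportSymbol_le (k : Fin 3 → ℤ) (i j n : Fin 3) :
    ‖transportSymbol k i j n‖ ≤ 2 * waveNorm k := by
  rw [transportSymbol, norm_mul, norm_mul, norm_neg, Complex.norm_I, one_mul, Complex.norm_intCast]
  gcongr
  · refine (norm_sub_le _ _).trans ?_
    have h1 := norm_coord_mul_div_le k i n
    have h2 : ‖(if i = n then (1 : ℂ) else 0)‖ ≤ 1 := by split_ifs <;> simp
    linarith
  · exact abs_coord_le_waveNorm k j

theorem conj_transportSymbol_neg (k : Fin 3 → ℤ) (i j n : Fin 3) :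
    conj (transportSymbol (-k) i j n) = transportSymbol k i j n := by
  simp [transportSymbol, apply_ite]

theorem transportSymbol_zero (i j n : Fin 3) : transportSymbol 0 i j n = 0 := by
  simp [transportSymbol]

theorem ofReal_sq_waveNorm (k : Fin 3 → ℤ) : (waveNorm k : ℂ) ^ 2 = ∑ i, (k i : ℂ) ^ 2 := by
  rw [← Complex.ofReal_pow, sq_waveNorm]
  push_cast
  rfl

theorem waveNorm_ne_zero {k : Fin 3 → ℤ} (hk : k ≠ 0) : (waveNorm k : ℂ) ≠ 0 := by
  exact_mod_cast (waveNorm_pos hk).ne'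

/-- The symbol contains the projection orthogonal to `k`; hence the nonlinearity creates no
divergence. -/
theorem sum_mul_transportSymbol (k : Fin 3 → ℤ) (j n : Fin 3) :
    ∑ i, (k i : ℂ) * transportSymbol k i j n = 0 := by
  by_cases hk : k = 0
  · simp [hk, transportSymbol]
  have h0 := waveNorm_ne_zero hk
  have h1 : ∑ i, (k i : ℂ) * (if i = n then 1 else 0) = k n := by simp
  have h2 : ∑ i, (k i : ℂ) * ((k i * k n : ℂ) / (waveNorm k : ℂ) ^ 2) = k n := by
    have : ∑ i, (k i : ℂ) * ((k i * k n : ℂ) / (waveNorm k : ℂ) ^ 2) =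
        (∑ i, (k i : ℂ) ^ 2) * k n / (waveNorm k : ℂ) ^ 2 := by
      rw [Finset.sum_mul, Finset.sum_div]
      exact Finset.sum_congr rfl fun i _ => by ring
    rw [this, ← ofReal_sq_waveNorm]
    field_simp
  calc _ = -Complex.I * k j * (∑ i, (k i : ℂ) * (if i = n then 1 else 0) -
        ∑ i, (k i : ℂ) * ((k i * k n : ℂ) / (waveNorm k : ℂ) ^ 2)) := by
        rw [← Finset.sum_sub_distrib, Finset.mul_sum]
        exact Finset.sum_congr rfl fun i _ => by rw [transportSymbol]; ring
    _ = 0 := by rw [h1, h2, sub_self, mul_zero]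

theorem product_rate_nonneg {ν : ℝ} (hν : 0 < ν) (k l : Fin 3 → ℤ) :
    0 ≤ (waveNorm l + waveNorm (k - l) - waveNorm k) * ν / 2 := by
  have := waveNorm_le_add_sub k l
  have : 0 ≤ waveNorm l + waveNorm (k - l) - waveNorm k := by linarith
  positivity

theorem decay_congr {T : EReal} {c c' : ℝ} (hc : 0 ≤ c) (hc' : 0 ≤ c') (h : c = c') :
    decay T hc = decay T hc' := by
  subst h; rfl

/-- The quadratic term of the Navier-Stokes equations on the sector. -/
def nsModel {ν : ℝ} (hν : 0 < ν) (T : EReal) {K : ℝ} (hK : 0 ≤ K)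
    (hL : ∀ k, waveNorm k ^ 4 * ‖volterra T (rate ν k)‖ ^ 2 ≤ K ^ 2 * √(waveNorm k)) :
    QuadraticModel (SectorHol T) where
  m k l := decay T (product_rate_nonneg hν k l)
  L k := volterra T (rate ν k)
  p := transportSymbol
  K := K
  K_nonneg := hK
  norm_m_le _ _ := norm_decay_le _
  norm_p_le := norm_transportSymbol_le
  norm_L_le := hL

theorem norm_heatFun_le {ν : ℝ} (hν : 0 < ν) (T : EReal) (v₀ : (Fin 3 → ℝ) → Vec3)
    (k : Fin 3 → ℤ) :
    ‖fun i => ((waveNorm k : ℂ) * coeff v₀ k i) • decay T (rate_nonneg hν k)‖ ≤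
      waveNorm k * ‖coeff v₀ k‖ := by
  have h0 := waveNorm_nonneg k
  refine (pi_norm_le_iff_of_nonneg (by positivity)).mpr fun i => ?_
  rw [norm_smul, norm_mul, Complex.norm_real, Real.norm_of_nonneg h0]
  calc _ ≤ waveNorm k * ‖coeff v₀ k‖ * 1 :=
        mul_le_mul (mul_le_mul_of_nonneg_left (PiLp.norm_apply_le _ i) h0) (norm_decay_le _)
          (norm_nonneg _) (by positivity)
    _ = _ := mul_one _

/-- The weighted coefficients of the heat flow of the initial field. -/
def heatFlow {ν : ℝ} (hν : 0 < ν) (T : EReal) {v₀ : (Fin 3 → ℝ) → Vec3} (h0 : MemH1 v₀) :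
    CoeffSpace (SectorHol T) :=
  ⟨fun k i => ((waveNorm k : ℂ) * coeff v₀ k i) • decay T (rate_nonneg hν k), by
    refine memℓp_gen (Summable.of_nonneg_of_le (fun k => by positivity) (fun k => ?_)
      (summable_of_h1ENorm_lt_top h0.finite_norm))
    rw [ENNReal.toReal_ofNat, Real.rpow_ofNat, ← mul_pow]
    have := norm_heatFun_le hν T v₀ k
    gcongr⟩

theorem heatFlow_apply {ν : ℝ} (hν : 0 < ν) (T : EReal) {v₀ : (Fin 3 → ℝ) → Vec3} (h0 : MemH1 v₀)
    (k : Fin 3 → ℤ) (i : Fin 3) : heatFlow hν T h0 k i =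
      ((waveNorm k : ℂ) * coeff v₀ k i) • decay T (rate_nonneg hν k) := rfl

theorem norm_heatFlow_le {ν : ℝ} (hν : 0 < ν) (T : EReal) {v₀ : (Fin 3 → ℝ) → Vec3}
    (h0 : MemH1 v₀) : ‖heatFlow hν T h0‖ ≤ h1Norm v₀ := by
  have hs := summable_of_h1ENorm_lt_top h0.finite_norm
  have h1 : ‖heatFlow hν T h0‖ ^ 2 ≤ h1Norm v₀ ^ 2 := by
    rw [← tsum_sq_norm, sq_h1Norm h0.finite_norm]
    refine (summable_sq_norm _).tsum_le_tsum (fun k => ?_) hs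
    rw [← mul_pow]
    have := norm_heatFun_le hν T v₀ k
    exact pow_le_pow_left₀ (norm_nonneg _) this 2
  exact (sq_le_sq₀ (norm_nonneg _) ENNReal.toReal_nonneg).mp h1

theorem reflect_heatFlow {ν : ℝ} (hν : 0 < ν) (T : EReal) {v₀ : (Fin 3 → ℝ) → Vec3}
    (h0 : MemH1 v₀) (hreal : ∀ x i, (v₀ x i).im = 0) :
    QuadraticModel.reflect (conjHol T) (heatFlow hν T h0) = heatFlow hν T h0 := by
  ext k i
  rw [QuadraticModel.reflect_apply, heatFlow_apply, heatFlow_apply, map_smulₛₗ, conjHol_decay,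
    decay_congr (rate_nonneg hν (-k)) (rate_nonneg hν k) (rate_neg ν k), map_mul,
    coeff_apply h0.integrable, coeff_neg_of_real (fun x => hreal x i), Complex.conj_conj,
    Complex.conj_ofReal, waveNorm_neg, coeff_apply h0.integrable]

end Model

/-! ### The velocity and pressure coefficients of a fixed point -/

section Velocity

open scoped ComplexConjugate

/-- The factor `exp(-|k|_e ν t/2)` relating Fourier coefficients and their weighted versions. -/
def amp (ν : ℝ) (k : Fin 3 → ℤ) (t : ℂ) : ℂ := Complex.exp (-((waveNorm k * ν / 2 : ℝ) : ℂ) * t)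

theorem norm_amp (ν : ℝ) (k : Fin 3 → ℤ) (t : ℂ) :
    ‖amp ν k t‖ = Real.exp (-t.re * waveNorm k * ν / 2) := by
  rw [amp, Complex.norm_exp, ← Complex.ofReal_neg, Complex.re_ofReal_mul]
  congr 1
  ring

theorem differentiable_amp (ν : ℝ) (k : Fin 3 → ℤ) : Differentiable ℂ (amp ν k) := by
  unfold amp; fun_prop

theorem hasDerivAt_amp (ν : ℝ) (k : Fin 3 → ℤ) (t : ℂ) :
    HasDerivAt (amp ν k) (-((waveNorm k * ν / 2 : ℝ) : ℂ) * amp ν k t) t := by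
  have := ((hasDerivAt_id t).const_mul (-((waveNorm k * ν / 2 : ℝ) : ℂ))).cexp
  refine HasDerivAt.congr_deriv this ?_
  rw [amp, id, mul_one, mul_comm]

variable {T : EReal}

/-- The Fourier coefficients of the velocity with weighted coefficients `u`. -/
def velCoeff (ν : ℝ) (u : CoeffSpace (SectorHol T)) (j : Fin 3) (k : Fin 3 → ℤ) (t : ℂ) : ℂ :=
  amp ν k t * (((waveNorm k)⁻¹ : ℝ) : ℂ) * evalAt t (u k j)

theorem velCoeff_zero (ν : ℝ) (u : CoeffSpace (SectorHol T)) (j : Fin 3) (t : ℂ) :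
    velCoeff ν u j 0 t = 0 := by
  simp only [velCoeff, waveNorm_zero, inv_zero, Complex.ofReal_zero, mul_zero, zero_mul]

theorem norm_velCoeff_le (ν : ℝ) (u : CoeffSpace (SectorHol T)) (j : Fin 3) (k : Fin 3 → ℤ)
    (t : ℂ) : ‖velCoeff ν u j k t‖ ≤
      (waveNorm k)⁻¹ * ‖u k‖ * Real.exp (-t.re * waveNorm k * ν / 2) := by
  have h0 := waveNorm_nonneg k
  have h1 : ‖evalAt t (u k j)‖ ≤ ‖u k‖ := (norm_evalAt_le t _).trans (norm_le_pi_norm (u k) j)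
  rw [velCoeff, norm_mul, norm_mul, norm_amp, Complex.norm_real,
    Real.norm_of_nonneg (by positivity)]
  calc _ ≤ Real.exp (-t.re * waveNorm k * ν / 2) * (waveNorm k)⁻¹ * ‖u k‖ :=
        mul_le_mul_of_nonneg_left h1 (by positivity)
    _ = _ := by ring

theorem inv_waveNorm_le_one (k : Fin 3 → ℤ) : (waveNorm k)⁻¹ ≤ 1 := by
  by_cases hk : k = 0
  · simp [hk]
  · exact inv_le_one_of_one_le₀ (one_le_waveNorm hk)

theorem modeBound_velCoeff (ν : ℝ) (u : CoeffSpace (SectorHol T)) (j : Fin 3) :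
    ModeBound ν T (velCoeff ν u j) 0 ‖u‖ where
  differentiableOn k := ((differentiable_amp ν k).differentiableOn.mul_const _).mul
    (differentiableOn_evalAt _)
  nonneg := norm_nonneg u
  norm_le k t _ := by
    refine (norm_velCoeff_le ν u j k t).trans ?_
    rw [pow_zero, mul_one]
    refine mul_le_mul_of_nonneg_right ?_ (Real.exp_pos _).le
    calc _ ≤ 1 * ‖u k‖ := mul_le_mul_of_nonneg_right (inv_waveNorm_le_one k) (norm_nonneg _)
      _ ≤ ‖u‖ := by rw [one_mul]; exact lp.norm_apply_le_norm (by norm_num) u k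

variable {ν : ℝ} (hν : 0 < ν) {K : ℝ} (hK : 0 ≤ K)
  (hL : ∀ k, waveNorm k ^ 4 * ‖volterra T (rate ν k)‖ ^ 2 ≤ K ^ 2 * √(waveNorm k))

/-- The Fourier coefficients of the products of the components of the velocity. -/
def prodCoeff (u : CoeffSpace (SectorHol T)) (i n : Fin 3) (k : Fin 3 → ℤ) (t : ℂ) : ℂ :=
  amp ν k t * evalAt t ((nsModel hν T hK hL).conv k (fun l => u l i) fun l => u l n)

/-- The factor `m k l` was chosen so that `exp(-|k|νt/2)` times it splits into the exponentials of
`l` and `k - l`; thus the weighted convolution is the ordinary one of the velocity coefficients. -/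
theorem amp_mul_evalAt_term (u : CoeffSpace (SectorHol T)) (i n : Fin 3) (k l : Fin 3 → ℤ) {t : ℂ}
    (ht : t ∈ sector T) :
    amp ν k t * evalAt t ((nsModel hν T hK hL).term k (fun l => u l i) (fun l => u l n) l) =
      velCoeff ν u i l t * velCoeff ν u n (k - l) t := by
  have h1 : amp ν k t * evalAt t (decay T (product_rate_nonneg hν k l)) =
      amp ν l t * amp ν (k - l) t := by
    rw [evalAt_decay _ ht, amp, amp, amp, ← Complex.exp_add, ← Complex.exp_add]
    congr 1
    push_cast
    ring
  simp only [QuadraticModel.term, map_smul, evalAt_mul, smul_eq_mul, velCoeff, mul_inv]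
  change amp ν k t * (_ * (evalAt t (decay T (product_rate_nonneg hν k l)) * _)) = _
  push_cast
  linear_combination ((waveNorm l : ℂ)⁻¹ * (waveNorm (k - l) : ℂ)⁻¹ *
    (evalAt t (u l i) * evalAt t (u (k - l) n))) * h1

theorem hasSum_prodCoeff (u : CoeffSpace (SectorHol T)) (i n : Fin 3) (k : Fin 3 → ℤ) {t : ℂ}
    (ht : t ∈ sector T) :
    HasSum (fun l => velCoeff ν u i l t * velCoeff ν u n (k - l) t)
      (prodCoeff hν hK hL u i n k t) := by
  have h := (((nsModel hν T hK hL).summable_term u u k i n).hasSum.mapL (evalAt t)).mul_left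
    (amp ν k t)
  refine h.congr_fun fun l => ?_
  exact (amp_mul_evalAt_term hν hK hL u i n k l ht).symm

/-- The inverse lengths are at most 1, and `2ab ≤ a² + b²`. A bound uniform in `k` is enough here,
because the exponential factor makes the pressure series converge. -/
theorem norm_conv_le_sq (u : CoeffSpace (SectorHol T)) (i n : Fin 3) (k : Fin 3 → ℤ) :
    ‖(nsModel hν T hK hL).conv k (fun l => u l i) fun l => u l n‖ ≤ ‖u‖ ^ 2 := by
  refine ((nsModel hν T hK hL).norm_conv_le u u k i n).trans ?_
  have h1 := summable_sq_norm u
  have h2 : Summable fun l => ‖u (k - l)‖ ^ 2 := (Equiv.subLeft k).summable_iff.mpr h1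
  have h3 : ∑' l, ‖u (k - l)‖ ^ 2 = ‖u‖ ^ 2 := by
    rw [← tsum_sq_norm]; exact (Equiv.subLeft k).tsum_eq fun l => ‖u l‖ ^ 2
  have h4 : ∑' l, (1 / 2) * (‖u l‖ ^ 2 + ‖u (k - l)‖ ^ 2) = ‖u‖ ^ 2 := by
    rw [tsum_mul_left, h1.tsum_add h2, h3, tsum_sq_norm]; ring
  rw [← h4]
  refine (summable_majorant u u k).tsum_le_tsum (fun l => ?_) ((h1.add h2).mul_left _)
  have h5 : (waveNorm l * waveNorm (k - l))⁻¹ ≤ 1 := by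
    rw [mul_inv]
    exact mul_le_one₀ (inv_waveNorm_le_one _) (inv_nonneg.mpr (waveNorm_nonneg _))
      (inv_waveNorm_le_one _)
  calc _ ≤ 1 * (‖u l‖ * ‖u (k - l)‖) :=
        mul_le_mul_of_nonneg_right h5 (mul_nonneg (norm_nonneg _) (norm_nonneg _))
    _ ≤ _ := by linarith [two_mul_le_add_sq ‖u l‖ ‖u (k - l)‖]

theorem norm_prodCoeff_le (u : CoeffSpace (SectorHol T)) (i n : Fin 3) (k : Fin 3 → ℤ) (t : ℂ) :
    ‖prodCoeff hν hK hL u i n k t‖ ≤ ‖u‖ ^ 2 * Real.exp (-t.re * waveNorm k * ν / 2) := by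
  rw [prodCoeff, norm_mul, norm_amp, mul_comm]
  exact mul_le_mul_of_nonneg_right ((norm_evalAt_le _ _).trans (norm_conv_le_sq hν hK hL u i n k))
    (Real.exp_pos _).le

/-- The Fourier coefficients of the pressure. -/
def pressureCoeff (u : CoeffSpace (SectorHol T)) (k : Fin 3 → ℤ) (t : ℂ) : ℂ :=
  -∑ i, ∑ n, (k i * k n : ℂ) / (waveNorm k : ℂ) ^ 2 * prodCoeff hν hK hL u i n k t

theorem modeBound_pressureCoeff (u : CoeffSpace (SectorHol T)) :
    ModeBound ν T (pressureCoeff hν hK hL u) 0 (9 * ‖u‖ ^ 2) where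
  differentiableOn k := by
    refine DifferentiableOn.neg (DifferentiableOn.fun_sum fun i _ =>
      DifferentiableOn.fun_sum fun n _ => DifferentiableOn.const_mul ?_ _)
    exact (differentiable_amp ν k).differentiableOn.mul (differentiableOn_evalAt _)
  nonneg := mul_nonneg (by norm_num) (sq_nonneg _)
  norm_le k t _ := by
    rw [pressureCoeff, norm_neg, pow_zero, mul_one]
    calc _ ≤ ∑ i : Fin 3, ∑ n : Fin 3, 1 * (‖u‖ ^ 2 * Real.exp (-t.re * waveNorm k * ν / 2)) := by
          refine (norm_sum_le _ _).trans (Finset.sum_le_sum fun i _ => ?_)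
          refine (norm_sum_le _ _).trans (Finset.sum_le_sum fun n _ => ?_)
          rw [norm_mul]
          exact mul_le_mul (norm_coord_mul_div_le k i n) (norm_prodCoeff_le hν hK hL u i n k t)
            (norm_nonneg _) zero_le_one
      _ = _ := by
          simp only [Finset.sum_const, Finset.card_univ, Fintype.card_fin, nsmul_eq_mul]
          push_cast
          ring

variable {v₀ : (Fin 3 → ℝ) → Vec3} (h0 : MemH1 v₀) {u : CoeffSpace (SectorHol T)}
theorem solution_apply
    (hu : u = heatFlow hν T h0 + (nsModel hν T hK hL).quad u u)
    (k : Fin 3 → ℤ) (j : Fin 3) :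
    u k j = ((waveNorm k : ℂ) * coeff v₀ k j) • decay T (rate_nonneg hν k) +
      volterra T (rate ν k) ((nsModel hν T hK hL).source u u k j) := by
  conv_lhs => rw [hu]
  rfl

theorem evalAt_solution
    (hu : u = heatFlow hν T h0 + (nsModel hν T hK hL).quad u u)
    (k : Fin 3 → ℤ) (j : Fin 3) {t : ℂ} (ht : t ∈ sector T) :
    evalAt t (u k j) =
      (waveNorm k : ℂ) * coeff v₀ k j * Complex.exp (-(rate ν k : ℂ) * t) +
      evalAt t (volterra T (rate ν k) ((nsModel hν T hK hL).source u u k j)) := by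
  rw [solution_apply hν hK hL h0 hu, map_add, map_smul, smul_eq_mul, evalAt_decay _ ht]

theorem amp_mul_evalAt_source (k : Fin 3 → ℤ) (j : Fin 3) (t : ℂ) :
    amp ν k t * (((waveNorm k)⁻¹ : ℝ) : ℂ) * evalAt t ((nsModel hν T hK hL).source u u k j) =
      ∑ i, ∑ n, transportSymbol k j i n * prodCoeff hν hK hL u i n k t := by
  by_cases hk : k = 0
  · simp only [hk, waveNorm_zero, inv_zero, Complex.ofReal_zero, mul_zero, zero_mul,
      transportSymbol_zero, Finset.sum_const_zero]
  have hw := waveNorm_ne_zero hk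
  simp only [QuadraticModel.source, map_smul, map_sum, smul_eq_mul, Finset.mul_sum, prodCoeff]
  refine Finset.sum_congr rfl fun i _ => Finset.sum_congr rfl fun n _ => ?_
  change _ * (_ * (transportSymbol k j i n * _)) = _
  push_cast
  field_simp

/-- The weighted coefficient decays at the rate `ν|k|_e² - ν|k|_e/2`, and the factor `amp` restores
the missing `ν|k|_e/2`. -/
theorem hasDerivAt_velCoeff
    (hu : u = heatFlow hν T h0 + (nsModel hν T hK hL).quad u u)
    (k : Fin 3 → ℤ) (j : Fin 3) {t : ℂ} (ht : t ∈ sector T) :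
    HasDerivAt (velCoeff ν u j k) (-(ν : ℂ) * (waveNorm k : ℂ) ^ 2 * velCoeff ν u j k t +
      ∑ i, ∑ n, transportSymbol k j i n * prodCoeff hν hK hL u i n k t) t := by
  rw [← amp_mul_evalAt_source]
  by_cases hk : k = 0
  · subst hk
    have : velCoeff ν u j 0 = fun _ => 0 := funext fun t => velCoeff_zero ν u j t
    rw [this]
    simpa only [waveNorm_zero, inv_zero, Complex.ofReal_zero, mul_zero, zero_mul, add_zero] using
      hasDerivAt_const t (0 : ℂ)
  have h1 : HasDerivAt (fun s => (waveNorm k : ℂ) * coeff v₀ k j *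
      Complex.exp (-(rate ν k : ℂ) * s)) ((waveNorm k : ℂ) * coeff v₀ k j *
      (Complex.exp (-(rate ν k : ℂ) * t) * -(rate ν k : ℂ))) t := by
    have := (((hasDerivAt_id t).const_mul (-(rate ν k : ℂ))).cexp).const_mul
      ((waveNorm k : ℂ) * coeff v₀ k j)
    simpa only [id, mul_one] using! this
  have h2 := h1.add (hasDerivAt_volterra (rate_pos hν hk)
    ((nsModel hν T hK hL).source u u k j) ht)
  have h3 : HasDerivAt (fun s => evalAt s (u k j)) (-(rate ν k : ℂ) * evalAt t (u k j) +
      evalAt t ((nsModel hν T hK hL).source u u k j)) t := by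
    refine (h2.congr_of_eventuallyEq ?_).congr_deriv ?_
    · filter_upwards [(isOpen_sector T).mem_nhds ht] with s hs using
        evalAt_solution hν hK hL h0 hu k j hs
    · rw [evalAt_solution hν hK hL h0 hu k j ht]; ring
  refine (((hasDerivAt_amp ν k t).mul_const _).mul h3).congr_deriv ?_
  rw [velCoeff, rate]
  push_cast
  ring

/-- Both parts of the Duhamel formula are orthogonal to `k`: the heat flow since the initial field
is divergence free, the integral since its source is projected. The operator `volterra` is linear
and the same for all three components. -/
theorem sum_mul_velCoeff
    (hu : u = heatFlow hν T h0 + (nsModel hν T hK hL).quad u u)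
    (hdiv : WeakDivFree v₀) (k : Fin 3 → ℤ) {t : ℂ} (ht : t ∈ sector T) :
    ∑ j, (k j : ℂ) * velCoeff ν u j k t = 0 := by
  have h1 : ∑ j, (k j : ℂ) • (nsModel hν T hK hL).source u u k j = 0 := by
    simp only [QuadraticModel.source]
    calc _ = (waveNorm k : ℂ) • ∑ i, ∑ n, (∑ j, (k j : ℂ) * transportSymbol k j i n) •
          (nsModel hν T hK hL).conv k (fun l => u l i) (fun l => u l n) := by
          simp only [Finset.smul_sum, Finset.sum_smul]
          rw [Finset.sum_comm]
          refine Finset.sum_congr rfl fun i _ => ?_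
          rw [Finset.sum_comm]
          refine Finset.sum_congr rfl fun n _ => Finset.sum_congr rfl fun j _ => ?_
          change (k j : ℂ) • (waveNorm k : ℂ) • (transportSymbol k j i n • _) = _
          simp only [smul_smul]
          congr 1
          ring
      _ = 0 := by
          simp only [sum_mul_transportSymbol, zero_smul, Finset.sum_const_zero, smul_zero]
  have h2 : ∑ j, (k j : ℂ) * evalAt t (u k j) = 0 := by
    have h3 : ∑ j, (k j : ℂ) * evalAt t (volterra T (rate ν k)
        ((nsModel hν T hK hL).source u u k j)) = 0 := by
      have := congrArg (fun f => evalAt t (volterra T (rate ν k) f)) h1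
      simpa only [map_sum, map_smul, map_zero, smul_eq_mul] using this
    calc _ = (waveNorm k : ℂ) * Complex.exp (-(rate ν k : ℂ) * t) *
          (∑ j, (k j : ℂ) * coeff v₀ k j) + ∑ j, (k j : ℂ) * evalAt t (volterra T (rate ν k)
        ((nsModel hν T hK hL).source u u k j)) := by
          rw [Finset.mul_sum, ← Finset.sum_add_distrib]
          refine Finset.sum_congr rfl fun j _ => ?_
          rw [evalAt_solution hν hK hL h0 hu k j ht]
          ring
      _ = 0 := by rw [h3, sum_mul_coeff_eq_zero h0.integrable hdiv, mul_zero, add_zero]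
  calc _ = amp ν k t * (((waveNorm k)⁻¹ : ℝ) : ℂ) * ∑ j, (k j : ℂ) * evalAt t (u k j) := by
        rw [Finset.mul_sum]
        exact Finset.sum_congr rfl fun j _ => by rw [velCoeff]; ring
    _ = 0 := by rw [h2, mul_zero]

/-- The Duhamel integral is at most `|t|` times the norm of its source, and the heat flow is
continuous at 0. The zero mode is excluded because it was divided out in `velCoeff`. -/
theorem tendsto_velCoeff
    (hu : u = heatFlow hν T h0 + (nsModel hν T hK hL).quad u u)
    {k : Fin 3 → ℤ} (hk : k ≠ 0) (j : Fin 3) :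
    Filter.Tendsto (velCoeff ν u j k) (nhdsWithin 0 (sector T)) (nhds (coeff v₀ k j)) := by
  have h1 : Filter.Tendsto (fun t => evalAt t (volterra T (rate ν k)
      ((nsModel hν T hK hL).source u u k j))) (nhdsWithin 0 (sector T)) (nhds 0) := by
    refine squeeze_zero_norm' (a := fun t : ℂ => ‖t‖ * ‖(nsModel hν T hK hL).source u u k j‖) ?_ ?_
    · filter_upwards [self_mem_nhdsWithin] with t ht using norm_evalAt_volterra_le _ _ ht
    · have : Continuous fun t : ℂ => ‖t‖ * ‖(nsModel hν T hK hL).source u u k j‖ :=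
        continuous_norm.mul continuous_const
      have h := this.tendsto 0
      rw [norm_zero, zero_mul] at h
      exact h.mono_left nhdsWithin_le_nhds
  have h2 : Filter.Tendsto (fun t : ℂ => (waveNorm k : ℂ) * coeff v₀ k j *
      Complex.exp (-(rate ν k : ℂ) * t)) (nhdsWithin 0 (sector T))
      (nhds ((waveNorm k : ℂ) * coeff v₀ k j)) := by
    have : Continuous fun t : ℂ => (waveNorm k : ℂ) * coeff v₀ k j *
      Complex.exp (-(rate ν k : ℂ) * t) := by fun_prop
    have h := this.tendsto 0
    rw [mul_zero, Complex.exp_zero, mul_one] at h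
    exact h.mono_left nhdsWithin_le_nhds
  have h3 : Filter.Tendsto (fun t => amp ν k t * (((waveNorm k)⁻¹ : ℝ) : ℂ))
      (nhdsWithin 0 (sector T)) (nhds (((waveNorm k)⁻¹ : ℝ) : ℂ)) := by
    have h := ((differentiable_amp ν k).continuous.mul
      (continuous_const (y := (((waveNorm k)⁻¹ : ℝ) : ℂ)))).tendsto 0
    have h1 : amp ν k 0 = 1 := by rw [amp, mul_zero, Complex.exp_zero]
    rw [Pi.mul_apply, h1, one_mul] at h
    exact h.mono_left nhdsWithin_le_nhds
  have h4 := h3.mul (h2.add h1)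
  have hw := waveNorm_ne_zero hk
  have h5 : (((waveNorm k)⁻¹ : ℝ) : ℂ) * ((waveNorm k : ℂ) * coeff v₀ k j + 0) = coeff v₀ k j := by
    push_cast; field_simp; ring
  rw [h5] at h4
  refine h4.congr' ?_
  filter_upwards [self_mem_nhdsWithin] with t ht
  rw [velCoeff, evalAt_solution hν hK hL h0 hu k j ht]

theorem velCoeff_neg_of_reflect (hrefl : QuadraticModel.reflect (conjHol T) u = u)
    (k : Fin 3 → ℤ) (j : Fin 3) {t : ℝ} (ht : (t : ℂ) ∈ sector T) :
    velCoeff ν u j (-k) t = conj (velCoeff ν u j k t) := by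
  have h1 : evalAt (t : ℂ) (u (-k) j) = conj (evalAt (t : ℂ) (u k j)) := by
    conv_lhs => rw [← hrefl]
    rw [QuadraticModel.reflect_apply, evalAt_conjHol _ ht, neg_neg, Complex.conj_ofReal]
  rw [velCoeff, velCoeff, h1, map_mul, map_mul, Complex.conj_ofReal, amp, amp, ← Complex.exp_conj,
    map_mul, map_neg, Complex.conj_ofReal, Complex.conj_ofReal, waveNorm_neg]

end Velocity

/-! ### The solution, its initial values and its majorant -/

section Assembly

open scoped ComplexConjugate

variable {T : EReal}

/-- The velocity field with weighted coefficients `u`. -/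
def velField (ν : ℝ) (u : CoeffSpace (SectorHol T)) (q : ℂ × (Fin 3 → ℂ)) : Vec3 :=
  WithLp.toLp 2 fun j => fourierSum (velCoeff ν u j) q

/-- The Fourier coefficients of the velocity field, as vectors. -/
def velVec (ν : ℝ) (u : CoeffSpace (SectorHol T)) (k : Fin 3 → ℤ) (t : ℂ) : Vec3 :=
  WithLp.toLp 2 fun j => velCoeff ν u j k t

theorem norm_toLp_le (w : Fin 3 → ℂ) : ‖(WithLp.toLp 2 w : Vec3)‖ ≤ ∑ j, ‖w j‖ := by
  rw [EuclideanSpace.norm_eq]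
  refine Real.sqrt_le_iff.mpr ⟨Finset.sum_nonneg fun j _ => norm_nonneg _, ?_⟩
  exact Finset.sum_sq_le_sq_sum_of_nonneg fun j _ => norm_nonneg _

theorem summable_norm_velVec {ν : ℝ} (u : CoeffSpace (SectorHol T)) {q : ℂ × (Fin 3 → ℂ)}
    (hq : q ∈ wideDomain ν T) : Summable fun k => ‖character k q.2 • velVec ν u k q.1‖ := by
  refine Summable.of_nonneg_of_le (fun k => norm_nonneg _) (fun k => ?_)
    (summable_sum fun (j : Fin 3) (_ : j ∈ Finset.univ) =>
      (modeBound_velCoeff ν u j).summable hq)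
  rw [norm_smul]
  calc _ ≤ ‖character k q.2‖ * ∑ j, ‖velCoeff ν u j k q.1‖ := by
        gcongr; exact norm_toLp_le _
    _ = _ := by
        rw [Finset.mul_sum]
        exact Finset.sum_congr rfl fun j _ => by rw [norm_mul, mul_comm]

theorem hasSum_velField {ν : ℝ} (u : CoeffSpace (SectorHol T)) {q : ℂ × (Fin 3 → ℂ)}
    (hq : q ∈ wideDomain ν T) :
    HasSum (fun k => character k q.2 • velVec ν u k q.1) (velField ν u q) := by
  have h := (summable_norm_velVec u hq).of_norm
  have h2 : velField ν u q = ∑' k, character k q.2 • velVec ν u k q.1 := by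
    ext j
    have := (EuclideanSpace.proj (𝕜 := ℂ) j : Vec3 →L[ℂ] ℂ).map_tsum h
    refine Eq.trans ?_ this.symm
    change ∑' k, _ = ∑' k, _
    refine tsum_congr fun k => ?_
    simp [velVec, mul_comm]
  rw [h2]
  exact h.hasSum

theorem slice_velField {ν : ℝ} (hν : 0 < ν) (u : CoeffSpace (SectorHol T)) {t : ℂ}
    (ht : t ∈ sector T) : slice (velField ν u) t =
      fun x => ∑' k, character k (realPt x) • velVec ν u k t :=
  funext fun x => (hasSum_velField u (realPt_mem_wideDomain hν ht x)).tsum_eq.symm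

theorem summable_norm_velVec_of_mem_sector {ν : ℝ} (hν : 0 < ν) (u : CoeffSpace (SectorHol T))
    {t : ℂ} (ht : t ∈ sector T) : Summable fun k => ‖velVec ν u k t‖ := by
  have := summable_norm_velVec u (realPt_mem_wideDomain hν ht 0)
  simpa only [norm_smul, norm_character_realPt, one_mul] using this

theorem coeff_slice_velField {ν : ℝ} (hν : 0 < ν) (u : CoeffSpace (SectorHol T)) {t : ℂ}
    (ht : t ∈ sector T) (k : Fin 3 → ℤ) : coeff (slice (velField ν u) t) k = velVec ν u k t := by
  rw [slice_velField hν u ht]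
  exact coeff_series (summable_norm_velVec_of_mem_sector hν u ht) k

theorem integrable_slice_velField {ν : ℝ} (hν : 0 < ν) (u : CoeffSpace (SectorHol T)) {t : ℂ}
    (ht : t ∈ sector T) :
    MeasureTheory.Integrable (slice (velField ν u) t) (MeasureTheory.volume.restrict cell) := by
  rw [slice_velField hν u ht]
  have hs := summable_norm_velVec_of_mem_sector hν u ht
  refine integrable_of_continuous (continuous_series hs) (C := ∑' k, ‖velVec ν u k t‖) fun x => ?_
  refine tsum_of_norm_bounded hs.hasSum fun k => ?_
  rw [norm_smul, norm_character_realPt, one_mul]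

theorem velVec_zero (ν : ℝ) (u : CoeffSpace (SectorHol T)) (t : ℂ) : velVec ν u 0 t = 0 := by
  ext j
  exact velCoeff_zero ν u j t

theorem sum_norm_velCoeff_le (ν : ℝ) (u : CoeffSpace (SectorHol T)) (k : Fin 3 → ℤ) (t : ℂ) :
    ∑ j, ‖velCoeff ν u j k t‖ ≤
      3 * ((waveNorm k)⁻¹ * ‖u k‖) * Real.exp (-t.re * waveNorm k * ν / 2) := by
  refine (Finset.sum_le_sum fun j _ => norm_velCoeff_le ν u j k t).trans_eq ?_
  simp only [Finset.sum_const, Finset.card_univ, Fintype.card_fin, nsmul_eq_mul]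
  push_cast
  ring

theorem memCH1_const {E : Type*} [NormedAddCommGroup E] [NormedSpace ℂ E] {f : (Fin 3 → ℝ) → E}
    (hf : MemH1 f) (I : Set ℝ) : MemCH1 I fun _ => f where
  memH1 _ _ := hf
  continuous t₀ _ := by
    have : h1ENorm (fun x => f x - f x) = 0 := by simp [h1ENorm, coeff]
    rw [this]
    exact tendsto_const_nhds
  bounded := ⟨(h1ENorm f).toReal, fun _ _ => (ENNReal.ofReal_toReal hf.finite_norm.ne).ge⟩

/-- The norm of `u k` already contains the supremum over the sector, so one function of `x` bounds
the modes at all times; the majorant is taken constant in `t`. The factor 3 passes from the maximum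
over components to the sum. -/
theorem exists_majorant (u : CoeffSpace (SectorHol T)) :
    ∃ f : (Fin 3 → ℝ) → ℂ, MemH1 f ∧ ∀ k, coeff f k = ((3 * ((waveNorm k)⁻¹ * ‖u k‖) : ℝ) : ℂ) := by
  set a : (Fin 3 → ℤ) → ℂ := fun k => ((3 * ((waveNorm k)⁻¹ * ‖u k‖) : ℝ) : ℂ) with ha
  have hna : ∀ k, ‖a k‖ = 3 * ((waveNorm k)⁻¹ * ‖u k‖) := fun k => by
    rw [ha, Complex.norm_real, Real.norm_of_nonneg]
    exact mul_nonneg (by norm_num) (mul_nonneg (inv_nonneg.mpr (waveNorm_nonneg k)) (norm_nonneg _))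
  have hsq := (summable_sq_norm u).mul_left 9
  have h1 : ∀ k, ‖a k‖ ^ 2 ≤ 9 * ‖u k‖ ^ 2 := fun k => by
    have h2 : (waveNorm k)⁻¹ ^ 2 ≤ 1 :=
      pow_le_one₀ (inv_nonneg.mpr (waveNorm_nonneg k)) (inv_waveNorm_le_one k)
    calc ‖a k‖ ^ 2 = 9 * ((waveNorm k)⁻¹ ^ 2 * ‖u k‖ ^ 2) := by rw [hna]; ring
      _ ≤ 9 * (1 * ‖u k‖ ^ 2) :=
        mul_le_mul_of_nonneg_left (mul_le_mul_of_nonneg_right h2 (sq_nonneg _)) (by norm_num)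
      _ = _ := by rw [one_mul]
  obtain ⟨f, hf1, hf2, hf3⟩ := exists_coeff_eq
    (Summable.of_nonneg_of_le (fun k => sq_nonneg ‖a k‖) h1 hsq)
  refine ⟨f, ⟨hf1, hf2, ?_, ?_⟩, hf3⟩
  -- The prescribed zeroth coefficient vanishes since `(waveNorm 0)⁻¹ = 0`, and this coefficient is
  -- a multiple of the mean.
  · have h := hf3 0
    simp only [coeff, neg_zero, character_zero, one_smul, ha, waveNorm_zero, inv_zero, zero_mul,
      mul_zero, Complex.ofReal_zero] at h
    exact (smul_eq_zero.mp h).resolve_left (inv_ne_zero two_pi_cube_ne_zero)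
  · rw [h1ENorm_eq]
    · exact ENNReal.ofReal_lt_top
    refine Summable.of_nonneg_of_le (fun k => mul_nonneg (sq_nonneg _) (sq_nonneg _)) (fun k => ?_)
      hsq
    rw [hf3, ← mul_pow]
    change (waveNorm k * ‖a k‖) ^ 2 ≤ _
    by_cases hk : k = 0
    · rw [hk, waveNorm_zero, zero_mul, zero_pow two_ne_zero]
      exact mul_nonneg (by norm_num) (sq_nonneg _)
    · have := waveNorm_pos hk
      rw [hna]
      refine le_of_eq ?_
      field_simp
      norm_num
      ring

theorem fourierSum_periodic (a : (Fin 3 → ℤ) → ℂ → ℂ) (q : ℂ × (Fin 3 → ℂ)) (i : Fin 3) :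
    fourierSum a (q.1, q.2 + Pi.single i (2 * Real.pi : ℂ)) = fourierSum a q := by
  simp only [fourierSum, character_add_single]

variable {ν : ℝ} (hν : 0 < ν) {K : ℝ} (hK : 0 ≤ K)
  (hL : ∀ k, waveNorm k ^ 4 * ‖volterra T (rate ν k)‖ ^ 2 ≤ K ^ 2 * √(waveNorm k))
  {v₀ : (Fin 3 → ℝ) → Vec3} (h0 : MemH1 v₀) {u : CoeffSpace (SectorHol T)}

theorem hasSum_transport (hdiv : ∀ k, ∀ t ∈ sector T, ∑ j, (k j : ℂ) * velCoeff ν u j k t = 0)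
    {q : ℂ × (Fin 3 → ℂ)} (hq : q ∈ wideDomain ν T) (j : Fin 3) :
    HasSum (fun k => (Complex.I * ∑ l, (k l : ℂ) * prodCoeff hν hK hL u l j k q.1) *
      character k q.2)
      (∑ l, fourierSum (velCoeff ν u l) q * dx l (fourierSum (velCoeff ν u j)) q) := by
  have ha := fun l => modeBound_velCoeff ν u l
  have h1 := fun l => hasSum_mul_series ((ha l).summable hq) (((ha j).mul_coord l).summable hq)
  have h2 := hasSum_sum fun (l : Fin 3) (_ : l ∈ Finset.univ) => (h1 l).2
  have h3 : ∀ l, dx l (fourierSum (velCoeff ν u j)) q =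
      ∑' k, Complex.I * k l * velCoeff ν u j k q.1 * character k q.2 := fun l =>
    (ha j).dx_eq hν hq l
  simp only [h3]
  refine h2.congr_fun fun k => ?_
  rw [← Finset.sum_mul]
  congr 1
  have hs : ∀ l : Fin 3, Summable fun m => velCoeff ν u l m q.1 *
      (Complex.I * ((k - m) l : ℤ) * velCoeff ν u j (k - m) q.1) := fun l => (h1 l).1 k
  have hp := fun l => hasSum_prodCoeff hν hK hL u l j k hq.1
  rw [← Summable.tsum_finsetSum fun l _ => hs l, Finset.mul_sum]
  have h4 : ∀ l : Fin 3, Complex.I * ((k l : ℂ) * prodCoeff hν hK hL u l j k q.1) =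
      ∑' m, Complex.I * (k l : ℂ) * (velCoeff ν u l m q.1 * velCoeff ν u j (k - m) q.1) :=
    fun l => by rw [tsum_mul_left, (hp l).tsum_eq, mul_assoc]
  simp only [h4]
  rw [← Summable.tsum_finsetSum fun l _ => (hp l).summable.mul_left _]
  refine tsum_congr fun m => ?_
  -- The derivative falls on the mode `k - m`. Replacing `k - m` by `k` changes the sum by a
  -- multiple of the divergence of mode `m`, which is zero; this puts transport in conservative
  -- form.
  have h5 : ∑ l, velCoeff ν u l m q.1 *
      (Complex.I * ((k - m) l : ℤ) * velCoeff ν u j (k - m) q.1) =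
      ∑ l, Complex.I * (k l : ℂ) * (velCoeff ν u l m q.1 * velCoeff ν u j (k - m) q.1) -
      Complex.I * velCoeff ν u j (k - m) q.1 * ∑ l, (m l : ℂ) * velCoeff ν u l m q.1 := by
    rw [Finset.mul_sum, ← Finset.sum_sub_distrib]
    refine Finset.sum_congr rfl fun l _ => ?_
    rw [Pi.sub_apply]
    push_cast
    ring
  rw [h5, hdiv m _ hq.1, mul_zero, sub_zero]

/-- The projected and the unprojected transport terms differ by a multiple of `k`, hence by a
gradient; this is what determines `pressureCoeff`. -/
theorem transport_balance (k : Fin 3 → ℤ) (j : Fin 3) (t : ℂ) :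
    ∑ i, ∑ n, transportSymbol k j i n * prodCoeff hν hK hL u i n k t +
      Complex.I * ∑ l, (k l : ℂ) * prodCoeff hν hK hL u l j k t =
      -(Complex.I * k j * pressureCoeff hν hK hL u k t) := by
  have h1 : ∀ i : Fin 3, ∑ n, transportSymbol k j i n * prodCoeff hν hK hL u i n k t =
      -(Complex.I * (k i * prodCoeff hν hK hL u i j k t)) +
      Complex.I * k j * ∑ n, (k i * k n : ℂ) / (waveNorm k : ℂ) ^ 2 *
        prodCoeff hν hK hL u i n k t := fun i => by
    have h2 : ∑ n, (if j = n then (1 : ℂ) else 0) * prodCoeff hν hK hL u i n k t =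
        prodCoeff hν hK hL u i j k t := by simp
    rw [← h2, Finset.mul_sum, Finset.mul_sum, Finset.mul_sum, ← Finset.sum_neg_distrib,
      ← Finset.sum_add_distrib]
    refine Finset.sum_congr rfl fun n _ => ?_
    rw [transportSymbol]
    ring
  simp only [h1, Finset.sum_add_distrib, Finset.sum_neg_distrib, ← Finset.mul_sum, pressureCoeff]
  ring

theorem solvesNS
    (hu : u = heatFlow hν T h0 + (nsModel hν T hK hL).quad u u)
    {α : ℝ} (hα : 0 < α) (hα1 : α ≤ 1) (hdiv : WeakDivFree v₀) :
    SolvesNS ν (domainQ ν α T) (velField ν u) (fourierSum (pressureCoeff hν hK hL u)) := by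
  have ha := fun l => modeBound_velCoeff ν u l
  have hd : ∀ k, ∀ t ∈ sector T, ∑ j, (k j : ℂ) * velCoeff ν u j k t = 0 := fun k t ht =>
    sum_mul_velCoeff hν hK hL h0 hu hdiv k ht
  refine ⟨fun q hq j => ?_, fun q hq => ?_⟩
  · have hq := domainQ_subset_wideDomain hν hα hα1 T hq
    change dt (fourierSum (velCoeff ν u j)) q +
      ∑ l, fourierSum (velCoeff ν u l) q * dx l (fourierSum (velCoeff ν u j)) q =
      -dx j (fourierSum (pressureCoeff hν hK hL u)) q +
        (ν : ℂ) * ∑ l, dx l (dx l (fourierSum (velCoeff ν u j))) q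
    have h1 := ((ha j).hasSum_dt hν hq).add (hasSum_transport hν hK hL hd hq j)
    have h2 := ((modeBound_pressureCoeff hν hK hL u).hasSum_dx hν hq j).neg.add
      ((hasSum_sum fun (l : Fin 3) (_ : l ∈ Finset.univ) =>
        (ha j).hasSum_dx_dx hν hq l).mul_left (ν : ℂ))
    refine h1.unique (h2.congr_fun fun k => ?_)
    have h3 := (hasDerivAt_velCoeff hν hK hL h0 hu k j hq.1).deriv
    have h4 := transport_balance hν hK hL (u := u) k j q.1
    have h5 : ∑ l, -(k l : ℂ) ^ 2 * velCoeff ν u j k q.1 * character k q.2 =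
        -(waveNorm k : ℂ) ^ 2 * velCoeff ν u j k q.1 * character k q.2 := by
      rw [ofReal_sq_waveNorm, ← Finset.sum_neg_distrib, Finset.sum_mul, Finset.sum_mul]
    rw [h3, h5]
    linear_combination character k q.2 * h4
  · have hq := domainQ_subset_wideDomain hν hα hα1 T hq
    change ∑ l, dx l (fourierSum (velCoeff ν u l)) q = 0
    have h1 := hasSum_sum fun (l : Fin 3) (_ : l ∈ Finset.univ) => (ha l).hasSum_dx hν hq l
    refine h1.unique (hasSum_zero.congr_fun fun k => ?_)
    calc _ = Complex.I * (∑ l, (k l : ℂ) * velCoeff ν u l k q.1) * character k q.2 := by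
          rw [Finset.mul_sum, Finset.sum_mul]
          exact Finset.sum_congr rfl fun l _ => by ring
      _ = 0 := by rw [hd k _ hq.1, mul_zero, zero_mul]

theorem tendsto_initial
    (hu : u = heatFlow hν T h0 + (nsModel hν T hK hL).quad u u) : Filter.Tendsto
    (fun t : ℂ => h1ENorm (fun x => v₀ x - slice (velField ν u) t x))
    (nhdsWithin 0 (sector T)) (nhds 0) := by
  have hs0 := summable_of_h1ENorm_lt_top h0.finite_norm
  -- The dominating series is independent of `t`: `(a + b)² ≤ 2a² + 2b²` with `b = 3‖u k‖` gives the
  -- constants 2 and 18.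
  have hbs := (hs0.mul_left 2).add ((summable_sq_norm u).mul_left 18)
  have hcoeff : ∀ t ∈ sector T, ∀ k, coeff (fun x => v₀ x - slice (velField ν u) t x) k =
      coeff v₀ k - velVec ν u k t := fun t ht k => by
    rw [coeff_sub h0.integrable (integrable_slice_velField hν u ht), coeff_slice_velField hν u ht]
  have hbound : ∀ t ∈ sector T, ∀ k, ‖waveNorm k ^ 2 * ‖coeff v₀ k - velVec ν u k t‖ ^ 2‖ ≤
      2 * (waveNorm k ^ 2 * ‖coeff v₀ k‖ ^ 2) + 18 * ‖u k‖ ^ 2 := fun t ht k => by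
    have hw := waveNorm_nonneg k
    have hn : waveNorm k * ‖velVec ν u k t‖ ≤ 3 * ‖u k‖ := by
      by_cases hk : k = 0
      · rw [hk, waveNorm_zero, zero_mul]; exact mul_nonneg (by norm_num) (norm_nonneg _)
      have hw0 := waveNorm_pos hk
      have h1 := (norm_toLp_le fun j => velCoeff ν u j k t).trans (sum_norm_velCoeff_le ν u k t)
      have h2 : Real.exp (-t.re * waveNorm k * ν / 2) ≤ 1 := by
        rw [Real.exp_le_one_iff]
        have := re_pos_of_mem_sector ht
        have : 0 ≤ t.re * waveNorm k * ν := by positivity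
        linarith
      have h3 : 0 ≤ 3 * ((waveNorm k)⁻¹ * ‖u k‖) :=
        mul_nonneg (by norm_num) (mul_nonneg (inv_nonneg.mpr hw) (norm_nonneg _))
      have h4 : ‖velVec ν u k t‖ ≤ 3 * ((waveNorm k)⁻¹ * ‖u k‖) :=
        h1.trans (mul_le_of_le_one_right h3 h2)
      calc _ ≤ waveNorm k * (3 * ((waveNorm k)⁻¹ * ‖u k‖)) := by gcongr
        _ = _ := by field_simp
    rw [Real.norm_of_nonneg (mul_nonneg (sq_nonneg _) (sq_nonneg _)), ← mul_pow, ← mul_pow]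
    calc _ ≤ (waveNorm k * ‖coeff v₀ k‖ + 3 * ‖u k‖) ^ 2 := by
          refine pow_le_pow_left₀ (mul_nonneg hw (norm_nonneg _)) ?_ 2
          calc _ ≤ waveNorm k * (‖coeff v₀ k‖ + ‖velVec ν u k t‖) := by
                gcongr; exact norm_sub_le _ _
            _ ≤ _ := by rw [mul_add]; gcongr
      _ ≤ _ := by nlinarith [sq_nonneg (waveNorm k * ‖coeff v₀ k‖ - 3 * ‖u k‖)]
  have hlim : ∀ k, Filter.Tendsto (fun t => waveNorm k ^ 2 * ‖coeff v₀ k - velVec ν u k t‖ ^ 2)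
      (nhdsWithin 0 (sector T)) (nhds 0) := fun k => by
    by_cases hk : k = 0
    · simp only [hk, waveNorm_zero, zero_pow two_ne_zero, zero_mul]
      exact tendsto_const_nhds
    have h1 : Filter.Tendsto (velVec ν u k) (nhdsWithin 0 (sector T)) (nhds (coeff v₀ k)) := by
      have h2 : Filter.Tendsto (fun t j => velCoeff ν u j k t) (nhdsWithin 0 (sector T))
          (nhds fun j => coeff v₀ k j) :=
        tendsto_pi_nhds.mpr fun j => tendsto_velCoeff hν hK hL h0 hu hk j
      exact ((PiLp.continuous_toLp 2 _).tendsto _).comp h2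
    have h3 := (((tendsto_const_nhds (x := coeff v₀ k)).sub h1).norm.pow 2).const_mul
      (waveNorm k ^ 2)
    rwa [sub_self, norm_zero, zero_pow two_ne_zero, mul_zero] at h3
  have h1 : Filter.Tendsto (fun t => ∑' k, waveNorm k ^ 2 * ‖coeff v₀ k - velVec ν u k t‖ ^ 2)
      (nhdsWithin 0 (sector T)) (nhds 0) := by
    have := tendsto_tsum_of_dominated_convergence hbs hlim
      (by filter_upwards [self_mem_nhdsWithin] with t ht using hbound t ht)
    rwa [tsum_zero] at this
  have h2 : Filter.Tendsto (fun t => ENNReal.ofReal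
      (√(∑' k, waveNorm k ^ 2 * ‖coeff v₀ k - velVec ν u k t‖ ^ 2)))
      (nhdsWithin 0 (sector T)) (nhds 0) := by
    have := (ENNReal.continuous_ofReal.comp Real.continuous_sqrt).tendsto 0
    simp only [Function.comp, Real.sqrt_zero, ENNReal.ofReal_zero] at this
    exact this.comp h1
  refine h2.congr' ?_
  filter_upwards [self_mem_nhdsWithin] with t ht
  rw [h1ENorm_eq]
  · simp only [hcoeff t ht]
  · simp only [hcoeff t ht]
    exact Summable.of_norm_bounded hbs (hbound t ht)

theorem velField_real (hrefl : QuadraticModel.reflect (conjHol T) u = u) {t : ℝ}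
    (ht : (t : ℂ) ∈ sector T) (x : Fin 3 → ℝ) (j : Fin 3) :
    (slice (velField ν u) t x j).im = 0 := by
  rw [← Complex.conj_eq_iff_im]
  change conj (∑' k, velCoeff ν u j k t * character k (realPt x)) =
    ∑' k, velCoeff ν u j k t * character k (realPt x)
  rw [Complex.conj_tsum, ← (Equiv.neg (Fin 3 → ℤ)).tsum_eq fun k =>
    velCoeff ν u j k t * character k (realPt x)]
  refine tsum_congr fun k => ?_
  rw [map_mul, conj_character_realPt, Equiv.neg_apply, velCoeff_neg_of_reflect hrefl k j ht]

theorem isAnalyticSolution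
    (hu : u = heatFlow hν T h0 + (nsModel hν T hK hL).quad u u)
    {α : ℝ} (hα : 0 < α) (hα1 : α ≤ 1) (hdiv : WeakDivFree v₀)
    (hrefl : (∀ x i, (v₀ x i).im = 0) → QuadraticModel.reflect (conjHol T) u = u) :
    ∃ v V, IsAnalyticSolution ν α T v₀ v V := by
  obtain ⟨f, hf, hfk⟩ := exists_majorant u
  have hsub := domainQ_subset_wideDomain hν hα hα1 T
  refine ⟨velField ν u, fun _ => f, ?_⟩
  exact
    { holomorphic := by
        refine differentiableOn_euclidean.mpr fun j q hq => ?_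
        exact ((modeBound_velCoeff ν u j).differentiableAt hν (hsub hq)).differentiableWithinAt
      periodic := fun q _ i => by
        simp only [velField, fourierSum_periodic]
      solves := ⟨fourierSum (pressureCoeff hν hK hL u),
        fun q hq => ((modeBound_pressureCoeff hν hK hL u).differentiableAt hν
          (hsub hq)).differentiableWithinAt,
        fun q _ i => fourierSum_periodic _ q i,
        solvesNS hν hK hL h0 hu hα hα1 hdiv⟩
      fourier := fun q hq => by
        have h1 := hasSum_velField u (hsub hq)
        simp only [coeff_slice_velField hν u hq.1]
        refine (hasSum_subtype_iff_of_support_subset (s := {k : Fin 3 → ℤ | k ≠ 0}) ?_).mpr h1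
        intro k hk h2
        subst h2
        exact hk (by simp only [velVec_zero, smul_zero])
      initial := tendsto_initial hν hK hL h0 hu
      real := fun hr t ht x i => velField_real (hrefl hr) ht x i
      majorant_mem := memCH1_const hf _
      majorant_real := fun t _ k => by rw [hfk, Complex.ofReal_im]
      majorant := fun t ht k _ => by
        rw [coeff_slice_velField hν u ht, hfk, Complex.ofReal_re]
        exact sum_norm_velCoeff_le ν u k t }

end Assembly

/-! ### Existence and the choice of constants -/

section Existence

/-- Existence of an analytic solution under a smallness condition. -/
theorem exists_isAnalyticSolution {ν : ℝ} (hν : 0 < ν) {T : EReal} {K : ℝ} (hK : 0 ≤ K)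
    (hL : ∀ k, waveNorm k ^ 4 * ‖volterra T (rate ν k)‖ ^ 2 ≤ K ^ 2 * √(waveNorm k))
    {α : ℝ} (hα : 0 < α) (hα1 : α ≤ 1) {v₀ : (Fin 3 → ℝ) → Vec3}
    (h0 : MemH1 v₀) (hdiv : WeakDivFree v₀)
    (hs : 144 * √latticeConst * K * h1Norm v₀ ≤ 1) : ∃ v V, IsAnalyticSolution ν α T v₀ v V := by
  obtain ⟨u, hu, huniq⟩ := (nsModel hν T hK hL).exists_solution (heatFlow hν T h0)
    (le_trans (mul_le_mul_of_nonneg_left (norm_heatFlow_le hν T h0)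
      (mul_nonneg (by positivity) hK)) hs)
  refine isAnalyticSolution hν hK hL h0 hu hα hα1 hdiv fun hr => ?_
  refine QuadraticModel.reflect_eq_of_solution conjHol_mul (fun k l => ?_) (fun k a => ?_)
    conj_transportSymbol_neg (reflect_heatFlow hν T h0 hr) hu huniq
  · refine (conjHol_decay (product_rate_nonneg hν (-k) (-l))).trans
      (decay_congr _ (product_rate_nonneg hν k l) ?_)
    have : -k - -l = -(k - l) := by abel
    rw [this, waveNorm_neg, waveNorm_neg, waveNorm_neg]
  · change conjHol T (volterra T (rate ν (-k)) a) = _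
    rw [conjHol_volterra, rate_neg]
    rfl

end Existence

end

end NSTorus

theorem theorem2p1 (ν : ℝ) (hν : 0 < ν) :
    ∃ c : ℝ, 0 < c ∧ ∃ μ : ℝ, 0 < μ ∧
      ∀ α : ℝ, 0 < α → (∀ x : Fin 3 → ℂ, α * ‖x‖ ≤ NSTorus.normEucl x) →
      ∀ v₀ : (Fin 3 → ℝ) → NSTorus.Vec3, NSTorus.MemH1 v₀ → NSTorus.WeakDivFree v₀ →
        (∃ v V, NSTorus.IsAnalyticSolution ν α
          ((c / (1 + NSTorus.h1Norm v₀) ^ 16 : ℝ) : EReal) v₀ v V) ∧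
        (NSTorus.h1Norm v₀ ≤ μ →
          ∃ v V, NSTorus.IsAnalyticSolution ν α (⊤ : EReal) v₀ v V) := by
  have hC : 0 < √NSTorus.latticeConst := Real.sqrt_pos.mpr NSTorus.latticeConst_pos
  set C := √NSTorus.latticeConst with hCdef
  set d : ℝ := (144 * C)⁻¹ with hd
  have hd0 : 0 < d := by positivity
  -- The smallness condition reads `K * h1Norm v₀ ≤ d`. For finite time `K = d / (1 + R) ^ 2`, and
  -- equality in `2 ^ 15 * S ≤ ν ^ 7 * K ^ 8` yields both `c` and the exponent `16 = 2 * 8`. For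
  -- infinite time `K = 4 / ν`, whence `μ = ν * d / 4`.
  refine ⟨ν ^ 7 * d ^ 8 / 2 ^ 15, by positivity, ν * d / 4, by positivity,
    fun α hα hcomp v₀ h0 hdiv => ⟨?_, fun hsmall => ?_⟩⟩
  · have hR : 0 ≤ NSTorus.h1Norm v₀ := ENNReal.toReal_nonneg
    set R := NSTorus.h1Norm v₀ with hRdef
    refine NSTorus.exists_isAnalyticSolution hν (K := d / (1 + R) ^ 2) (by positivity)
      (NSTorus.volterra_rate_bound_time hν (by positivity) (le_of_eq ?_)) hα
      (NSTorus.le_one_of_norm_comparison hcomp) h0 hdiv ?_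
    · field_simp
    · rw [← hRdef, ← hCdef]
      have h1 : R ≤ (1 + R) ^ 2 := by nlinarith
      calc 144 * C * (d / (1 + R) ^ 2) * R = R / (1 + R) ^ 2 := by rw [hd]; field_simp
        _ ≤ 1 := div_le_one_of_le₀ h1 (by positivity)
  · refine NSTorus.exists_isAnalyticSolution hν (K := 4 / ν) (by positivity)
      (NSTorus.volterra_rate_bound hν ⊤) hα (NSTorus.le_one_of_norm_comparison hcomp) h0 hdiv ?_
    rw [← hCdef]
    calc 144 * C * (4 / ν) * NSTorus.h1Norm v₀ ≤ 144 * C * (4 / ν) * (ν * d / 4) := by gcongr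
      _ = 1 := by rw [hd]; field_simp
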